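/- **Setting.** There are $n\ge 1$ agents; agent $i$ has a private value $v_i\in[0,v_{\max}]$ for being served, drawn independently from a prior $F_i$ (an arbitrary Borel probability law on $[0,v_{\max}]$). A cost function assigns to every set $T$ of served agents a cost $c(T)\in[0,\infty]$, with $c(\emptyset)=0$ (general costs). In a general feasibility setting all costs are $0$ or $\infty$. The welfare of serving $T$ at values $v$ is $\sum_{i\in T}v_i-c(T)$. Let $\mu_{\max}=\max_i \mathbb E[v_i]>0$. A (randomized) algorithm $\mathcal A$ maps valuation profiles to sets of served agents; its expected welfare over $v\sim F_1\times\dots\times F_n$ and its own coins is also denoted $\mathcal A\in[-\infty,\infty)$. **Oracle model.** A reduction is a randomized mechanism that receives the bids and knows the numbers $n,v_{\max},\mu_{\max},\varepsilon$, but otherwise has only oracle access to the instance. It proceeds in rounds. In each round it chooses adaptively one subinterval $[a_i,b_i)$ per agent and obtains independent samples of $F_i$ conditioned on $[a_i,b_i)$ (or is told that the interval has probability $0$); then it chooses adaptively a profile, runs $\mathcal A$ on it with fresh coins, and sees the set returned and the cost of that set. Finally it outputs a set of served agents and a payment for every agent. Its runtime is the (worst-case) number of calls to $\mathcal A$, including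 those made for computing payments. The mechanism is Bayesian incentive compatible (BIC) if expected payments exist and, for every agent, every value $v\ge0$ and every bid $z\ge 0$, bidding $v$ gives an agent of value $v$ at least as much expected utility (value if served, minus payment) as bidding $z$, when the other agents bid their true values, drawn from their priors; expectations are also over all coins of the mechanism, the oracles and $\mathcal A$. **Theorem.** For every $\varepsilon>0$ (and every $n$, $v_{\max}$, $\mu_{\max}$) there is a reduction that, for all costs, all priors with these parameters and every algorithm $\mathcal A$, is a BIC mechanism $\hat{\mathcal A}_\varepsilon$ in which an agent bidding $0$ pays $0$ in expectation, and whose expected welfare under truthful bids satisfies $$\hat{\mathcal A}_\varepsilon\ \ge\ \mathcal A-\varepsilon\,\mu_{\max}.$$ Its runtime is $\tilde O\!\left(n^{9}\varepsilon^{-9}\log^{5}\!\big(v_{\max}/(\varepsilon\mu_{\max})\big)\right)$. For general feasibility settings there is such a reduction with runtime $\tilde O\!\left(n^{5}\varepsilon^{-5}\log^{3}\!\big(v_{\max}/(\varepsilon\mu_{\max})\big)\right)$. Here $\tilde O(f)$ means at most $C f\log^{p}f$ with absolute constants $C,p$, and in these runtime bounds $\varepsilon$ is replaced by $1/2$ when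 $\varepsilon>1/2$. -/

import Mathlib

open MeasureTheory ProbabilityTheory
open scoped ENNReal

noncomputable section

namespace BlackBox

/-- A valuation (or bid) profile of `n` agents. -/
abbrev Profile (n : ℕ) : Type := Fin n → ℝ

/-- An allocation, given as the set of agents that are served. -/
abbrev Alloc (n : ℕ) : Type := Finset (Fin n)

/-- A single-parameter Bayesian setting with general costs: a cost for every set of served agents
(serving nobody is free, `∞` means infeasible) and independent priors, where `vmax` is an upper
bound on every valuation. The priors are arbitrary Borel laws; no density is required. -/
structure Setting (n : ℕ) (vmax : ℝ) where
  cost : Alloc n → ℝ≥0∞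
  cost_empty : cost ∅ = 0
  prior : Fin n → Measure ℝ
  prior_prob : ∀ i, IsProbabilityMeasure (prior i)
  prior_support : ∀ i, ∀ᵐ v ∂prior i, v ∈ Set.Icc 0 vmax

attribute [instance] Setting.prior_prob

namespace Setting

variable {n : ℕ} {vmax : ℝ}

/-- The product prior of the valuation profile. -/
def joint (S : Setting n vmax) : Measure (Profile n) := Measure.pi S.prior

/-- The largest expected valuation of an agent. -/
def muMax (S : Setting n vmax) : ℝ := ⨆ i, ∫ v, v ∂S.prior i

/-- General feasibility settings: every allocation costs either `0` or `∞`. -/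
def IsFeasibility (S : Setting n vmax) : Prop := ∀ T, S.cost T = 0 ∨ S.cost T = ∞

/-- Expected social welfare of the random allocation `x` when the random true values are `v`:
expected total value of the served agents minus expected cost (`⊥` if the expected cost is
infinite). -/
def expWelfare (S : Setting n vmax) {Ω : Type*} [MeasurableSpace Ω] (P : Measure Ω)
    (v : Ω → Profile n) (x : Ω → Alloc n) : EReal :=
  ((∫ ω, ∑ i ∈ x ω, v ω i ∂P : ℝ) : EReal) - ((∫⁻ ω, S.cost (x ω) ∂P : ℝ≥0∞) : EReal)

end Setting

/-- A randomized algorithm: it maps a valuation profile and the outcome of its own random coins to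
an allocation. -/
structure Algorithm (n : ℕ) where
  Coins : Type*
  [coinsSpace : MeasurableSpace Coins]
  law : Measure Coins
  [law_prob : IsProbabilityMeasure law]
  run : Profile n × Coins → Alloc n
  measurable_run : Measurable run

attribute [instance] Algorithm.coinsSpace Algorithm.law_prob

/-- Expected welfare of an algorithm on values drawn from the prior. -/
def Algorithm.welfare {n : ℕ} (A : Algorithm n) {vmax : ℝ} (S : Setting n vmax) : EReal :=
  S.expWelfare (S.joint.prod A.law) (fun q => q.1) A.run

/-- Inverse transform sampling: for `u` uniform on `[0, 1]`, a value with law `F` conditioned on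
`[a, b)`. -/
def quantile (F : Measure ℝ) (a b : ℝ) (u : unitInterval) : ℝ :=
  sInf {x | (u : ℝ) * F.real (Set.Ico a b) < F.real (Set.Ico a x)}

theorem quantile_lt_iff (F : Measure ℝ) [IsFiniteMeasure F] {a b : ℝ}
    (h : F (Set.Ico a b) ≠ 0) {u : unitInterval} (hu : u ≠ 1) (y : ℝ) :
    quantile F a b u < y ↔ (u : ℝ) * F.real (Set.Ico a b) < F.real (Set.Ico a y) := by
  have hm : 0 < F.real (Set.Ico a b) := by
    rw [measureReal_def]
    exact ENNReal.toReal_pos h (measure_ne_top _ _)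
  have hu1 : (u : ℝ) < 1 := lt_of_le_of_ne u.2.2 (fun e => hu (Subtype.ext e))
  have hne : {x | (u : ℝ) * F.real (Set.Ico a b) < F.real (Set.Ico a x)}.Nonempty :=
    ⟨b, by simpa using mul_lt_mul_of_pos_right hu1 hm⟩
  have hbd : BddBelow {x | (u : ℝ) * F.real (Set.Ico a b) < F.real (Set.Ico a x)} := by
    refine ⟨a, fun x hx => ?_⟩
    by_contra hxa
    have h1 : Set.Ico a x = ∅ := Set.Ico_eq_empty (fun h2 => hxa h2.le)
    have h2 : (u : ℝ) * F.real (Set.Ico a b) < F.real (Set.Ico a x) := hx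
    rw [h1, measureReal_empty] at h2
    exact absurd h2 (not_lt.2 (mul_nonneg u.2.1 hm.le))
  constructor
  · intro hlt
    obtain ⟨x, hx, hxy⟩ := (csInf_lt_iff hbd hne).1 hlt
    exact lt_of_lt_of_le hx (measureReal_mono (Set.Ico_subset_Ico_right hxy.le))
  · intro hlt
    obtain ⟨s, hs, hsy, hst⟩ := exists_seq_strictMono_tendsto y
    have hU : (⋃ k, Set.Ico a (s k)) = Set.Ico a y := by
      ext x
      simp only [Set.mem_iUnion, Set.mem_Ico]
      constructor
      · rintro ⟨k, h1, h2⟩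
        exact ⟨h1, h2.trans (hsy k)⟩
      · rintro ⟨h1, h2⟩
        obtain ⟨k, hk⟩ := (hst.eventually (lt_mem_nhds h2)).exists
        exact ⟨k, h1, hk⟩
    have hT := tendsto_measure_iUnion_atTop (μ := F)
      (s := fun k => Set.Ico a (s k)) (fun i j hij => Set.Ico_subset_Ico_right (hs.monotone hij))
    rw [hU] at hT
    have hT2 := (ENNReal.tendsto_toReal (measure_ne_top F (Set.Ico a y))).comp hT
    obtain ⟨k, hk⟩ := (hT2.eventually (lt_mem_nhds hlt)).exists
    exact lt_of_le_of_lt (csInf_le hbd hk) (hsy k)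

theorem measurable_quantile (F : Measure ℝ) [IsFiniteMeasure F] {a b : ℝ}
    (h : F (Set.Ico a b) ≠ 0) : Measurable (quantile F a b) := by
  refine measurable_of_Iio fun y => ?_
  have : quantile F a b ⁻¹' Set.Iio y =
      ({1}ᶜ ∩ {u : unitInterval | (u : ℝ) * F.real (Set.Ico a b) < F.real (Set.Ico a y)}) ∪
        ({1} ∩ quantile F a b ⁻¹' Set.Iio y) := by
    ext u
    by_cases hu : u = 1
    · simp [hu]
    · simp [hu, quantile_lt_iff F h hu]
  rw [this]
  refine MeasurableSet.union ((measurableSet_singleton _).compl.inter ?_) ?_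
  · exact measurableSet_lt (by fun_prop) measurable_const
  · exact (Set.subsingleton_singleton.anti Set.inter_subset_left).measurableSet

/-- The sampler has the right law. -/
theorem map_quantile (F : Measure ℝ) [IsFiniteMeasure F] {a b : ℝ}
    (h : F (Set.Ico a b) ≠ 0) :
    (volume : Measure unitInterval).map (quantile F a b) = F[|Set.Ico a b] := by
  have hmeas := measurable_quantile F h
  have : IsProbabilityMeasure (F[|Set.Ico a b]) := cond_isProbabilityMeasure h
  have : IsProbabilityMeasure ((volume : Measure unitInterval).map (quantile F a b)) :=
    Measure.isProbabilityMeasure_map hmeas.aemeasurable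
  have hm : 0 < F.real (Set.Ico a b) := by
    rw [measureReal_def]
    exact ENNReal.toReal_pos h (measure_ne_top _ _)
  have key : ∀ y, (volume : Measure unitInterval).map (quantile F a b) (Set.Iio y)
      = F[|Set.Ico a b] (Set.Iio y) := by
    intro y
    rw [Measure.map_apply hmeas measurableSet_Iio, cond_apply measurableSet_Ico, Set.Ico_inter_Iio]
    have hae : quantile F a b ⁻¹' Set.Iio y =ᵐ[volume]
        {u : unitInterval | (u : ℝ) * F.real (Set.Ico a b) < F.real (Set.Ico a y)} := by
      have h1 : ∀ᵐ u : unitInterval, u ≠ 1 := by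
        simp [ae_iff]
      filter_upwards [h1] with u hu
      exact propext (quantile_lt_iff F h hu y)
    rw [measure_congr hae]
    rcases le_or_gt b y with hby | hyb
    · rw [min_eq_left hby, ENNReal.inv_mul_cancel h (measure_ne_top _ _)]
      have h2 : {u : unitInterval | (u : ℝ) * F.real (Set.Ico a b) < F.real (Set.Ico a y)}
          =ᵐ[volume] Set.univ := by
        have h1 : ∀ᵐ u : unitInterval, u ≠ 1 := by
          simp [ae_iff]
        filter_upwards [h1] with u hu
        have hu1 : (u : ℝ) < 1 := lt_of_le_of_ne u.2.2 (fun e => hu (Subtype.ext e))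
        refine propext ⟨fun _ => trivial, fun _ => ?_⟩
        exact lt_of_lt_of_le (by simpa using mul_lt_mul_of_pos_right hu1 hm)
          (measureReal_mono (Set.Ico_subset_Ico_right hby))
      rw [measure_congr h2, measure_univ]
    · rw [min_eq_right hyb.le]
      have hle : F.real (Set.Ico a y) ≤ F.real (Set.Ico a b) :=
        measureReal_mono (Set.Ico_subset_Ico_right hyb.le)
      have hc : F.real (Set.Ico a y) / F.real (Set.Ico a b) ∈ unitInterval :=
        ⟨div_nonneg measureReal_nonneg hm.le, (div_le_one hm).2 hle⟩
      have h3 : {u : unitInterval | (u : ℝ) * F.real (Set.Ico a b) < F.real (Set.Ico a y)}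
          = Set.Iio ⟨_, hc⟩ := by
        ext u
        rw [Set.mem_Iio, ← Subtype.coe_lt_coe]
        exact (lt_div_iff₀ hm).symm
      rw [h3, unitInterval.volume_Iio]
      simp only
      rw [ENNReal.ofReal_div_of_pos hm, ofReal_measureReal, ofReal_measureReal, mul_comm,
        ENNReal.div_eq_inv_mul, mul_comm]
  refine Measure.ext_of_Ici _ _ fun y => ?_
  rw [← Set.compl_Iio, prob_compl_eq_one_sub measurableSet_Iio,
    prob_compl_eq_one_sub measurableSet_Iio, key y]

/-- The distribution oracle on the window `[w.1, w.2)`, with internal coin `u`: a value drawn from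
`F` conditioned on the window, or `inl ()` if the window has probability zero. -/
def draw (F : Measure ℝ) (w : ℝ × ℝ) (u : unitInterval) : Unit ⊕ ℝ :=
  open Classical in
  if F (Set.Ico w.1 w.2) = 0 then Sum.inl () else Sum.inr (quantile F w.1 w.2 u)

/-- The replies of the distribution oracle that precede one call to the algorithm, one per agent. -/
abbrev Draws (n : ℕ) : Type := Fin n → Unit ⊕ ℝ

/-- The replies of the oracles in one round: the draws, and then the allocation returned by the
algorithm together with its cost. -/
abbrev Reply (n : ℕ) : Type := Draws n × (Alloc n × ℝ≥0∞)

/-- The replies of the first `t` rounds. -/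
abbrev History (n t : ℕ) : Type := Fin t → Reply n

/-- A black-box reduction, i.e. a mechanism with oracle access to an algorithm and to the priors.
It has private coins (`Seed`), receives the bids, and proceeds in `calls` rounds. In each round it
chooses adaptively one subinterval `[a, b)` per agent, receives a sample of each agent's prior
conditioned on that subinterval, then chooses adaptively a profile and runs the algorithm on it with
fresh coins; it sees the allocation returned and the cost of that allocation. In the end it outputs
an allocation and payments. Nothing else about the priors, the costs or the algorithm is accessible
to it. The runtime is `calls`, the number of calls to the algorithm. -/
structure Reduction (n : ℕ) where
  Seed : Type
  [seedSpace : MeasurableSpace Seed]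
  seedLaw : Measure Seed
  [seedLaw_prob : IsProbabilityMeasure seedLaw]
  calls : ℕ
  window (t : ℕ) : Seed × Profile n × History n t → Fin n → ℝ × ℝ
  query (t : ℕ) : (Seed × Profile n × History n t) × Draws n → Profile n
  alloc : Seed × Profile n × History n calls → Alloc n
  pay : Seed × Profile n × History n calls → Fin n → ℝ
  measurable_window : ∀ t, Measurable (window t)
  measurable_query : ∀ t, Measurable (query t)
  measurable_alloc : Measurable alloc
  measurable_pay : Measurable pay

attribute [instance] Reduction.seedSpace Reduction.seedLaw_prob

namespace Reduction

variable {n : ℕ} {vmax : ℝ} (R : Reduction n) (S : Setting n vmax) (A : Algorithm n)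

/-- All coins used in one execution: those of the reduction, and for every round those of the
distribution oracles and those of the algorithm. -/
abbrev Tape : Type _ := R.Seed × (Fin R.calls → (Fin n → unitInterval) × A.Coins)

/-- All coins are independent. -/
def tapeLaw : Measure (R.Tape A) :=
  R.seedLaw.prod (Measure.pi fun _ => (volume : Measure (Fin n → unitInterval)).prod A.law)

/-- The replies in round `t` after history `h`, when the oracles use the coins `u` and `r`. -/
def reply (s : R.Seed) (b : Profile n) (t : ℕ) (h : History n t)
    (u : Fin n → unitInterval) (r : A.Coins) : Reply n :=
  let d : Draws n := fun i => draw (S.prior i) (R.window t (s, b, h) i) (u i)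
  let T : Alloc n := A.run (R.query t ((s, b, h), d), r)
  (d, T, S.cost T)

/-- The first `t` rounds of the execution on bids `b` with coins `τ`. -/
def transcript (b : Profile n) (τ : R.Tape A) : (t : ℕ) → t ≤ R.calls → History n t
  | 0, _ => Fin.elim0
  | t + 1, ht =>
    let h := transcript b τ t (Nat.le_of_succ_le ht)
    Fin.snoc (α := fun _ => Reply n) h
      (R.reply S A τ.1 b t h (τ.2 ⟨t, ht⟩).1 (τ.2 ⟨t, ht⟩).2)

/-- The allocation chosen on bids `b`. -/
def outAlloc (b : Profile n) (τ : R.Tape A) : Alloc n :=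
  R.alloc (τ.1, b, R.transcript S A b τ R.calls le_rfl)

/-- The payments charged on bids `b`. -/
def outPay (b : Profile n) (τ : R.Tape A) : Fin n → ℝ :=
  R.pay (τ.1, b, R.transcript S A b τ R.calls le_rfl)

/-- Expected welfare of the mechanism under truthful bids drawn from the prior. -/
def welfare : EReal :=
  S.expWelfare (S.joint.prod (R.tapeLaw A)) (fun q => q.1) (fun q => R.outAlloc S A q.1 q.2)

/-- Interim allocation probability of agent `i` when bidding `z`, with the bids of the other agents
drawn from the prior. -/
def interimAlloc (i : Fin n) (z : ℝ) : ℝ :=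
  (S.joint.prod (R.tapeLaw A)).real {q | i ∈ R.outAlloc S A (Function.update q.1 i z) q.2}

/-- Interim expected payment of agent `i` when bidding `z`, with the bids of the other agents drawn
from the prior. -/
def interimPay (i : Fin n) (z : ℝ) : ℝ :=
  ∫ q, R.outPay S A (Function.update q.1 i z) q.2 i ∂(S.joint.prod (R.tapeLaw A))

/-- Bayesian incentive compatibility: expected payments exist, and truthful bidding is a best
response of every agent at every value, provided that the other agents bid truthfully. -/
def IsBIC : Prop :=
  ∀ i : Fin n,
    (∀ z, 0 ≤ z → Integrable (fun q : Profile n × R.Tape A =>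
      R.outPay S A (Function.update q.1 i z) q.2 i) (S.joint.prod (R.tapeLaw A))) ∧
    ∀ v z, 0 ≤ v → 0 ≤ z →
      v * R.interimAlloc S A i z - R.interimPay S A i z ≤
        v * R.interimAlloc S A i v - R.interimPay S A i v

/-- The normalization of payments: an agent with value zero pays zero in expectation. -/
def IsNormalized : Prop := ∀ i : Fin n, R.interimPay S A i 0 = 0

end Reduction

/-- The bound `C f log^p f` behind `Õ(f)`. -/
def softO (C : ℝ) (p : ℕ) (f : ℝ) : ℝ := C * f * Real.log f ^ p

/-- `n^a ε^{-b} log^c (vmax / (ε μ))`, with `ε` replaced by `1/2` if it exceeds `1/2`, where the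
expression would lose its meaning. -/
def runtimeScale (a b c n : ℕ) (ε vmax μ : ℝ) : ℝ :=
  (n : ℝ) ^ a * (min ε (1 / 2))⁻¹ ^ b * Real.log (vmax / (min ε (1 / 2) * μ)) ^ c

end BlackBox

end

/-! Pooling. The bid of each agent is replaced by a sample of its prior conditioned on an interval
(a pool) that contains the bid. The pools come from tables of samples that are independent of the
bids, so under truthful bidding each replaced value still has the law of the prior
(`map_draw_pool`). Hence the algorithm is always run on the product prior, which settles the
expected cost and makes the agents independent of each other's pools: a bid z is served with the
average allocation of its own pool. If these averages increase along the pools, the interim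
allocation x is monotone. The payment z (1[served at z] - 1[served at u z]), with u uniform and the
second lottery taken from an additional run, has mean z x(z) - ∫_0^z x, so monotonicity yields
incentive compatibility (`isBIC_of_monotone`).

Exact monotonicity from estimates. The averages are known only up to sampling errors, but
monotonicity must hold exactly. Part of the samples propose a chain of cuts with a level y at each
cut, below which the average of the pool should lie and above which the average of all larger values
should lie. Fresh samples then verify the cuts from the bottom to the top; at the first failure
everything above stays in one pool. For a fixed chain the verifications use disjoint samples, so the
mean allocation obeys a recursion (`chainValue`). A wrong cut c of the range [a, ⊤) must not only
survive a large deviation: a sample of [a, ⊤) must also fall below c. It therefore passes with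
probability at most σ/4 times the conditional mass of [a, c), and that mass times the average of [a,
c) is at most the average of [a, ⊤). So violations of monotonicity are small relative to the
allocation itself, and they disappear after multiplication with a function that grows by a factor 1
+ σ at each grid point (`chainValue_mul_mono`). Such a factor is produced by tests: with probability
ρ a random agent is tested and the allocation is kept only with a probability that increases with
its bid, by 1/J at each of the J grid points. This gives σ = ρ / (n J) at a loss of at most a
fraction ρ of the value (`monotone_interim`).

Small loss of value. For an arbitrary allocation curve, the level sets of its isotonic regression,
with some neighbours merged, form a chain whose averages are separated by a margin and whose pools
have no suffix with an average much above that of the pool (`exists_goodChain`). Both properties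
survive estimation, so with accurate tables a good chain is proposed and completely verified.
Summation by parts turns the suffix condition into a bound for the value lost in a pool
(`pool_value_ge`). Averages over intervals of tiny mass cause problems, so cuts are restricted to a
coarse grid in which successive points enclose observable mass; rounding values up to this grid is
cheap by Markov's inequality (`next_mul_cell_le`). The loss per agent is (ρ + O(δ)) μ, and δ and ρ
of order ε / n give the theorem (`welfare_ge`). A geometric grid with J of order (n/ε) log(vmax/(ε
μ)) points and M of order (n/ε) J log J repetitions suffice, that is about n J^2 M calls. Costs
enter only through their expectation, so the same reduction serves general costs and feasibility
settings. -/

noncomputable section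

namespace BlackBox

/-! ### Chains of cuts -/

section Chains

variable {κ : Type*} [LinearOrder κ] [BoundedOrder κ]

/-- The suffix condition on a pool `[a, c)`: no suffix starting in `G` has a much larger average. -/
def SuffixOK (p : κ → κ → ℝ) (G : Set κ) (s : ℝ) (a c : κ) : Prop :=
  ∀ b ∈ G, a < b → b < c → p b c ≤ p a c + s

/-- A chain of cuts with separating levels: the averages `p` of consecutive pools lie on both sides
of the level of the cut between them, with a gap `g`. -/
def GoodChain (p : κ → κ → ℝ) (G : Set κ) (g s : ℝ) : κ → ℝ → List (κ × ℝ) → Prop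
  | a, _, [] => SuffixOK p G s a ⊤
  | a, lo, (c, y) :: l => c ∈ G ∧ a < c ∧ lo + g ≤ p a c ∧ p a c ≤ y - g ∧ y + g ≤ p c ⊤ ∧
      SuffixOK p G s a c ∧ GoodChain p G g s c y l

/-- A gap compares one average with a fixed level and loses δ; the suffix condition compares two
averages and loses 2δ. -/
theorem GoodChain.perturb {p q : κ → κ → ℝ} {G : Set κ} {g s δ : ℝ}
    (hpq : ∀ a b, a < b → |p a b - q a b| ≤ δ) {l : List (κ × ℝ)} {a : κ} {lo : ℝ}
    (h : GoodChain p G g s a lo l) (ha : a < ⊤) (hG : ∀ b ∈ G, b < ⊤) :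
    GoodChain q G (g - δ) (s + 2 * δ) a lo l := by
  have hS : ∀ a c, a < c → SuffixOK p G s a c → SuffixOK q G (s + 2 * δ) a c := by
    intro a c hac h b hb hab hbc
    have h1 := h b hb hab hbc
    have h2 := abs_le.1 (hpq a c hac)
    have h3 := abs_le.1 (hpq b c hbc)
    linarith
  induction l generalizing a lo with
  | nil => exact hS _ _ ha h
  | cons x l ih =>
    obtain ⟨c, y⟩ := x
    obtain ⟨hc, hac, h1, h2, h3, h4, h5⟩ := h
    have e1 := abs_le.1 (hpq a c hac)
    have e2 := abs_le.1 (hpq c ⊤ (hG c hc))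
    exact ⟨hc, hac, by linarith, by linarith, by linarith, hS _ _ hac h4, ih h5 (hG c hc)⟩

end Chains

/-! ### Separated chains for an arbitrary allocation curve -/

section Existence

variable {κ : Type*} [LinearOrder κ]

/-- A cell starting at `a`: the level set of the isotonic regression of `h` against `f`, at height
`d` above the smallest prefix average `m`. -/
theorem exists_cell {f h : κ → ℝ} {T : Finset κ} {d : ℝ} (hd : 0 < d) {a : κ} (ha : a ∈ T)
    (hTa : ∃ b ∈ T, a < b) (hf : ∀ b ∈ T, ∀ c ∈ T, b < c → f b < f c) :
    ∃ m : ℝ, ∃ c ∈ T, a < c ∧ (∀ b ∈ T, a < b → m * (f b - f a) ≤ h b - h a) ∧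
      (∃ b ∈ T, a < b ∧ h b - h a = m * (f b - f a)) ∧
      (∀ b ∈ T, a ≤ b → b ≤ c → h c - h b ≤ (m + d) * (f c - f b)) ∧
      (∀ b ∈ T, c < b → (m + d) * (f b - f c) < h b - h c) := by
  classical
  -- The point b0 has the smallest prefix average m, and c is the last maximizer of (m + d) f - h
  -- from a on. Maximality bounds the suffix averages that end at c; being the last maximizer makes
  -- all averages that start at c larger than m + d.
  obtain ⟨b0, hb0, hmin⟩ := Finset.exists_min_image (T.filter (a < ·))
    (fun b => (h b - h a) / (f b - f a)) (by
      obtain ⟨b, hb, hab⟩ := hTa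
      exact ⟨b, by simp [hb, hab]⟩)
  simp only [Finset.mem_filter] at hb0 hmin
  set m := (h b0 - h a) / (f b0 - f a) with hm
  have hpos : ∀ b ∈ T, a < b → 0 < f b - f a := fun b hb hab => sub_pos.2 (hf a ha b hb hab)
  set Φ : κ → ℝ := fun t => (m + d) * f t - h t with hΦ
  obtain ⟨t0, ht0, hmax⟩ := Finset.exists_max_image (T.filter (a ≤ ·)) Φ ⟨a, by simp [ha]⟩
  set A := (T.filter (a ≤ ·)).filter (fun t => Φ t0 ≤ Φ t) with hA
  have hAne : A.Nonempty := ⟨t0, by simp only [hA, Finset.mem_filter] at ht0 ⊢; exact ⟨ht0, le_rfl⟩⟩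
  set c := A.max' hAne with hc
  have hcA : c ∈ A := A.max'_mem hAne
  simp only [hA, Finset.mem_filter] at hcA ht0
  simp only [Finset.mem_filter] at hmax
  have hcmax : ∀ b ∈ T, a ≤ b → Φ b ≤ Φ c := fun b hb hab => (hmax b ⟨hb, hab⟩).trans hcA.2
  have hb0eq : h b0 - h a = m * (f b0 - f a) := by
    rw [hm, div_mul_cancel₀ _ (hpos b0 hb0.1 hb0.2).ne']
  -- At b0 the function Φ exceeds its value at a by d (f b0 - f a) > 0, so a is not a maximizer.
  have hac : a < c := by
    refine lt_of_le_of_ne hcA.1.2 fun hEq => ?_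
    have h1 := hcmax b0 hb0.1 hb0.2.le
    rw [← hEq] at h1
    simp only [hΦ] at h1
    have h2 := mul_pos hd (hpos b0 hb0.1 hb0.2)
    nlinarith
  refine ⟨m, c, hcA.1.1, hac, ?_, ⟨b0, hb0.1, hb0.2, hb0eq⟩, ?_, ?_⟩
  · intro b hb hab
    rw [← le_div_iff₀ (hpos b hb hab)]
    exact hmin b ⟨hb, hab⟩
  · intro b hb hab hbc
    have := hcmax b hb hab
    simp only [hΦ] at this
    linarith
  · intro b hb hcb
    by_contra hcon
    have : b ∈ A := by
      simp only [hA, Finset.mem_filter]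
      refine ⟨⟨hb, hac.le.trans hcb.le⟩, hcA.2.trans ?_⟩
      simp only [hΦ]
      linarith
    exact absurd (A.le_max' b this) (not_le.2 hcb)

/-- Every allocation curve has a chain of cuts with well separated levels and small oscillation. -/
theorem exists_goodChain [Fintype κ] [BoundedOrder κ] {f h : κ → ℝ} {G : Finset κ} {d : ℝ} (hd : 0 < d) (hG : ∀ b ∈ G, b < ⊤)
    (hf : ∀ b ∈ insert ⊤ G, ∀ c ∈ insert ⊤ G, b < c → f b < f c) {a : κ} (ha : a ∈ G) {lo : ℝ}
    (hh : ∀ b ∈ insert ⊤ G, ∀ c ∈ insert ⊤ G, b < c → lo + d / 4 ≤ (h c - h b) / (f c - f b)) :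
    ∃ l, GoodChain (fun a b => (h b - h a) / (f b - f a)) (G : Set κ) (d / 4) (3 / 2 * d) a lo l := by
  classical
  set T := insert ⊤ G with hT
  set p : κ → κ → ℝ := fun a b => (h b - h a) / (f b - f a) with hp
  have hGT : ∀ {b}, b ∈ G → b ∈ T := fun hb => by simp [hT, hb]
  have htop : (⊤ : κ) ∈ T := by simp [hT]
  have hTG : ∀ {b}, b ∈ T → b ≠ ⊤ → b ∈ G := fun hb hne => by
    simpa [hT, hne] using hb
  have hcell := fun a : {a // a ∈ G} => exists_cell (f := f) (h := h) hd (hGT a.2)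
    ⟨⊤, htop, hG a a.2⟩ hf
  choose m nx hnxT hlt hmin hatt hsuf hpre using hcell
  have hpe : ∀ b ∈ T, ∀ c ∈ T, b < c → h c - h b = p b c * (f c - f b) := fun b hb c hc hbc => by
    rw [hp]; exact (div_mul_cancel₀ _ (sub_pos.2 (hf b hb c hc hbc)).ne').symm
  have hle : ∀ b ∈ T, ∀ c ∈ T, b < c → ∀ t, h c - h b ≤ t * (f c - f b) → p b c ≤ t :=
    fun b hb c hc hbc t ht => (div_le_iff₀ (sub_pos.2 (hf b hb c hc hbc))).2 ht
  have hge : ∀ b ∈ T, ∀ c ∈ T, b < c → ∀ t, t * (f c - f b) ≤ h c - h b → t ≤ p b c :=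
    fun b hb c hc hbc t ht => (le_div_iff₀ (sub_pos.2 (hf b hb c hc hbc))).2 ht
  have hfp : ∀ b ∈ T, ∀ c ∈ T, b < c → 0 < f c - f b := fun b hb c hc hbc =>
    sub_pos.2 (hf b hb c hc hbc)
  let A : {a // a ∈ G} → ℝ := fun a => p a (nx a)
  have hA1 : ∀ a, m a ≤ A a := fun a => hge _ (hGT a.2) _ (hnxT a) (hlt a) _
    (hmin a _ (hnxT a) (hlt a))
  have hA2 : ∀ a, A a ≤ m a + d := fun a => hle _ (hGT a.2) _ (hnxT a) (hlt a) _
    (hsuf a _ (hGT a.2) le_rfl (hlt a).le)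
  -- The minimal prefix average of the next cell is attained, and every average starting at nx a
  -- exceeds m a + d. So the minima climb by more than d per cell, while the cell averages A, which
  -- lie in [m, m + d], may still be close to each other.
  have hm : ∀ a (hc : nx a ∈ G), m a + d < m ⟨nx a, hc⟩ := by
    intro a hc
    obtain ⟨b, hb, hlt', he⟩ := hatt ⟨nx a, hc⟩
    have := hpre a b hb hlt'
    rw [he] at this
    exact lt_of_mul_lt_mul_right this (hfp _ (hnxT a) _ hb hlt').le
  have hAtop : ∀ a : {a // a ∈ G}, A a ≤ p a ⊤ := by
    intro a
    by_cases hc : nx a = ⊤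
    · simp only [A, hc]; exact le_rfl
    · have hlt2 : nx a < ⊤ := lt_top_iff_ne_top.2 hc
      refine hge _ (hGT a.2) _ htop (hG a a.2) _ ?_
      have h1 := hpre a ⊤ htop hlt2
      have h2 := hpe _ (hGT a.2) _ (hnxT a) (hlt a)
      have h3 := mul_le_mul_of_nonneg_right (hA2 a) (hfp _ (hnxT a) _ htop hlt2).le
      have h4 : h (nx a) - h a = A a * (f (nx a) - f a) := h2
      linarith
  -- Induction on the number of points above a. The list is chosen before lo, because the level of
  -- the preceding cut is fixed only after the rest of the chain is known.
  have key : ∀ N : ℕ, ∀ a : {a // a ∈ G}, (Finset.univ.filter (fun b : κ => (a : κ) < b)).card < N →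
      ∃ l, ∀ lo, lo + d / 4 ≤ A a → GoodChain p (G : Set κ) (d / 4) (3 / 2 * d) a lo l := by
    intro N
    induction N with
    | zero => intro a ha; omega
    | succ N ih =>
      intro a hN
      have hcard : ∀ b : κ, (a : κ) < b →
          (Finset.univ.filter (fun t : κ => b < t)).card < N := by
        intro b hab
        refine lt_of_lt_of_le (Finset.card_lt_card ?_) (Nat.lt_succ_iff.1 hN)
        refine ⟨fun t => by simpa using hab.trans, fun hcon => ?_⟩
        have := hcon (by simpa using hab : b ∈ _)
        simp at this
      have hsufA : SuffixOK p (G : Set κ) (3 / 2 * d) a (nx a) := by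
        intro b hb hab hbc
        have h1 := hle _ (hGT hb) _ (hnxT a) hbc _ (hsuf a b (hGT hb) hab.le hbc.le)
        have := hA1 a
        have h2 : p a (nx a) = A a := rfl
        linarith
      by_cases hc : nx a = ⊤
      · exact ⟨[], fun lo _ => by rw [hc] at hsufA; exact hsufA⟩
      · have hc1 : nx a ∈ G := hTG (hnxT a) hc
        let a1 : {a // a ∈ G} := ⟨nx a, hc1⟩
        have hm1 := hm a hc1
        -- If neighbouring averages differ by at least d / 2, a level at A a + d / 4 separates them.
        -- Otherwise the two cells are merged: the merged average lies in [A a, A a + d / 2), and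
        -- for the cell a2 that follows, A a2 ≥ m a2 > m a1 + d > m a + 2 d ≥ A a + d, so the level
        -- A a + 3 / 4 d separates. Suffixes of the merged pool average at most A a1 + d < A a + 3 /
        -- 2 d.
        by_cases hgap : d / 2 ≤ A a1 - A a
        · obtain ⟨l, hl⟩ := ih a1 (hcard _ (hlt a))
          refine ⟨(nx a, A a + d / 4) :: l, fun lo hlo => ⟨hc1, hlt a, hlo, ?_, ?_, hsufA, ?_⟩⟩
          · show A a ≤ _
            linarith
          · have := hAtop a1
            show _ ≤ p a1 ⊤
            linarith
          · exact hl _ (by linarith)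
        · have hsuf2 : ∀ b ∈ G, (a : κ) < b → b < nx a1 → p b (nx a1) ≤ A a + 3 / 2 * d := by
            intro b hb hab hbc
            have e1 : m a1 ≤ A a1 := hA1 a1
            rcases lt_or_ge b (nx a) with hb1 | hb1
            · refine hle _ (hGT hb) _ (hnxT a1) hbc _ ?_
              have h1 := hsuf a b (hGT hb) hab.le hb1.le
              have h2 := hsuf a1 (nx a) (hnxT a) le_rfl (hlt a1).le
              have h3 : (m a + d) * (f (nx a) - f b) ≤ (A a + 3 / 2 * d) * (f (nx a) - f b) :=
                mul_le_mul_of_nonneg_right (by linarith [hA1 a]) (hfp _ (hGT hb) _ (hnxT a) hb1).le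
              have h4 : (m a1 + d) * (f (nx a1) - f (nx a)) ≤
                  (A a + 3 / 2 * d) * (f (nx a1) - f (nx a)) :=
                mul_le_mul_of_nonneg_right (by linarith) (hfp _ (hnxT a) _ (hnxT a1) (hlt a1)).le
              linarith
            · have h1 := hle _ (hGT hb) _ (hnxT a1) hbc _ (hsuf a1 b (hGT hb) hb1 hbc.le)
              linarith
          have hav1 : A a ≤ p a (nx a1) := by
            refine hge _ (hGT a.2) _ (hnxT a1) ((hlt a).trans (hlt a1)) _ ?_
            have h2 : h (nx a) - h a = A a * (f (nx a) - f a) := hpe _ (hGT a.2) _ (hnxT a) (hlt a)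
            have h3 : h (nx a1) - h (nx a) = A a1 * (f (nx a1) - f (nx a)) :=
              hpe _ (hnxT a) _ (hnxT a1) (hlt a1)
            have h4 : A a * (f (nx a1) - f (nx a)) ≤ A a1 * (f (nx a1) - f (nx a)) :=
              mul_le_mul_of_nonneg_right (by linarith [hA1 a1, hA2 a])
                (hfp _ (hnxT a) _ (hnxT a1) (hlt a1)).le
            linarith
          have hav2 : p a (nx a1) ≤ A a1 := by
            refine hle _ (hGT a.2) _ (hnxT a1) ((hlt a).trans (hlt a1)) _ ?_
            have h2 : h (nx a) - h a = A a * (f (nx a) - f a) := hpe _ (hGT a.2) _ (hnxT a) (hlt a)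
            have h3 : h (nx a1) - h (nx a) = A a1 * (f (nx a1) - f (nx a)) :=
              hpe _ (hnxT a) _ (hnxT a1) (hlt a1)
            have h4 : A a * (f (nx a) - f a) ≤ A a1 * (f (nx a) - f a) :=
              mul_le_mul_of_nonneg_right (by linarith [hA1 a1, hA2 a])
                (hfp _ (hGT a.2) _ (hnxT a) (hlt a)).le
            linarith
          by_cases hc2 : nx a1 = ⊤
          · refine ⟨[], fun lo _ b hb hab hbc => ?_⟩
            rw [← hc2] at hbc ⊢
            linarith [hsuf2 b hb hab hbc]
          · have hc2G : nx a1 ∈ G := hTG (hnxT a1) hc2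
            let a2 : {a // a ∈ G} := ⟨nx a1, hc2G⟩
            have hm2 : m a1 + d < m a2 := hm a1 hc2G
            obtain ⟨l, hl⟩ := ih a2 (hcard _ ((hlt a).trans (hlt a1)))
            have e0 := hA1 a
            have e1 : m a1 ≤ A a1 := hA1 a1
            have e2 := hA1 a2
            have e3 := hA2 a
            have e4 : m a + d < m a1 := hm1
            refine ⟨(nx a1, A a + 3 / 4 * d) :: l,
              fun lo hlo => ⟨hc2G, (hlt a).trans (hlt a1), ?_, ?_, ?_, ?_, hl _ ?_⟩⟩
            · exact hlo.trans hav1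
            · exact hav2.trans (by linarith)
            · have := hAtop a2
              show _ ≤ p a2 ⊤
              linarith
            · intro b hb hab hbc
              linarith [hsuf2 b hb hab hbc]
            · linarith
  obtain ⟨l, hl⟩ := key _ ⟨a, ha⟩ (Nat.lt_succ_self _)
  exact ⟨l, hl lo (hh _ (hGT ha) _ (hnxT _) (hlt ⟨a, ha⟩))⟩

end Existence

/-- Summation by parts: if the suffix sums are nonpositive wherever the weights jump, the weighted
sum is nonpositive. -/
theorem sum_weighted_nonpos {u q : ℕ → ℝ} (hu : Monotone u) {a c : ℕ} (hac : a ≤ c) (h0 : 0 ≤ u a)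
    (ha : q c - q a ≤ 0)
    (hS : ∀ b, a < b → b < c → u (b - 1) ≠ u b → q c - q b ≤ 0) :
    ∑ j ∈ Finset.Ico a c, u j * (q (j + 1) - q j) ≤ 0 := by
  -- Induction from the top: lowering the start from k + 1 to k changes the bound by (u (k + 1) - u
  -- k) times the suffix sum from k + 1, which is zero where u does not jump and nonpositive where
  -- it does.
  have key : ∑ j ∈ Finset.Ico a c, u j * (q (j + 1) - q j) ≤ u a * (q c - q a) := by
    clear ha h0
    induction hac using Nat.decreasingInduction with
    | self => simp
    | of_succ k hk ih =>
      rw [Finset.sum_eq_sum_Ico_succ_bot hk]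
      have h1 := ih fun b hb hbc => hS b (by omega) hbc
      have h2 : (u (k + 1) - u k) * (q c - q (k + 1)) ≤ 0 := by
        rcases eq_or_lt_of_le (Nat.succ_le_of_lt hk) with hEq | hlt
        · simp [← hEq]
        · by_cases hne : u k = u (k + 1)
          · simp [hne]
          · exact mul_nonpos_of_nonneg_of_nonpos (sub_nonneg.2 (hu (Nat.le_succ k)))
              (hS (k + 1) (Nat.lt_succ_self k) hlt (by simpa using hne))
      nlinarith
  exact key.trans (mul_nonpos_of_nonneg_of_nonpos h0 ha)

/-! ### Independent verifications and approximate monotonicity -/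

section Pools

variable {κ : Type*} [LinearOrder κ] [BoundedOrder κ]

open Classical in
/-- The pool of the value `z` when the cuts of the list are made one after the other, from the
bottom to the top, until the first verification `E` fails. -/
def poolOf (E : κ → ℝ → κ → ℝ → Prop) (val : κ → ℝ) : κ → ℝ → List (κ × ℝ) → ℝ → κ × κ
  | a, _, [], _ => (a, ⊤)
  | a, lo, (c, y) :: l, z =>
    if a < c ∧ E a lo c y then if z < val c then (a, c) else poolOf E val c y l z else (a, ⊤)

open Classical in
/-- The expected average of the pool of `z` when the verifications are independent and succeed with
probabilities `e`. -/
def chainValue (p : κ → κ → ℝ) (e : κ → ℝ → κ → ℝ → ℝ) (val : κ → ℝ) :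
    κ → ℝ → List (κ × ℝ) → ℝ → ℝ
  | a, _, [], _ => p a ⊤
  | a, lo, (c, y) :: l, z =>
    if a < c then
      (1 - e a lo c y) * p a ⊤ +
        e a lo c y * (if z < val c then p a c else chainValue p e val c y l z)
    else p a ⊤

variable {p : κ → κ → ℝ} {e : κ → ℝ → κ → ℝ → ℝ} {val : κ → ℝ}

theorem chainValue_nonneg (hp : ∀ a b, 0 ≤ p a b) (he0 : ∀ a lo c y, 0 ≤ e a lo c y)
    (he1 : ∀ a lo c y, e a lo c y ≤ 1) (l : List (κ × ℝ)) (a : κ) (lo z : ℝ) :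
    0 ≤ chainValue p e val a lo l z := by
  induction l generalizing a lo with
  | nil => exact hp _ _
  | cons x l ih =>
    obtain ⟨c, y⟩ := x
    rw [chainValue]
    split_ifs
    · exact add_nonneg (mul_nonneg (sub_nonneg.2 (he1 ..)) (hp ..)) (mul_nonneg (he0 ..) (hp ..))
    · exact add_nonneg (mul_nonneg (sub_nonneg.2 (he1 ..)) (hp ..)) (mul_nonneg (he0 ..) (ih ..))
    · exact hp ..

/-- If wrong cuts pass the verification with a probability that is small relative to the mass below
the cut, the expected allocation becomes monotone after multiplication with a function that grows
by a factor `1 + σ` at each possible cut. -/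
theorem chainValue_mul_mono (hval : StrictMono val) {fr : κ → κ → ℝ} {σ : ℝ} (hσ0 : 0 ≤ σ)
    (hσ1 : σ ≤ 1) (hp : ∀ a b, 0 ≤ p a b) (he0 : ∀ a lo c y, 0 ≤ e a lo c y)
    (he1 : ∀ a lo c y, e a lo c y ≤ 1) (hfr1 : ∀ a c, fr a c ≤ 1)
    (hfr : ∀ a c, a < c → fr a c * p a c ≤ p a ⊤)
    (hbad : ∀ a lo c y, a < c → y < p a c ∨ p c ⊤ < y → e a lo c y ≤ σ / 4 * fr a c)
    (hlow : ∀ a lo c y, a < c → p a c < lo → e a lo c y ≤ σ / 4)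
    {φ : ℝ → ℝ} (hφ0 : ∀ z, 0 ≤ φ z) (hφm : Monotone φ)
    (hφ : ∀ a c z z', a < c → z < val c → val c ≤ z' → (1 + σ) * φ z ≤ φ z')
    (l : List (κ × ℝ)) (a : κ) (lo : ℝ) {z z' : ℝ} (hz : z ≤ z') :
    chainValue p e val a lo l z * φ z ≤ chainValue p e val a lo l z' * φ z' := by
  induction l generalizing a lo z z' with
  | nil => exact mul_le_mul_of_nonneg_left (hφm hz) (hp ..)
  | cons x l ih =>
    obtain ⟨c, y⟩ := x
    rw [chainValue, chainValue]
    by_cases hac : a < c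
    swap
    · rw [if_neg hac, if_neg hac]
      exact mul_le_mul_of_nonneg_left (hφm hz) (hp ..)
    rw [if_pos hac, if_pos hac]
    set ee := e a lo c y with hee
    have h0 : 0 ≤ ee := he0 ..
    have h1 : ee ≤ 1 := he1 ..
    have hU : 0 ≤ p a ⊤ := hp ..
    have hφz := hφm hz
    by_cases hz' : z' < val c
    · rw [if_pos hz', if_pos (hz.trans_lt hz')]
      exact mul_le_mul_of_nonneg_left hφz
        (add_nonneg (mul_nonneg (sub_nonneg.2 h1) hU) (mul_nonneg h0 (hp ..)))
    rw [if_neg hz']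
    have hz'c := not_lt.1 hz'
    by_cases hzc : z < val c
    swap
    · rw [if_neg hzc]
      have h2 := mul_le_mul_of_nonneg_left (ih c y hz) h0
      have h3 := mul_le_mul_of_nonneg_left hφz (mul_nonneg (sub_nonneg.2 h1) hU)
      linarith
    rw [if_pos hzc]
    set W := chainValue p e val c y l (val c) with hW
    have hW0 : 0 ≤ W := chainValue_nonneg hp he0 he1 ..
    have h2 := mul_le_mul_of_nonneg_left (ih c y hz'c) h0
    have h3 := mul_le_mul_of_nonneg_left (hφm hz'c) (mul_nonneg (sub_nonneg.2 h1) hU)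
    have hjump := hφ a c z (val c) hac hzc le_rfl
    have hL : 0 ≤ p a c := hp ..
    -- Only a pair with z < val c ≤ z' is critical; there φ gains the factor 1 + σ, and above val c
    -- the induction hypothesis takes over.
    suffices hs : (1 - ee) * p a ⊤ + ee * p a c ≤ (1 + σ) * ((1 - ee) * p a ⊤ + ee * W) by
      have h4 := mul_le_mul_of_nonneg_right hs (hφ0 z)
      have h5 := mul_le_mul_of_nonneg_left hjump
        (add_nonneg (mul_nonneg (sub_nonneg.2 h1) hU) (mul_nonneg h0 hW0))
      linarith
    -- Wrong cut: the pool below c contributes at most ee * p a c ≤ σ / 4 * fr a c * p a c ≤ σ / 4 *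
    -- p a ⊤, while the factor 1 + σ gains σ (1 - ee) p a ⊤ ≥ 3 / 4 * σ * p a ⊤ on the event of
    -- failure.
    by_cases hb : y < p a c ∨ p c ⊤ < y
    · have h4 := hbad a lo c y hac hb
      have h5 : ee * p a c ≤ σ / 4 * p a ⊤ :=
        (mul_le_mul_of_nonneg_right h4 hL).trans (by
          rw [mul_assoc]; exact mul_le_mul_of_nonneg_left (hfr a c hac) (by linarith))
      have h6 : ee ≤ 1 / 4 := h4.trans (by nlinarith [hfr1 a c])
      have h7 : 3 / 4 * (σ * p a ⊤) ≤ (1 - ee) * (σ * p a ⊤) :=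
        mul_le_mul_of_nonneg_right (by linarith) (mul_nonneg hσ0 hU)
      have h8 := mul_nonneg h0 hW0
      have h9 := mul_nonneg hσ0 h8
      have h10 := mul_nonneg hσ0 hU
      nlinarith
    · push Not at hb
      -- Correct cut: p a c ≤ y ≤ p c ⊤. The value W just above c mixes p c ⊤ with the average p c
      -- c' of the next pool. If the latter is below y, the next cut violates its lower level and
      -- passes with probability at most σ / 4; then W ≥ (1 - σ / 4) y, and (1 + σ) (1 - σ / 4) ≥ 1.
      have hWL : p a c ≤ (1 + σ) * W := by
        have hUy : y ≤ p c ⊤ := hb.2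
        have triv : ∀ t, y ≤ t → p a c ≤ (1 + σ) * t := fun t ht => by
          nlinarith [mul_nonneg hσ0 (hL.trans (hb.1.trans ht))]
        rcases l with _ | ⟨⟨c', y'⟩, l⟩
        · exact triv _ hUy
        · rw [hW, chainValue]
          split_ifs with hcc hv
          · set e' := e c y c' y' with he'
            by_cases hp' : p c c' < y
            · have h4 : e' ≤ σ / 4 := hlow c y c' y' hcc hp'
              have h5 : 0 ≤ e' * p c c' := mul_nonneg (he0 ..) (hp ..)
              have h6 : 1 ≤ (1 + σ) * (1 - e') := by nlinarith [he0 c y c' y']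
              have h7 : 0 ≤ p c ⊤ := hp ..
              nlinarith
            · refine triv _ ?_
              have h4 := mul_le_mul_of_nonneg_left (not_lt.1 hp') (he0 c y c' y')
              have h5 := mul_le_mul_of_nonneg_left hUy (sub_nonneg.2 (he1 c y c' y'))
              linarith
          · exact absurd (hval hcc) hv
          · exact triv _ hUy
      have h4 := mul_le_mul_of_nonneg_left hWL h0
      have h5 := mul_nonneg hσ0 (mul_nonneg (sub_nonneg.2 h1) hU)
      linarith

end Pools

/-! ### Independence in finite product spaces -/

section Independence

variable {ι : Type*} [Fintype ι] {α : ι → Type*} [∀ i, MeasurableSpace (α i)]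
  (μ : ∀ i, Measure (α i)) [∀ i, IsProbabilityMeasure (μ i)]

theorem iIndepFun_coordinates {τ : Type*} {r : τ → ι} (hr : Function.Injective r) :
    iIndepFun (fun t (ω : ∀ i, α i) => ω (r t)) (Measure.pi μ) := by
  have h := iIndepFun_pi (μ := μ) (X := fun i (x : α i) => x) (fun i => aemeasurable_id)
  exact h.precomp hr

/-- Each function factors through the restriction to its set of coordinates, the missing coordinates
being filled in from a fixed point, and disjoint blocks of independent coordinates are independent.
-/
theorem indepFun_of_dependsOn {β γ : Type*} [MeasurableSpace β] [MeasurableSpace γ]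
    {f : (∀ i, α i) → β} {g : (∀ i, α i) → γ} (hf : Measurable f) (hg : Measurable g)
    {S T : Set ι} (hST : Disjoint S T) (hfS : DependsOn f S) (hgT : DependsOn g T) :
    IndepFun f g (Measure.pi μ) := by
  classical
  have hne : ∀ i, Nonempty (α i) := fun i => (μ i).nonempty_of_neZero
  let ω0 : ∀ i, α i := fun i => Classical.arbitrary _
  let ext : ∀ U : Finset ι, (∀ i : U, α i) → ∀ i, α i :=
    fun U x i => if h : i ∈ U then x ⟨i, h⟩ else ω0 i
  have hext : ∀ U, Measurable (ext U) := fun U => by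
    refine measurable_pi_lambda _ fun i => ?_
    by_cases h : i ∈ U
    · simpa [ext, h] using measurable_pi_apply (⟨i, h⟩ : U)
    · simp [ext, h]
  have h1 := iIndepFun.indepFun_finset S.toFinset T.toFinset (by simpa using hST)
    (iIndepFun_coordinates μ Function.injective_id) (fun i => measurable_pi_apply i)
  have h2 := h1.comp (hf.comp (hext S.toFinset)) (hg.comp (hext T.toFinset))
  convert h2 using 1
  · funext ω
    exact hfS fun i hi => by simp [ext, hi]
  · funext ω
    exact hgT fun i hi => by simp [ext, hi]

theorem pi_real_forall_mem {τ : Type*} [Fintype τ] {r : τ → ι} (hr : Function.Injective r)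
    {B : ∀ t, Set (α (r t))} (hB : ∀ t, MeasurableSet (B t)) :
    (Measure.pi μ).real {ω | ∀ t, ω (r t) ∈ B t} = ∏ t, (μ (r t)).real (B t) := by
  have h := (iIndepFun_coordinates μ hr).measure_inter_preimage_eq_mul Finset.univ
    (sets := B) (fun t _ => hB t)
  have hset : {ω : ∀ i, α i | ∀ t, ω (r t) ∈ B t} =
      ⋂ t ∈ Finset.univ, (fun ω : ∀ i, α i => ω (r t)) ⁻¹' B t := by
    ext ω; simp
  rw [hset, measureReal_def, h, ENNReal.toReal_prod]
  refine Finset.prod_congr rfl fun t _ => ?_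
  rw [measureReal_def, (measurePreserving_eval μ (r t)).measure_preimage (hB t).nullMeasurableSet]

/-- Hoeffding's inequality for the frequency of independent events. -/
theorem hoeffding_frequency {M : ℕ} (hM : 0 < M) {r : Fin M → ι} (hr : Function.Injective r)
    {X : ∀ m, α (r m) → ℝ} (hX : ∀ m, Measurable (X m)) (hX01 : ∀ m x, X m x ∈ Set.Icc (0 : ℝ) 1)
    {q δ : ℝ} (hδ : 0 ≤ δ) (hq : ∀ m, ∫ x, X m x ∂μ (r m) = q) :
    (Measure.pi μ).real {ω | (∑ m, X m (ω (r m))) / M ≤ q - δ} ≤ Real.exp (-2 * M * δ ^ 2) ∧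
    (Measure.pi μ).real {ω | q + δ ≤ (∑ m, X m (ω (r m))) / M} ≤ Real.exp (-2 * M * δ ^ 2) := by
  have hMr : (0 : ℝ) < M := by exact_mod_cast hM
  have hint : ∀ m, ∫ ω, X m (ω (r m)) ∂(Measure.pi μ) = q := fun m => by
    rw [← hq m, ← (measurePreserving_eval μ (r m)).map_eq,
      integral_map (measurable_pi_apply _).aemeasurable (hX m).aestronglyMeasurable]
  have hind : iIndepFun (fun m (ω : ∀ i, α i) => X m (ω (r m)) - q) (Measure.pi μ) :=
    (iIndepFun_coordinates μ hr).comp (fun m x => X m x - q) (fun m => (hX m).sub_const q)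
  have hsub : ∀ m, HasSubgaussianMGF (fun ω : ∀ i, α i => X m (ω (r m)) - q)
      ((‖(1 : ℝ) - 0‖₊ / 2) ^ 2) (Measure.pi μ) := fun m => by
    have := hasSubgaussianMGF_of_mem_Icc (μ := Measure.pi μ)
      (X := fun ω : ∀ i, α i => X m (ω (r m))) (a := 0) (b := 1)
      ((hX m).comp (measurable_pi_apply _)).aemeasurable
      (Filter.Eventually.of_forall fun ω => hX01 m _)
    rwa [hint m] at this
  have hc : ((∑ m : Fin M, ((‖(1 : ℝ) - 0‖₊ / 2) ^ 2 : NNReal) : NNReal) : ℝ) = M / 4 := by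
    rw [NNReal.coe_sum]
    simp
    ring
  have hexp : -((M : ℝ) * δ) ^ 2 / (2 * (M / 4)) = -2 * M * δ ^ 2 := by
    field_simp
    ring
  have hsum : ∀ ω : ∀ i, α i, ∑ m, (X m (ω (r m)) - q) = ∑ m, X m (ω (r m)) - M * q := fun ω => by
    simp [Finset.sum_sub_distrib]
  constructor
  · have h := HasSubgaussianMGF.measure_sum_ge_le_of_iIndepFun
      (X := fun m (ω : ∀ i, α i) => -(X m (ω (r m)) - q)) (μ := Measure.pi μ)
      (hind.comp (fun _ x => -x) (fun _ => measurable_neg)) (s := Finset.univ)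
      (fun m _ => (hsub m).neg) (ε := M * δ) (by positivity)
    rw [hc, hexp] at h
    refine (measureReal_mono ?_).trans h
    intro ω hω
    simp only [Set.mem_ofPred_eq] at hω ⊢
    rw [div_le_iff₀ hMr] at hω
    rw [Finset.sum_neg_distrib, hsum]
    linarith
  · have h := HasSubgaussianMGF.measure_sum_ge_le_of_iIndepFun hind (s := Finset.univ)
      (fun m _ => hsub m) (ε := M * δ) (by positivity)
    rw [hc, hexp] at h
    refine (measureReal_mono ?_).trans h
    intro ω hω
    simp only [Set.mem_ofPred_eq] at hω ⊢
    rw [le_div_iff₀ hMr] at hω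
    rw [hsum]
    linarith

end Independence

/-! ### Tables of samples -/

/-- The rounds devoted to one agent: two grid points, one of five purposes, and a repetition. -/
abbrev RoundIdx (J M : ℕ) : Type := Fin (J + 1) × Fin (J + 1) × Fin 5 × Fin M

/-- What is remembered of a round: whether the agent was served, and the grid points above the
sampled value. -/
abbrev Datum (J : ℕ) : Type := Bool × (Fin (J + 1) → Bool)

abbrev Table (J M : ℕ) : Type := RoundIdx J M → Datum J

namespace Table

variable {J M : ℕ}

/-- Empirical frequency of service. -/
def est (ω : Table J M) (k : Fin 5) (a c : Fin (J + 1)) : ℝ :=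
  (∑ m : Fin M, if (ω (a, c, k, m)).1 then (1 : ℝ) else 0) / M

/-- Evidence for a substantial conditional mass below the grid point `b`. -/
def Flag (ω : Table J M) (a b : Fin (J + 1)) : Prop := ∀ c, ∃ m, (ω (a, c, 1, m)).2 b = true

/-- The verification of a cut. -/
def Verified (δ : ℝ) (ω : Table J M) (a : Fin (J + 1)) (lo : ℝ) (c : Fin (J + 1)) (y : ℝ) : Prop :=
  (ω.est 2 a c ≤ y - δ ∧ lo + δ ≤ ω.est 2 a c ∧ y + δ ≤ ω.est 3 a c) ∧
    ∃ b m, (ω (a, b, 4, m)).2 c = true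

/-- The laws of the entries of the table of an agent: `p` are the average allocations in intervals,
`fr a b` is the conditional mass of `[a, b)` given `[a, ⊤)`. -/
structure IsLaw (ν : RoundIdx J M → Measure (Datum J)) (p fr : Fin (J + 1) → Fin (J + 1) → ℝ) :
    Prop where
  prob : ∀ r, IsProbabilityMeasure (ν r)
  bit0 : ∀ a c m, (ν (a, c, 0, m)).real {x | x.1 = true} = p a c
  bit2 : ∀ a c m, (ν (a, c, 2, m)).real {x | x.1 = true} = p a c
  bit3 : ∀ a c m, (ν (a, c, 3, m)).real {x | x.1 = true} = p c ⊤
  hit1 : ∀ a c m b, (ν (a, c, 1, m)).real {x | x.2 b = true} = fr a b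
  hit4 : ∀ a c m b, (ν (a, c, 4, m)).real {x | x.2 b = true} = fr a b

variable {ν : RoundIdx J M → Measure (Datum J)} {p fr : Fin (J + 1) → Fin (J + 1) → ℝ} {δ : ℝ}

theorem est_tail (hν : IsLaw ν p fr) (hM : 0 < M) (hδ : 0 ≤ δ) {k : Fin 5} {a c : Fin (J + 1)}
    {q : ℝ} (hq : ∀ m, (ν (a, c, k, m)).real {x | x.1 = true} = q) :
    (Measure.pi ν).real {ω : Table J M | ω.est k a c ≤ q - δ} ≤ Real.exp (-2 * M * δ ^ 2) ∧
    (Measure.pi ν).real {ω : Table J M | q + δ ≤ ω.est k a c} ≤ Real.exp (-2 * M * δ ^ 2) := by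
  have := hν.prob
  refine hoeffding_frequency ν hM (r := fun m : Fin M => (a, c, k, m))
    (fun m m' h => by simpa using h) (X := fun m x => if x.1 = true then (1 : ℝ) else 0)
    (fun m => .of_discrete) (fun m x => by split_ifs <;> simp) hδ fun m => ?_
  rw [← hq m, ← integral_indicator_one (MeasurableSet.of_discrete)]
  congr 1
  funext x
  simp [Set.indicator_apply]

/-- A cut that starts at a reads only row a, and only the purposes 2, 3, 4. The starting points
increase along a chain, so its verifications are independent of each other and of the proposal,
which reads the purposes 0 and 1. -/
theorem dependsOn_verified {a : Fin (J + 1)} {lo y : ℝ} {c : Fin (J + 1)} :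
    DependsOn (fun ω : Table J M => Verified δ ω a lo c y) {r | r.1 = a ∧ 2 ≤ r.2.2.1} := by
  intro (ω : Table J M) (ω' : Table J M) h
  have h2 : ω.est 2 a c = ω'.est 2 a c := by
    simp only [est]
    congr 1
    refine Finset.sum_congr rfl fun m _ => ?_
    rw [h (a, c, 2, m) (by simp)]
  have h3 : ω.est 3 a c = ω'.est 3 a c := by
    simp only [est]
    congr 1
    refine Finset.sum_congr rfl fun m _ => ?_
    rw [h (a, c, 3, m) ⟨rfl, (by decide : (2 : Fin 5) ≤ 3)⟩]
  have h4 : (∃ b m, (ω (a, b, 4, m)).2 c = true) ↔ ∃ b m, (ω' (a, b, 4, m)).2 c = true := by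
    refine exists_congr fun b => exists_congr fun m => ?_
    rw [h (a, b, 4, m) ⟨rfl, (by decide : (2 : Fin 5) ≤ 4)⟩]
  simp only [Verified, h2, h3, h4]

theorem dependsOn_poolOf {val : Fin (J + 1) → ℝ} (l : List (Fin (J + 1) × ℝ)) (a : Fin (J + 1))
    (lo z : ℝ) :
    DependsOn (fun ω : Table J M => poolOf (Verified δ ω) val a lo l z)
      {r | a ≤ r.1 ∧ 2 ≤ r.2.2.1} := by
  induction l generalizing a lo with
  | nil => intro ω ω' _; rfl
  | cons x l ih =>
    obtain ⟨c, y⟩ := x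
    intro ω ω' h
    simp only [poolOf]
    by_cases hac : a < c
    swap
    · simp [hac]
    have h1 : Verified δ ω a lo c y = Verified δ ω' a lo c y :=
      dependsOn_verified fun r hr => h r ⟨hr.1.ge, hr.2⟩
    have h2 : poolOf (Verified δ ω) val c y l z = poolOf (Verified δ ω') val c y l z :=
      ih c y fun r hr => h r ⟨hac.le.trans hr.1, hr.2⟩
    rw [h1, h2]

/-- The first verification reads row a and the remaining ones read rows from c > a on. The
expectation therefore factors at every cut. -/
theorem integral_poolOf (hν : IsLaw ν p fr) {val : Fin (J + 1) → ℝ} (l : List (Fin (J + 1) × ℝ))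
    (a : Fin (J + 1)) (lo z : ℝ) :
    ∫ ω, (fun w => p w.1 w.2) (poolOf (Verified δ ω) val a lo l z) ∂(Measure.pi ν) =
      chainValue p (fun a lo c y => (Measure.pi ν).real {ω | Verified δ ω a lo c y}) val a lo l z := by
  classical
  have := hν.prob
  induction l generalizing a lo with
  | nil => simp [poolOf, chainValue]
  | cons x l ih =>
    obtain ⟨c, y⟩ := x
    by_cases hac : a < c
    swap
    · simp [poolOf, chainValue, hac]
    simp only [poolOf, chainValue, hac, true_and, if_true]
    set P := Measure.pi ν
    set Y : Table J M → ℝ := fun ω =>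
      if z < val c then p a c else (fun w => p w.1 w.2) (poolOf (Verified δ ω) val c y l z) with hY
    set I : Table J M → ℝ := fun ω => if Verified δ ω a lo c y then 1 else 0 with hI
    have hYint : ∫ ω, Y ω ∂P = if z < val c then p a c else
        chainValue p (fun a lo c y => P.real {ω | Verified δ ω a lo c y}) val c y l z := by
      simp only [hY]
      split_ifs
      · simp
      · exact ih c y
    have hIint : ∫ ω, I ω ∂P = P.real {ω | Verified δ ω a lo c y} := by
      rw [← integral_indicator_one (MeasurableSet.of_discrete)]
      congr 1
    have hind : IndepFun I Y P := by
      refine indepFun_of_dependsOn ν .of_discrete .of_discrete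
        (S := {r | r.1 = a ∧ 2 ≤ r.2.2.1}) (T := {r | c ≤ r.1 ∧ 2 ≤ r.2.2.1}) ?_ ?_ ?_
      · rw [Set.disjoint_left]
        rintro r ⟨h1, -⟩ ⟨h2, -⟩
        exact absurd (h1 ▸ h2) (not_le.2 hac)
      · intro ω ω' h
        have h1 : Verified δ ω a lo c y = Verified δ ω' a lo c y := dependsOn_verified h
        simp only [hI, h1]
      · intro ω ω' h
        have h1 := dependsOn_poolOf (δ := δ) (val := val) l c y z h
        simp only at h1
        simp only [hY, h1]
    have hmul : ∫ ω, I ω * Y ω ∂P = (∫ ω, I ω ∂P) * ∫ ω, Y ω ∂P :=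
      hind.integral_fun_mul_eq_mul_integral Measurable.of_discrete.aestronglyMeasurable
        Measurable.of_discrete.aestronglyMeasurable
    rw [← hYint, ← hIint]
    have hpt : ∀ ω : Table J M, (fun w : Fin (J + 1) × Fin (J + 1) => p w.1 w.2)
        (if Verified δ ω a lo c y then
          if z < val c then (a, c) else poolOf (Verified δ ω) val c y l z else (a, ⊤)) =
        (1 - I ω) * p a ⊤ + I ω * Y ω := by
      intro ω
      simp only [hI, hY]
      split_ifs <;> simp
    rw [integral_congr_ae (Filter.Eventually.of_forall hpt),
      integral_add Integrable.of_finite Integrable.of_finite, hmul, integral_mul_const,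
      integral_sub Integrable.of_finite Integrable.of_finite]
    simp

/-- Union bound over all draws of purpose 4 in row a. The factor fr a c is the reason for this
purpose: it makes false cuts rare in proportion to the mass that they affect. -/
theorem real_hit_le (hν : IsLaw ν p fr) (a c : Fin (J + 1)) :
    (Measure.pi ν).real {ω : Table J M | ∃ b m, (ω (a, b, 4, m)).2 c = true} ≤
      (J + 1) * M * fr a c := by
  have := hν.prob
  have hset : {ω : Table J M | ∃ b m, (ω (a, b, 4, m)).2 c = true} =
      ⋃ t ∈ (Finset.univ : Finset (Fin (J + 1) × Fin M)),
        {ω : Table J M | (ω (a, t.1, 4, t.2)).2 c = true} := by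
    ext ω; simp
  rw [hset]
  refine (measureReal_biUnion_finset_le _ _).trans ?_
  have : ∀ t : Fin (J + 1) × Fin M, (Measure.pi ν).real
      {ω : Table J M | (ω (a, t.1, 4, t.2)).2 c = true} = fr a c := fun t => by
    rw [← hν.hit4 a t.1 t.2 c, measureReal_def, measureReal_def,
      ← (measurePreserving_eval ν (a, t.1, 4, t.2)).measure_preimage
        (MeasurableSet.of_discrete).nullMeasurableSet]
    rfl
  simp [this]

/-- A wrong level requires a deviation by δ of the estimate of purpose 2 or 3, and the hit of
purpose 4 is independent of it, so Hoeffding's bound and the bound for the hit multiply. -/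
theorem real_verified_le_of_bad (hν : IsLaw ν p fr) (hM : 0 < M) (hδ : 0 ≤ δ) {a c : Fin (J + 1)}
    {lo y : ℝ} (h : y < p a c ∨ p c ⊤ < y) :
    (Measure.pi ν).real {ω | Verified δ ω a lo c y} ≤
      Real.exp (-2 * M * δ ^ 2) * ((J + 1) * M * fr a c) := by
  have := hν.prob
  have key : ∃ k : Fin 5, (k = 2 ∨ k = 3) ∧ ∃ B : Set ℝ,
      (∀ ω : Table J M, Verified δ ω a lo c y → ω.est k a c ∈ B) ∧
      (Measure.pi ν).real {ω : Table J M | ω.est k a c ∈ B} ≤ Real.exp (-2 * M * δ ^ 2) := by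
    rcases h with h | h
    · refine ⟨2, .inl rfl, Set.Iic (p a c - δ), fun ω hω => ?_,
        (est_tail hν hM hδ (fun m => hν.bit2 a c m)).1⟩
      exact hω.1.1.trans (by linarith)
    · refine ⟨3, .inr rfl, Set.Ici (p c ⊤ + δ), fun ω hω => ?_,
        (est_tail hν hM hδ (fun m => hν.bit3 a c m)).2⟩
      exact le_trans (by linarith) hω.1.2.2
  obtain ⟨k, hk, B, hB, hP⟩ := key
  set H : Table J M → Prop := fun ω => ∃ b m, (ω (a, b, 4, m)).2 c = true with hH
  have hind : IndepFun (fun ω : Table J M => ω.est k a c ∈ B) H (Measure.pi ν) := by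
    refine indepFun_of_dependsOn ν .of_discrete .of_discrete
      (S := {r | r.2.2.1 = k}) (T := {r | r.2.2.1 = 4}) ?_ ?_ ?_
    · rw [Set.disjoint_left]
      rintro r h1 h2
      simp only [Set.mem_ofPred_eq] at h1 h2
      rw [h1] at h2
      rcases hk with rfl | rfl <;> exact absurd h2 (by decide)
    · intro (ω : Table J M) (ω' : Table J M) h
      have h2 : ω.est k a c = ω'.est k a c := by
        simp only [est]
        congr 1
        refine Finset.sum_congr rfl fun m _ => ?_
        rw [h (a, c, k, m) rfl]
      simp only [h2]
    · intro ω ω' h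
      refine propext (exists_congr fun b => exists_congr fun m => ?_)
      rw [h (a, b, 4, m) rfl]
  have h1 := hind.measure_inter_preimage_eq_mul {True} {True} .of_discrete .of_discrete
  have h2 : (Measure.pi ν).real {ω | Verified δ ω a lo c y} ≤
      (Measure.pi ν).real {ω : Table J M | ω.est k a c ∈ B} * (Measure.pi ν).real {ω | H ω} := by
    rw [measureReal_def, measureReal_def, measureReal_def, ← ENNReal.toReal_mul]
    refine ENNReal.toReal_mono (by finiteness) ?_
    have e1 : (fun ω : Table J M => ω.est k a c ∈ B) ⁻¹' {True} = {ω | ω.est k a c ∈ B} := by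
      ext; simp
    have e2 : H ⁻¹' {True} = {ω | H ω} := by ext; simp
    rw [e1, e2] at h1
    rw [← h1]
    exact measure_mono fun ω hω => ⟨hB ω hω, hω.2⟩
  exact h2.trans (mul_le_mul hP (real_hit_le hν a c) measureReal_nonneg (Real.exp_pos _).le)

theorem real_verified_le_of_low (hν : IsLaw ν p fr) (hM : 0 < M) (hδ : 0 ≤ δ) {a c : Fin (J + 1)}
    {lo y : ℝ} (h : p a c < lo) :
    (Measure.pi ν).real {ω | Verified δ ω a lo c y} ≤ Real.exp (-2 * M * δ ^ 2) := by
  have := hν.prob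
  refine (measureReal_mono fun ω hω => ?_).trans (est_tail hν hM hδ (fun m => hν.bit2 a c m)).2
  exact le_trans (by linarith) hω.1.2.1

/-- The tables that represent the laws of their entries well. -/
structure Accurate (p fr : Fin (J + 1) → Fin (J + 1) → ℝ) (δ θ : ℝ) (ω : Table J M) : Prop where
  est0 : ∀ a c, |p a c - ω.est 0 a c| ≤ δ
  est2 : ∀ a c, |p a c - ω.est 2 a c| ≤ δ
  est3 : ∀ a c, |p c ⊤ - ω.est 3 a c| ≤ δ
  flag : ∀ a b, θ ≤ fr a b → ω.Flag a b
  mass : ∀ a b, ω.Flag a b → 1 / (2 * M) < fr a b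
  hit : ∀ a c, 1 / (2 * M) < fr a c → ∃ b m, (ω (a, b, 4, m)).2 c = true

/-- Union bound over pairs of grid points. Hoeffding's inequality covers three estimates on two
sides. A mass of at least θ is missed by one of the J + 1 batches of purpose 1 with probability at
most (J + 1) exp(-θM). The threshold 1 / (2M) separates the two kinds of hits: a smaller mass rarely
meets every batch of purpose 1, and a larger one is rarely missed by all (J + 1) M draws of purpose
4. -/
theorem real_not_accurate_le (hν : IsLaw ν p fr) (hM : 0 < M) (hδ : 0 ≤ δ) {θ : ℝ}
    (hfr1 : ∀ a c, fr a c ≤ 1) :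
    (Measure.pi ν).real {ω : Table J M | ¬ Accurate p fr δ θ ω} ≤
      (J + 1) ^ 2 * (6 * Real.exp (-2 * M * δ ^ 2) + (J + 1) * Real.exp (-(θ * M)) +
        2 * Real.exp (-((J + 1) / 2))) := by
  classical
  have := hν.prob
  have hMr : (0 : ℝ) < M := by exact_mod_cast hM
  set P := Measure.pi ν with hP
  have hfr0 : ∀ a c, 0 ≤ fr a c := fun a c => by
    rw [← hν.hit1 a a ⟨0, hM⟩ c]; exact measureReal_nonneg
  have two : ∀ (k : Fin 5) (a c : Fin (J + 1)) (q : ℝ),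
      (∀ m, (ν (a, c, k, m)).real {x | x.1 = true} = q) →
      P.real {ω : Table J M | ¬ |q - ω.est k a c| ≤ δ} ≤ 2 * Real.exp (-2 * M * δ ^ 2) := by
    intro k a c q hq
    obtain ⟨h1, h2⟩ := est_tail hν hM hδ hq
    have h3 : {ω : Table J M | ¬ |q - ω.est k a c| ≤ δ} ⊆
        {ω : Table J M | ω.est k a c ≤ q - δ} ∪ {ω : Table J M | q + δ ≤ ω.est k a c} := by
      intro ω hω
      simp only [Set.mem_ofPred_eq, not_le, lt_abs] at hω
      rcases hω with h | h
      · left; simp only [Set.mem_ofPred_eq]; linarith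
      · right; simp only [Set.mem_ofPred_eq]; linarith
    linarith [(measureReal_mono h3 (μ := P)).trans (measureReal_union_le _ _)]
  have compl : ∀ (k : Fin 5) (a b c : Fin (J + 1)) (m : Fin M),
      (ν (a, c, k, m)).real {x | x.2 b = true} = fr a b →
      (ν (a, c, k, m)).real {x | ¬ x.2 b = true} = 1 - fr a b := by
    intro k a b c m h
    have := probReal_compl_eq_one_sub (μ := ν (a, c, k, m)) (s := {x | x.2 b = true})
      MeasurableSet.of_discrete
    rw [h] at this
    exact this
  have hF : ∀ a b, P.real {ω : Table J M | ¬ (θ ≤ fr a b → ω.Flag a b)} ≤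
      (J + 1) * Real.exp (-(θ * M)) := by
    intro a b
    by_cases hθ : θ ≤ fr a b
    swap
    · simp only [hθ, false_imp_iff, not_true_eq_false, Set.ofPred_false, measureReal_empty]
      positivity
    have hset : {ω : Table J M | ¬ (θ ≤ fr a b → ω.Flag a b)} =
        ⋃ c ∈ (Finset.univ : Finset (Fin (J + 1))),
          {ω : Table J M | ∀ m, ω (a, c, 1, m) ∈ {x : Datum J | ¬ x.2 b = true}} := by
      ext ω; simp [Flag, hθ]
    rw [hset]
    refine (measureReal_biUnion_finset_le _ _).trans ?_
    have h1 : ∀ c, P.real {ω : Table J M | ∀ m, ω (a, c, 1, m) ∈ {x : Datum J | ¬ x.2 b = true}} ≤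
        Real.exp (-(θ * M)) := by
      intro c
      rw [hP, pi_real_forall_mem ν (r := fun m : Fin M => (a, c, (1 : Fin 5), m))
        (fun m m' h => by simpa using h) (fun m => MeasurableSet.of_discrete),
        Finset.prod_congr rfl (fun m _ => compl 1 a b c m (hν.hit1 a c m b))]
      rw [Finset.prod_const, Finset.card_univ, Fintype.card_fin]
      have h2 : 1 - fr a b ≤ Real.exp (-θ) := by linarith [Real.add_one_le_exp (-θ)]
      have h3 : 0 ≤ 1 - fr a b := sub_nonneg.2 (hfr1 a b)
      refine (pow_le_pow_left₀ h3 h2 M).trans (le_of_eq ?_)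
      rw [← Real.exp_nat_mul]
      congr 1
      ring
    refine (Finset.sum_le_sum fun c _ => h1 c).trans (le_of_eq ?_)
    simp
  have hexp2 : (1 / 2 : ℝ) ≤ Real.exp (-(1 / 2)) := by
    have := Real.add_one_le_exp (-(1 / 2) : ℝ)
    linarith
  have hMs : ∀ a b, P.real {ω : Table J M | ¬ (ω.Flag a b → 1 / (2 * M) < fr a b)} ≤
      Real.exp (-((J + 1) / 2)) := by
    intro a b
    by_cases hlt : 1 / (2 * M) < fr a b
    · simp only [hlt, imp_true_iff, not_true_eq_false, Set.ofPred_false, measureReal_empty]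
      positivity
    -- A false flag selects one successful draw g c in each of the J + 1 batches. There are M ^ (J +
    -- 1) selections of probability fr a b ^ (J + 1) each, and M * fr a b ≤ 1 / 2 ≤ exp (-1 / 2).
    have hset : {ω : Table J M | ¬ (ω.Flag a b → 1 / (2 * M) < fr a b)} =
        ⋃ g ∈ (Finset.univ : Finset (Fin (J + 1) → Fin M)),
          {ω : Table J M | ∀ c, ω (a, c, 1, g c) ∈ {x : Datum J | x.2 b = true}} := by
      ext ω
      simp only [Set.mem_ofPred_eq, Classical.not_imp, hlt, not_false_eq_true, and_true, Flag,
        Set.mem_iUnion, Finset.mem_univ, exists_prop, true_and]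
      exact ⟨fun h => by choose g hg using h; exact ⟨g, hg⟩, fun ⟨g, hg⟩ c => ⟨g c, hg c⟩⟩
    rw [hset]
    refine (measureReal_biUnion_finset_le _ _).trans ?_
    have h1 : ∀ g : Fin (J + 1) → Fin M, P.real
        {ω : Table J M | ∀ c, ω (a, c, 1, g c) ∈ {x : Datum J | x.2 b = true}} = fr a b ^ (J + 1) := by
      intro g
      rw [hP, pi_real_forall_mem ν (r := fun c : Fin (J + 1) => (a, c, (1 : Fin 5), g c))
        (fun c c' h => by simp only [Prod.mk.injEq] at h; exact h.2.1)
        (fun m => MeasurableSet.of_discrete),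
        Finset.prod_congr rfl (fun c _ => hν.hit1 a c (g c) b)]
      simp
    rw [Finset.sum_congr rfl (fun g _ => h1 g)]
    simp only [Finset.sum_const, Finset.card_univ, Fintype.card_pi, Fintype.card_fin,
      Finset.prod_const, nsmul_eq_mul, Nat.cast_pow]
    rw [← mul_pow]
    have h2 : (M : ℝ) * fr a b ≤ Real.exp (-(1 / 2)) := by
      refine le_trans ?_ hexp2
      have := mul_le_mul_of_nonneg_left (not_lt.1 hlt) hMr.le
      refine this.trans (le_of_eq ?_)
      field_simp
    refine (pow_le_pow_left₀ (mul_nonneg hMr.le (hfr0 a b)) h2 _).trans (le_of_eq ?_)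
    rw [← Real.exp_nat_mul]
    congr 1
    push_cast
    ring
  have hHt : ∀ a c, P.real
      {ω : Table J M | ¬ (1 / (2 * M) < fr a c → ∃ b m, (ω (a, b, 4, m)).2 c = true)} ≤
      Real.exp (-((J + 1) / 2)) := by
    intro a c
    by_cases hlt : 1 / (2 * M) < fr a c
    swap
    · simp only [hlt, false_imp_iff, not_true_eq_false, Set.ofPred_false, measureReal_empty]
      positivity
    have hset : {ω : Table J M | ¬ (1 / (2 * M) < fr a c → ∃ b m, (ω (a, b, 4, m)).2 c = true)} =
        {ω : Table J M | ∀ t : Fin (J + 1) × Fin M,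
          ω (a, t.1, 4, t.2) ∈ {x : Datum J | ¬ x.2 c = true}} := by
      ext ω
      simp only [hlt, true_imp_iff, not_exists, Set.mem_ofPred_eq, Prod.forall]
    rw [hset, hP, pi_real_forall_mem ν
      (r := fun t : Fin (J + 1) × Fin M => (a, t.1, (4 : Fin 5), t.2))
      (fun t t' h => by simp only [Prod.mk.injEq, true_and] at h; exact Prod.ext h.1 h.2)
      (fun m => MeasurableSet.of_discrete),
      Finset.prod_congr rfl (fun t _ => compl 4 a c t.1 t.2 (hν.hit4 a t.1 t.2 c))]
    simp only [Finset.prod_const, Finset.card_univ, Fintype.card_prod, Fintype.card_fin]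
    have h2 : 1 - fr a c ≤ Real.exp (-(1 / (2 * M))) := by
      linarith [Real.add_one_le_exp (-(1 / (2 * (M : ℝ))))]
    refine (pow_le_pow_left₀ (sub_nonneg.2 (hfr1 a c)) h2 _).trans (le_of_eq ?_)
    rw [← Real.exp_nat_mul]
    congr 1
    push_cast
    field_simp
  set B : Fin (J + 1) × Fin (J + 1) → Set (Table J M) := fun t =>
    ((((({ω | ¬ |p t.1 t.2 - ω.est 0 t.1 t.2| ≤ δ} ∪ {ω | ¬ |p t.1 t.2 - ω.est 2 t.1 t.2| ≤ δ}) ∪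
      {ω | ¬ |p t.2 ⊤ - ω.est 3 t.1 t.2| ≤ δ}) ∪ {ω | ¬ (θ ≤ fr t.1 t.2 → ω.Flag t.1 t.2)}) ∪
      {ω | ¬ (ω.Flag t.1 t.2 → 1 / (2 * M) < fr t.1 t.2)}) ∪
      {ω | ¬ (1 / (2 * M) < fr t.1 t.2 → ∃ b m, (ω (t.1, b, 4, m)).2 t.2 = true)}) with hB
  have hsub : {ω : Table J M | ¬ Accurate p fr δ θ ω} ⊆ ⋃ t ∈ (Finset.univ : Finset _), B t := by
    intro ω hω
    by_contra hcon
    simp only [Finset.mem_univ, Set.iUnion_true, Set.mem_iUnion, not_exists, hB, Set.mem_union,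
      Set.mem_ofPred_eq, not_or, not_not] at hcon
    exact hω ⟨fun a c => (hcon (a, c)).1.1.1.1.1, fun a c => (hcon (a, c)).1.1.1.1.2,
      fun a c => (hcon (a, c)).1.1.1.2, fun a c => (hcon (a, c)).1.1.2,
      fun a c => (hcon (a, c)).1.2, fun a c => (hcon (a, c)).2⟩
  refine (measureReal_mono hsub (measure_ne_top _ _)).trans ((measureReal_biUnion_finset_le _ _).trans ?_)
  have hBt : ∀ t, P.real (B t) ≤ 6 * Real.exp (-2 * M * δ ^ 2) + (J + 1) * Real.exp (-(θ * M)) +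
        2 * Real.exp (-((J + 1) / 2)) := by
    intro t
    have u1 := two 0 t.1 t.2 _ (fun m => hν.bit0 t.1 t.2 m)
    have u2 := two 2 t.1 t.2 _ (fun m => hν.bit2 t.1 t.2 m)
    have u3 := two 3 t.1 t.2 _ (fun m => hν.bit3 t.1 t.2 m)
    have u4 := hF t.1 t.2
    have u5 := hMs t.1 t.2
    have u6 := hHt t.1 t.2
    have v := fun s t : Set (Table J M) => measureReal_union_le (μ := P) s t
    simp only [hB]
    refine (v _ _).trans ?_
    refine (add_le_add ((v _ _).trans (add_le_add ((v _ _).trans (add_le_add ((v _ _).trans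
      (add_le_add ((v _ _).trans (add_le_add u1 u2)) u3)) u4)) u5)) u6).trans (le_of_eq ?_)
    ring
  refine (Finset.sum_le_sum fun t _ => hBt t).trans (le_of_eq ?_)
  simp
  ring

end Table

/-! ### The proposed chain of cuts -/

section Coarse

open Classical in
/-- The last point of the coarse grid up to `j`, when `R a b` tells that `b` may follow `a`. -/
def coarse (R : ℕ → ℕ → Prop) : ℕ → ℕ
  | 0 => 0
  | j + 1 => if R (coarse R j) (j + 1) then j + 1 else coarse R j

variable {R : ℕ → ℕ → Prop}

theorem coarse_le (j : ℕ) : coarse R j ≤ j := by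
  induction j with
  | zero => simp [coarse]
  | succ j ih => rw [coarse]; split_ifs <;> omega

theorem coarse_mono : Monotone (coarse R) := by
  refine monotone_nat_of_le_succ fun j => ?_
  have := coarse_le (R := R) j
  rw [coarse.eq_2]
  split_ifs <;> omega

theorem coarse_succ_of_ne {j : ℕ} (h : coarse R (j + 1) ≠ j + 1) :
    coarse R (j + 1) = coarse R j ∧ ¬ R (coarse R j) (j + 1) := by
  rw [coarse] at h ⊢
  split_ifs at h ⊢ with h1
  · exact absurd rfl h
  · exact ⟨rfl, h1⟩

theorem rel_of_coarse_eq {j : ℕ} (h : coarse R (j + 1) = j + 1) : R (coarse R j) (j + 1) := by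
  by_contra hcon
  rw [coarse, if_neg hcon] at h
  have := coarse_le (R := R) j
  omega

theorem coarse_eq_of_forall_ne {j w : ℕ} (hjw : j ≤ w) (h : ∀ b, j < b → b ≤ w → coarse R b ≠ b) :
    coarse R w = coarse R j := by
  induction w, hjw using Nat.le_induction with
  | base => rfl
  | succ w hw ih =>
    rw [(coarse_succ_of_ne (h (w + 1) (by omega) le_rfl)).1]
    exact ih fun b hb hbw => h b hb (by omega)

theorem exists_next (R : ℕ → ℕ → Prop) (J j : ℕ) : ∃ b, j < b ∧ (coarse R b = b ∨ J ≤ b) :=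
  ⟨max J (j + 1), by omega, .inr (le_max_left _ _)⟩

open Classical in
/-- The next point of the coarse grid (or the end of the grid). -/
def next (R : ℕ → ℕ → Prop) (J j : ℕ) : ℕ := Nat.find (exists_next R J j)

variable {J : ℕ}

theorem lt_next (j : ℕ) : j < next R J j := by
  classical exact (Nat.find_spec (exists_next R J j)).1

theorem next_le {j b : ℕ} (h : j < b) (hb : coarse R b = b ∨ J ≤ b) : next R J j ≤ b := by
  classical exact Nat.find_min' (exists_next R J j) ⟨h, hb⟩

theorem next_mono : Monotone (next R J) := by
  classical
  intro i j hij
  obtain ⟨h1, h2⟩ := Nat.find_spec (exists_next R J j)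
  exact next_le (hij.trans_lt h1) h2

/-- The weights used in the summation by parts thus jump only at coarse points, where the suffix
condition of a pool is available. -/
theorem next_pred_eq {b : ℕ} (h1 : coarse R b ≠ b) (h2 : b < J) :
    next R J (b - 1) = next R J b := by
  classical
  refine le_antisymm (next_mono (Nat.sub_le b 1)) ?_
  obtain ⟨h3, h4⟩ := Nat.find_spec (exists_next R J (b - 1))
  refine next_le ?_ h4
  have h5 : Nat.find (exists_next R J (b - 1)) ≠ b := by
    intro h
    rw [h] at h4
    omega
  change b < Nat.find _
  omega

theorem coarse_of_lt_next {j b : ℕ} (hjb : j ≤ b) (hb : b < next R J j) :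
    coarse R b = coarse R j := by
  refine coarse_eq_of_forall_ne hjb fun b' h1 h2 h3 => ?_
  have := next_le (J := J) h1 (.inl h3)
  omega

theorem coarse_next {j : ℕ} (h : next R J j < J) : coarse R (next R J j) = next R J j := by
  classical
  rcases (Nat.find_spec (exists_next R J j)).2 with h1 | h1
  · exact h1
  · exact absurd h (not_lt.2 h1)

/-- No point strictly between was accepted, so all of them were rejected against the same coarse
point. -/
theorem not_rel_of_lt_next {j b : ℕ} (hjb : j < b) (hb : b < next R J j) :
    ¬ R (coarse R j) b := by
  obtain ⟨k, rfl⟩ := Nat.exists_eq_succ_of_ne_zero (show b ≠ 0 by omega)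
  have h1 : coarse R (k + 1) ≠ k + 1 := fun h => by
    have := next_le (J := J) hjb (.inl h)
    omega
  rw [← coarse_of_lt_next (J := J) (show j ≤ k by omega) (by omega)]
  exact (coarse_succ_of_ne h1).2

theorem rel_next {j : ℕ} (h : next R J j < J) : R (coarse R j) (next R J j) := by
  have h1 := lt_next (R := R) (J := J) j
  obtain ⟨k, hk⟩ := Nat.exists_eq_succ_of_ne_zero (show next R J j ≠ 0 by omega)
  have h2 := coarse_next h
  have h3 := coarse_of_lt_next (R := R) (J := J) (j := j) (b := k) (by omega) (by omega)
  rw [hk] at h2 ⊢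
  rw [← h3]
  exact rel_of_coarse_eq h2

end Coarse

section Proposal

variable {J M : ℕ}

/-- A relation on the grid points, extended to all natural numbers. -/
def extendRel (Q : Fin (J + 1) → Fin (J + 1) → Prop) (a b : ℕ) : Prop :=
  ∃ (ha : a < J + 1) (hb : b < J + 1), Q ⟨a, ha⟩ ⟨b, hb⟩

/-- The coarse grid: points below which there is substantial mass, as seen from the preceding one.
-/
def coarseSet (Q : Fin (J + 1) → Fin (J + 1) → Prop) : Set (Fin (J + 1)) :=
  {a | coarse (extendRel Q) a = a ∧ Q a ⊤ ∧ a ≠ ⊤}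

open Classical in
/-- A chain of cuts that looks good for the estimates `q` on the coarse grid given by `Q`. -/
def proposal (δ : ℝ) (q : Fin (J + 1) → Fin (J + 1) → ℝ) (Q : Fin (J + 1) → Fin (J + 1) → Prop) :
    List (Fin (J + 1) × ℝ) :=
  -- The initial level -1 lies below all frequencies, so that it imposes nothing for small δ. The
  -- default is a single pool; monotonicity holds for any list, and only the bound on the loss needs
  -- a good chain.
  if h : ∃ l, GoodChain q (coarseSet Q) (3 * δ) (26 * δ) ⊥ (-1) l then h.choose else []

namespace Table

/-- The chain of cuts proposed by a table. -/
def chain (δ : ℝ) (ω : Table J M) : List (Fin (J + 1) × ℝ) := proposal δ (ω.est 0) ω.Flag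

theorem dependsOn_chain {δ : ℝ} :
    DependsOn (fun ω : Table J M => ω.chain δ) {r | r.2.2.1 < 2} := by
  intro (ω : Table J M) (ω' : Table J M) h
  have h1 : ω.est 0 = ω'.est 0 := by
    funext a c
    simp only [est]
    congr 1
    refine Finset.sum_congr rfl fun m _ => ?_
    rw [h (a, c, 0, m) (by simp)]
  have h2 : ω.Flag = ω'.Flag := by
    funext a b
    refine propext (forall_congr' fun c => exists_congr fun m => ?_)
    rw [h (a, c, 1, m) (by simp)]
  simp only [chain, h1, h2]

/-- The pool of the value `z` according to a table. -/
def pool (δ : ℝ) (val : Fin (J + 1) → ℝ) (ω : Table J M) (z : ℝ) : Fin (J + 1) × Fin (J + 1) :=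
  poolOf (Verified δ ω) val ⊥ (-1) (ω.chain δ) z

variable {ν : RoundIdx J M → Measure (Datum J)} {p fr : Fin (J + 1) → Fin (J + 1) → ℝ} {δ : ℝ}

/-- The proposed chain takes finitely many values and is independent of the verifications.
Conditioning on it gives a mixture of `chainValue` with weights that do not depend on z, so
monotonicity may be checked for each fixed chain. -/
theorem integral_pool (hν : IsLaw ν p fr) (val : Fin (J + 1) → ℝ) :
    ∃ (s : Finset (List (Fin (J + 1) × ℝ))) (c : List (Fin (J + 1) × ℝ) → ℝ), (∀ l, 0 ≤ c l) ∧
      ∀ z, ∫ ω, (fun w => p w.1 w.2) (pool δ val ω z) ∂(Measure.pi ν) = ∑ l ∈ s, c l *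
        chainValue p (fun a lo c y => (Measure.pi ν).real {ω | Verified δ ω a lo c y}) val ⊥ (-1) l
          z := by
  classical
  have := hν.prob
  refine ⟨Finset.univ.image (fun ω : Table J M => ω.chain δ), fun l => (Measure.pi ν).real {ω : Table J M | ω.chain δ = l},
    fun l => measureReal_nonneg, fun z => ?_⟩
  have hpt : ∀ ω : Table J M, (fun w : Fin (J + 1) × Fin (J + 1) => p w.1 w.2) (pool δ val ω z) =
      ∑ l ∈ Finset.univ.image (fun ω : Table J M => ω.chain δ), (if ω.chain δ = l then 1 else 0) *
        (fun w : Fin (J + 1) × Fin (J + 1) => p w.1 w.2)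
          (poolOf (Verified δ ω) val ⊥ (-1) l z) := by
    intro ω
    simp [pool]
  rw [integral_congr_ae (Filter.Eventually.of_forall hpt),
    integral_finsetSum _ (fun _ _ => Integrable.of_finite)]
  refine Finset.sum_congr rfl fun l _ => ?_
  rw [← integral_poolOf hν l ⊥ (-1) z]
  have hind : IndepFun (fun ω : Table J M => if ω.chain δ = l then (1 : ℝ) else 0)
      (fun ω : Table J M => (fun w : Fin (J + 1) × Fin (J + 1) => p w.1 w.2)
          (poolOf (Verified δ ω) val ⊥ (-1) l z)) (Measure.pi ν) := by
    refine indepFun_of_dependsOn ν .of_discrete .of_discrete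
      (S := {r | r.2.2.1 < 2}) (T := {r | ⊥ ≤ r.1 ∧ 2 ≤ r.2.2.1}) ?_ ?_ ?_
    · rw [Set.disjoint_left]
      rintro r h1 ⟨-, h2⟩
      exact absurd h2 (not_le.2 h1)
    · intro ω ω' h
      have h1 := dependsOn_chain (δ := δ) h
      simp only at h1
      simp only [h1]
    · intro ω ω' h
      have h1 := dependsOn_poolOf (δ := δ) (val := val) l ⊥ (-1) z h
      simp only at h1
      simp only [h1]
  rw [hind.integral_fun_mul_eq_mul_integral Measurable.of_discrete.aestronglyMeasurable
    Measurable.of_discrete.aestronglyMeasurable]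
  congr 1
  show _ = (Measure.pi ν).real {ω : Table J M | ω.chain δ = l}
  rw [← integral_indicator_one (MeasurableSet.of_discrete)]
  congr 1
  funext ω
  simp [Set.indicator_apply]

/-- The expected average allocation of the pool of `z` is monotone up to a slowly growing factor. -/
theorem integral_pool_mul_mono (hν : IsLaw ν p fr) (hM : 0 < M) (hδ : 0 ≤ δ)
    {val : Fin (J + 1) → ℝ} (hval : StrictMono val) {σ : ℝ} (hσ0 : 0 ≤ σ) (hσ1 : σ ≤ 1)
    (hσ : Real.exp (-2 * M * δ ^ 2) * ((J + 1) * M) ≤ σ / 4)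
    (hp : ∀ a b, 0 ≤ p a b) (hfr0 : ∀ a c, 0 ≤ fr a c) (hfr1 : ∀ a c, fr a c ≤ 1)
    (hfr : ∀ a c, a < c → fr a c * p a c ≤ p a ⊤)
    {φ : ℝ → ℝ} (hφ0 : ∀ z, 0 ≤ φ z) (hφm : Monotone φ)
    (hφ : ∀ a c z z', a < c → z < val c → val c ≤ z' → (1 + σ) * φ z ≤ φ z') {z z' : ℝ}
    (hz : z ≤ z') :
    (∫ ω, (fun w => p w.1 w.2) (pool δ val ω z) ∂(Measure.pi ν)) * φ z ≤
      (∫ ω, (fun w => p w.1 w.2) (pool δ val ω z') ∂(Measure.pi ν)) * φ z' := by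
  have := hν.prob
  obtain ⟨s, c, hc, hX⟩ := integral_pool (δ := δ) hν val
  rw [hX, hX, Finset.sum_mul, Finset.sum_mul]
  refine Finset.sum_le_sum fun l _ => ?_
  rw [mul_assoc, mul_assoc]
  refine mul_le_mul_of_nonneg_left ?_ (hc l)
  refine chainValue_mul_mono hval hσ0 hσ1 hp (fun _ _ _ _ => measureReal_nonneg)
    (fun _ _ _ _ => measureReal_le_one) hfr1 hfr ?_ ?_ hφ0 hφm hφ l _ _ hz
  · intro a lo c y _ h
    refine (real_verified_le_of_bad hν hM hδ h).trans ?_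
    rw [← mul_assoc]
    exact mul_le_mul_of_nonneg_right hσ (hfr0 a c)
  · intro a lo c y _ h
    refine (real_verified_le_of_low hν hM hδ h).trans (le_trans ?_ hσ)
    refine le_mul_of_one_le_right (Real.exp_pos _).le ?_
    have : (1 : ℝ) ≤ M := by exact_mod_cast hM
    nlinarith [(Nat.cast_nonneg J : (0 : ℝ) ≤ J)]

end Table

end Proposal

/-! ### Loss of value for one agent -/

/-- The average allocation in the interval between two grid points; `H` is the measure of values
that are served. -/
def avgAlloc (F H : Measure ℝ) (val : ℕ → ℝ) (a b : ℕ) : ℝ :=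
  H.real (Set.Ico (val a) (val b)) / F.real (Set.Ico (val a) (val b))

/-- The conditional mass of `[a, b)` given that the value is at least `a`. -/
def relMass (F : Measure ℝ) (val : ℕ → ℝ) (J a b : ℕ) : ℝ :=
  F.real (Set.Ico (val a) (val b)) / F.real (Set.Ico (val a) (val J))

/-- A prior with mean at most `μ`, the measure of the served values, and a grid. -/
structure GridPrior (F H : Measure ℝ) (val : ℕ → ℝ) (J : ℕ) (d μ : ℝ) : Prop where
  prob : IsProbabilityMeasure F
  le : H ≤ F
  supp : ∀ᵐ v ∂F, v ∈ Set.Ico 0 (val J)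
  val_zero : val 0 = 0
  mono : StrictMono val
  step : ∀ j, val (j + 1) ≤ (1 + d) * val j + d * μ
  mean : ∫ v, v ∂F ≤ μ

section Cells

variable {val : ℕ → ℝ} (hval : Monotone val) (G : Measure ℝ) [IsFiniteMeasure G]

include hval in
theorem real_Ico_add {a b c : ℕ} (hab : a ≤ b) (hbc : b ≤ c) :
    G.real (Set.Ico (val a) (val b)) + G.real (Set.Ico (val b) (val c)) =
      G.real (Set.Ico (val a) (val c)) := by
  rw [← measureReal_union (Set.Ico_disjoint_Ico_same) measurableSet_Ico,
    Set.Ico_union_Ico_eq_Ico (hval hab) (hval hbc)]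

theorem integrableOn_Ico_id (s t : ℝ) : IntegrableOn (fun z : ℝ => z) (Set.Ico s t) G := by
  refine Measure.integrableOn_of_bounded (M := max |s| |t|) (measure_ne_top _ _)
    measurable_id.aestronglyMeasurable ?_
  filter_upwards [ae_restrict_mem measurableSet_Ico] with z hz
  exact abs_le_max_abs_abs hz.1 hz.2.le

theorem cell_integral_bounds (a b : ℕ) :
    val a * G.real (Set.Ico (val a) (val b)) ≤ ∫ z in Set.Ico (val a) (val b), z ∂G ∧
      ∫ z in Set.Ico (val a) (val b), z ∂G ≤ val b * G.real (Set.Ico (val a) (val b)) := by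
  have h1 : ∀ t : ℝ, t * G.real (Set.Ico (val a) (val b)) = ∫ _ in Set.Ico (val a) (val b), t ∂G :=
    fun t => by simp [mul_comm]
  have hint := integrableOn_Ico_id G (val a) (val b)
  rw [h1, h1]
  exact ⟨setIntegral_mono_on (integrable_const _).integrableOn hint measurableSet_Ico
    fun z hz => hz.1, setIntegral_mono_on hint (integrable_const _).integrableOn measurableSet_Ico
    fun z hz => hz.2.le⟩

include hval in
theorem integral_Ico_bounds {a c : ℕ} (hac : a ≤ c) :
    ∑ j ∈ Finset.Ico a c, val j * G.real (Set.Ico (val j) (val (j + 1))) ≤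
        ∫ z in Set.Ico (val a) (val c), z ∂G ∧
      ∫ z in Set.Ico (val a) (val c), z ∂G ≤
        ∑ j ∈ Finset.Ico a c, val (j + 1) * G.real (Set.Ico (val j) (val (j + 1))) := by
  induction c, hac using Nat.le_induction with
  | base => simp
  | succ c hc ih =>
    rw [Finset.sum_Ico_succ_top hc, Finset.sum_Ico_succ_top hc,
      ← Set.Ico_union_Ico_eq_Ico (hval hc) (hval (Nat.le_succ c)),
      setIntegral_union Set.Ico_disjoint_Ico_same measurableSet_Ico
        (integrableOn_Ico_id G _ _) (integrableOn_Ico_id G _ _)]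
    have := cell_integral_bounds (val := val) G c (c + 1)
    exact ⟨add_le_add ih.1 this.1, add_le_add ih.2 this.2⟩

end Cells

namespace GridPrior

variable {F H : Measure ℝ} {val : ℕ → ℝ} {J : ℕ} {d μ : ℝ} (P : GridPrior F H val J d μ)
include P

theorem finite_served : IsFiniteMeasure H := by
  have := P.prob
  exact isFiniteMeasure_of_le F P.le

theorem val_nonneg (j : ℕ) : 0 ≤ val j := by
  rw [← P.val_zero]; exact P.mono.monotone (Nat.zero_le j)

theorem served_le (s : Set ℝ) : H.real s ≤ F.real s := by
  have := P.prob
  exact ENNReal.toReal_mono (measure_ne_top F s) (P.le s)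

omit P in
theorem avgAlloc_nonneg (a b : ℕ) : 0 ≤ avgAlloc F H val a b :=
  div_nonneg measureReal_nonneg measureReal_nonneg

theorem avgAlloc_le_one (a b : ℕ) : avgAlloc F H val a b ≤ 1 :=
  div_le_one_of_le₀ (P.served_le _) measureReal_nonneg

/-- Null intervals are no exception, because the served measure is dominated by the prior. -/
theorem avgAlloc_mul (a b : ℕ) :
    avgAlloc F H val a b * F.real (Set.Ico (val a) (val b)) = H.real (Set.Ico (val a) (val b)) := by
  by_cases h : F.real (Set.Ico (val a) (val b)) = 0
  · have h1 := P.served_le (Set.Ico (val a) (val b))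
    rw [h, mul_zero]
    exact (le_antisymm (h1.trans h.le) measureReal_nonneg).symm
  · exact div_mul_cancel₀ _ h

omit P in
theorem relMass_nonneg (a b : ℕ) : 0 ≤ relMass F val J a b :=
  div_nonneg measureReal_nonneg measureReal_nonneg

theorem relMass_mul {a : ℕ} {b : ℕ} (hb : b ≤ J) :
    relMass F val J a b * F.real (Set.Ico (val a) (val J)) = F.real (Set.Ico (val a) (val b)) := by
  have := P.prob
  by_cases h : F.real (Set.Ico (val a) (val J)) = 0
  · have h1 : F.real (Set.Ico (val a) (val b)) ≤ F.real (Set.Ico (val a) (val J)) :=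
      measureReal_mono (Set.Ico_subset_Ico_right (P.mono.monotone hb))
    rw [h, mul_zero]
    exact (le_antisymm (h1.trans h.le) measureReal_nonneg).symm
  · exact div_mul_cancel₀ _ h

theorem relMass_le_one {a b : ℕ} (hb : b ≤ J) : relMass F val J a b ≤ 1 := by
  have := P.prob
  exact div_le_one_of_le₀ (measureReal_mono (Set.Ico_subset_Ico_right (P.mono.monotone hb)))
    measureReal_nonneg

/-- After multiplication with the mass of [a, J) this compares the served mass of [a, c) with that
of [a, J). It is the inequality by which the single pool pays for false cuts. -/
theorem relMass_mul_avgAlloc_le {a c : ℕ} (hc : c ≤ J) :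
    relMass F val J a c * avgAlloc F H val a c ≤ avgAlloc F H val a J := by
  have := P.prob
  have := P.finite_served
  by_cases h : F.real (Set.Ico (val a) (val J)) = 0
  · simp [relMass, avgAlloc, h]
  · have hpos : 0 < F.real (Set.Ico (val a) (val J)) := lt_of_le_of_ne measureReal_nonneg (Ne.symm h)
    rw [avgAlloc.eq_1 F H val a J, le_div_iff₀ hpos]
    have h1 := P.relMass_mul (a := a) hc
    have h2 := P.avgAlloc_mul a c
    calc _ = avgAlloc F H val a c * (relMass F val J a c * F.real (Set.Ico (val a) (val J))) := by ring
      _ = H.real (Set.Ico (val a) (val c)) := by rw [h1, h2]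
      _ ≤ _ := measureReal_mono (Set.Ico_subset_Ico_right (P.mono.monotone hc))

theorem real_univ_Ico : F.real (Set.Ico (val 0) (val J)) = 1 := by
  have := P.prob
  rw [P.val_zero, measureReal_def, (mem_ae_iff_prob_eq_one measurableSet_Ico).1 P.supp]
  simp

theorem setIntegral_Ico_eq {G : Measure ℝ} (hG : G ≤ F) :
    ∫ z in Set.Ico (val 0) (val J), z ∂G = ∫ z, z ∂G := by
  have h : ∀ᵐ v ∂G, v ∈ Set.Ico 0 (val J) := Measure.absolutelyContinuous_of_le hG P.supp
  rw [P.val_zero, Measure.restrict_eq_self_of_ae_mem h]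

theorem integrable_id : Integrable (fun z : ℝ => z) F := by
  have := P.prob
  have h := integrableOn_Ico_id F 0 (val J)
  rwa [IntegrableOn, Measure.restrict_eq_self_of_ae_mem P.supp] at h

/-- Markov's inequality. -/
theorem val_mul_tail_le (w : ℕ) : val w * F.real (Set.Ico (val w) (val J)) ≤ μ := by
  have := P.prob
  refine ((cell_integral_bounds F w J).1.trans ?_).trans P.mean
  exact setIntegral_le_integral P.integrable_id
    (by filter_upwards [P.supp] with z hz using hz.1)

/-- The mass of the cells between grid points. -/
theorem sum_val_mul_le : ∑ j ∈ Finset.Ico 0 J, val j * F.real (Set.Ico (val j) (val (j + 1))) ≤ μ := by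
  have := P.prob
  refine ((integral_Ico_bounds P.mono.monotone F (Nat.zero_le J)).1.trans (le_of_eq ?_)).trans P.mean
  exact P.setIntegral_Ico_eq le_rfl

theorem sum_cells : ∑ j ∈ Finset.Ico 0 J, F.real (Set.Ico (val j) (val (j + 1))) = 1 := by
  have := P.prob
  rw [← P.real_univ_Ico]
  have : ∀ c, ∑ j ∈ Finset.Ico 0 c, F.real (Set.Ico (val j) (val (j + 1))) =
      F.real (Set.Ico (val 0) (val c)) := by
    intro c
    induction c with
    | zero => simp
    | succ c ih =>
      rw [Finset.sum_Ico_succ_top (Nat.zero_le c), ih,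
        real_Ico_add P.mono.monotone F (Nat.zero_le c) (Nat.le_succ c)]
  exact this J

/-- If the relation `R` only fails for intervals of small conditional mass, replacing the values by
the next points of the coarse grid is cheap. -/
theorem next_mul_cell_le {R : ℕ → ℕ → Prop} {θ : ℝ} (hd0 : 0 ≤ d) (hd : d ≤ 1 / 2) (hμ : 0 ≤ μ)
    (hθ0 : 0 ≤ θ) (hθ : θ ≤ 1 / 2)
    (hR : ∀ a b, a < b → b < J → ¬ R a b → relMass F val J a b ≤ θ) {j : ℕ} (hj : j < J) :
    val (next R J j) * F.real (Set.Ico (val j) (val (j + 1))) ≤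
      (1 + d) * (val j * F.real (Set.Ico (val j) (val (j + 1)))) +
        d * μ * F.real (Set.Ico (val j) (val (j + 1))) + 4 * θ * μ := by
  have := P.prob
  set Fj := F.real (Set.Ico (val j) (val (j + 1))) with hFj
  have hFj0 : 0 ≤ Fj := measureReal_nonneg
  have hθμ := mul_nonneg hθ0 hμ
  have hlt := lt_next (R := R) (J := J) j
  have hleJ : next R J j ≤ J := next_le hj (.inr le_rfl)
  obtain ⟨w, hw⟩ := Nat.exists_eq_succ_of_ne_zero (show next R J j ≠ 0 by omega)
  have hstep := P.step w
  rw [hw]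
  -- Here w is the grid point just before the next coarse point. If w = j, a single grid step is
  -- made. Otherwise w was rejected against g = coarse R j, so [g, w), which contains the cell of j,
  -- has conditional mass at most θ above g.
  rcases eq_or_lt_of_le (show j ≤ w by omega) with rfl | hjw
  · have := mul_le_mul_of_nonneg_right hstep hFj0
    simp only [Nat.succ_eq_add_one]
    linarith
  · have hnR := not_rel_of_lt_next (R := R) (J := J) hjw (by omega)
    have hcj := coarse_le (R := R) j
    have h1 := hR _ _ (by omega) (by omega) hnR
    set g := coarse R j with hg
    have hS : F.real (Set.Ico (val g) (val w)) ≤ θ * F.real (Set.Ico (val g) (val J)) := by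
      rw [← P.relMass_mul (a := g) (show w ≤ J by omega)]
      exact mul_le_mul_of_nonneg_right h1 measureReal_nonneg
    have h2 : Fj ≤ F.real (Set.Ico (val g) (val w)) :=
      measureReal_mono (Set.Ico_subset_Ico (P.mono.monotone hcj) (P.mono.monotone hjw))
    have h3 := real_Ico_add P.mono.monotone F (show g ≤ w by omega) (show w ≤ J by omega)
    set FgJ := F.real (Set.Ico (val g) (val J)) with hFgJ
    have hFgJ0 : 0 ≤ FgJ := measureReal_nonneg
    have hFgJ1 : FgJ ≤ 1 := measureReal_le_one
    have h4 := P.val_mul_tail_le w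
    have hv := P.val_nonneg w
    -- As θ ≤ 1 / 2, at least half of the mass above g lies above w, where Markov's inequality
    -- applies.
    have h5 : val w * FgJ ≤ 2 * μ := by
      have : FgJ ≤ 2 * F.real (Set.Ico (val w) (val J)) := by nlinarith
      nlinarith
    have h6 : val (w + 1) * Fj ≤ ((1 + d) * val w + d * μ) * (θ * FgJ) :=
      mul_le_mul hstep (h2.trans hS) hFj0 (by positivity)
    have h7 : ((1 + d) * val w + d * μ) * (θ * FgJ) ≤ 4 * θ * μ := by
      have e1 : θ * (val w * FgJ) ≤ θ * (2 * μ) := mul_le_mul_of_nonneg_left h5 hθ0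
      have e2 : (1 + d) * (θ * (val w * FgJ)) ≤ 3 / 2 * (θ * (2 * μ)) :=
        mul_le_mul (by linarith) e1
          (mul_nonneg hθ0 (mul_nonneg hv hFgJ0)) (by norm_num)
      have e3 : d * (θ * μ) * FgJ ≤ 1 / 2 * (θ * μ) * 1 :=
        mul_le_mul (mul_le_mul_of_nonneg_right hd hθμ) hFgJ1 hFgJ0 (by positivity)
      nlinarith
    have h8 : 0 ≤ (1 + d) * (val j * Fj) + d * μ * Fj := by
      have := P.val_nonneg j
      positivity
    simp only [Nat.succ_eq_add_one]
    linarith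

/-- The value collected in a single pool. -/
theorem pool_value_ge {R : ℕ → ℕ → Prop} {s : ℝ} (hs : 0 ≤ s) {a c : ℕ} (hac : a < c) (hcJ : c ≤ J)
    (hsuf : ∀ b, a < b → b < c → coarse R b = b →
      H.real (Set.Ico (val b) (val c)) ≤
        (avgAlloc F H val a c + s) * F.real (Set.Ico (val b) (val c)))
    {err : ℕ → ℝ} (herr0 : ∀ j, 0 ≤ err j)
    (herr : ∀ j < J, val (next R J j) * F.real (Set.Ico (val j) (val (j + 1))) ≤
      val j * F.real (Set.Ico (val j) (val (j + 1))) + err j) :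
    ∑ j ∈ Finset.Ico a c, (val (next R J j) * H.real (Set.Ico (val j) (val (j + 1))) -
        s * (val (next R J j) * F.real (Set.Ico (val j) (val (j + 1)))) - err j) ≤
      avgAlloc F H val a c * ∫ z in Set.Ico (val a) (val c), z ∂F := by
  have := P.prob
  have := P.finite_served
  have hm := P.mono.monotone
  set p := avgAlloc F H val a c with hp
  have hp0 : 0 ≤ p := avgAlloc_nonneg a c
  have hp1 : p ≤ 1 := P.avgAlloc_le_one a c
  -- Suffix sums of q over the pool are nonpositive at coarse points by the suffix condition, and at
  -- a because p is the average of the whole pool.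
  set q : ℕ → ℝ := fun j => H.real (Set.Ico (val 0) (val j)) -
    (p + s) * F.real (Set.Ico (val 0) (val j)) with hq
  have hqd : ∀ b e, b ≤ e → q e - q b = H.real (Set.Ico (val b) (val e)) -
      (p + s) * F.real (Set.Ico (val b) (val e)) := by
    intro b e hbe
    simp only [hq, ← real_Ico_add hm H (Nat.zero_le b) hbe, ← real_Ico_add hm F (Nat.zero_le b) hbe]
    ring
  have habel := sum_weighted_nonpos (u := fun j => val (next R J j)) (q := q)
    (fun i j hij => hm (next_mono hij)) hac.le (P.val_nonneg _)
    (by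
      rw [hqd a c hac.le, ← P.avgAlloc_mul a c, ← hp]
      have := mul_nonneg hs (measureReal_nonneg (μ := F) (s := Set.Ico (val a) (val c)))
      linarith)
    (by
      intro b hab hbc hne
      rw [hqd b c hbc.le]
      have hcb : coarse R b = b := by
        by_contra hcon
        exact hne (congrArg val (next_pred_eq hcon (by omega)))
      linarith [hsuf b hab hbc hcb])
  have h1 := mul_le_mul_of_nonneg_left (integral_Ico_bounds hm F hac.le).1 hp0
  refine le_trans ?_ h1
  rw [Finset.mul_sum, ← sub_nonpos, ← Finset.sum_sub_distrib]
  refine le_trans (Finset.sum_le_sum fun j hj => ?_) habel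
  rw [hqd j (j + 1) (Nat.le_succ j)]
  have hj' := Finset.mem_Ico.1 hj
  have h2 := mul_le_mul_of_nonneg_left (herr j (by omega)) hp0
  have h3 := mul_le_mul_of_nonneg_right hp1 (herr0 j)
  linarith

end GridPrior

open Classical in
theorem measurable_poolOf {κ : Type*} [LinearOrder κ] [BoundedOrder κ] [MeasurableSpace κ]
    (E : κ → ℝ → κ → ℝ → Prop) (val : κ → ℝ) (l : List (κ × ℝ)) (a : κ) (lo : ℝ) :
    Measurable (poolOf E val a lo l) := by
  induction l generalizing a lo with
  | nil => exact measurable_const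
  | cons x l ih =>
    obtain ⟨c, y⟩ := x
    simp only [poolOf]
    by_cases h : a < c ∧ E a lo c y
    · simp only [h, and_self, if_true]
      exact Measurable.ite measurableSet_Iio measurable_const (ih c y)
    · simp only [h, if_false]
      exact measurable_const

/-! ### The loss of value with an accurate table -/

namespace GridPrior

variable {F H : Measure ℝ} {val : ℕ → ℝ} {J M : ℕ} {δ θ μ : ℝ}
  (P : GridPrior F H val J (16 * δ) μ) {ω : Table J M}
include P

theorem integrable_mul_alloc {g : ℝ → Fin (J + 1) × Fin (J + 1)} (hg : Measurable g) :
    Integrable (fun z => z * avgAlloc F H val (g z).1 (g z).2) F := by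
  refine P.integrable_id.mul_bdd (c := 1)
    ((Measurable.of_discrete (f := fun w : Fin (J + 1) × Fin (J + 1) =>
      avgAlloc F H val w.1 w.2)).comp hg).aestronglyMeasurable
    (Filter.Eventually.of_forall fun z => ?_)
  rw [Real.norm_eq_abs, abs_of_nonneg (avgAlloc_nonneg _ _)]
  exact P.avgAlloc_le_one _ _

variable (hω : ω.Accurate (fun a b => avgAlloc F H val a b) (fun a b => relMass F val J a b) δ θ)
include hω

omit P in
theorem relMass_le_of_not_flag {a b : ℕ} (ha : a < J + 1) (hb : b < J + 1)
    (h : ¬ extendRel ω.Flag a b) : relMass F val J a b ≤ θ := by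
  by_contra hcon
  exact h ⟨ha, hb, hω.flag ⟨a, ha⟩ ⟨b, hb⟩ (not_le.1 hcon).le⟩

omit P in
theorem relMass_pos_of_flag {a b : Fin (J + 1)} (h : ω.Flag a b) : 0 < relMass F val J a b :=
  lt_of_le_of_lt (by positivity) (hω.mass a b h)

omit P in
theorem tail_pos_of_flag {a b : Fin (J + 1)} (h : ω.Flag a b) :
    0 < F.real (Set.Ico (val a) (val J)) := by
  refine lt_of_le_of_ne measureReal_nonneg fun h0 => ?_
  have := relMass_pos_of_flag hω h
  simp [relMass, ← h0] at this

/-- The coarse point that precedes b is not below a, and b is flagged as seen from it. Positive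
masses make the average allocations true slopes in `exists_goodChain`. -/
theorem mass_pos_of_coarse {a b : Fin (J + 1)} (hab : a < b)
    (ha : coarse (extendRel ω.Flag) a = a)
    (hb : coarse (extendRel ω.Flag) b = b) : 0 < F.real (Set.Ico (val a) (val b)) := by
  have := P.prob
  have hab' : (a : ℕ) < b := hab
  obtain ⟨k, hk⟩ := Nat.exists_eq_succ_of_ne_zero (show (b : ℕ) ≠ 0 by omega)
  rw [hk] at hb
  obtain ⟨h1, h2, h3⟩ := rel_of_coarse_eq hb
  have h4 := relMass_pos_of_flag hω h3
  have h5 : (a : ℕ) ≤ coarse (extendRel ω.Flag) k := by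
    conv_lhs => rw [← ha]
    exact coarse_mono (by omega)
  have h6 : F.real (Set.Ico (val (coarse (extendRel ω.Flag) k)) (val (k + 1))) ≤
      F.real (Set.Ico (val a) (val b)) :=
    measureReal_mono (Set.Ico_subset_Ico (P.mono.monotone h5) (by rw [hk]))
  refine lt_of_lt_of_le (lt_of_le_of_ne measureReal_nonneg fun h0 => ?_) h6
  simp [relMass, ← h0] at h4

/-- The first coarse point after a is at most c and is flagged as seen from a. The bound is the one
above which purpose 4 is sure to hit in an accurate table. -/
theorem relMass_gt_of_coarse {a c : Fin (J + 1)} (hac : a < c)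
    (ha : coarse (extendRel ω.Flag) a = a)
    (hc : coarse (extendRel ω.Flag) c = c) (hcJ : c ≠ ⊤) :
    1 / (2 * M) < relMass F val J a c := by
  have := P.prob
  have hac' : (a : ℕ) < c := hac
  have hcJ' : (c : ℕ) < J := Fin.lt_last_iff_ne_last.2 hcJ
  have hn : next (extendRel ω.Flag) J a ≤ c := next_le hac' (.inl hc)
  obtain ⟨h1, h2, h3⟩ := rel_next (R := extendRel ω.Flag) (J := J) (j := a) (by omega)
  refine (hω.mass _ _ h3).trans_le ?_
  simp only [relMass, ha]
  gcongr
  · exact measure_ne_top _ _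
  · exact P.mono.monotone hn

/-- Proposal and verification estimate the same averages, each within δ, so margins of 3δ in the
proposal leave the required margins of δ. -/
theorem verified_of_est {a c : Fin (J + 1)} {lo y : ℝ} (hac : a < c)
    (ha : coarse (extendRel ω.Flag) a = a) (hc : c ∈ coarseSet ω.Flag)
    (h1 : lo + 3 * δ ≤ ω.est 0 a c) (h2 : ω.est 0 a c ≤ y - 3 * δ)
    (h3 : y + 3 * δ ≤ ω.est 0 c ⊤) : Table.Verified δ ω a lo c y := by
  have e1 := abs_le.1 (hω.est0 a c)
  have e2 := abs_le.1 (hω.est2 a c)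
  have e3 := abs_le.1 (hω.est0 c ⊤)
  have e4 := abs_le.1 (hω.est3 a c)
  refine ⟨⟨by linarith, by linarith, by linarith⟩, hω.hit a c ?_⟩
  exact P.relMass_gt_of_coarse hω hac ha hc.1 hc.2.2

/-- The value collected by the full chain of pools. -/
theorem chain_value_ge (hδ : 0 ≤ δ) (hθ1 : θ < 1) {err : ℕ → ℝ} (herr0 : ∀ j, 0 ≤ err j)
    (herr : ∀ j < J, val (next (extendRel ω.Flag) J j) * F.real (Set.Ico (val j) (val (j + 1))) ≤
      val j * F.real (Set.Ico (val j) (val (j + 1))) + err j)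
    (l : List (Fin (J + 1) × ℝ)) (a : Fin (J + 1)) (lo : ℝ)
    (hl : GoodChain (ω.est 0) (coarseSet ω.Flag) (3 * δ) (26 * δ) a lo l)
    (ha : coarse (extendRel ω.Flag) a = a) (haT : a ≠ ⊤) :
    ∑ j ∈ Finset.Ico (a : ℕ) J,
      (val (next (extendRel ω.Flag) J j) * H.real (Set.Ico (val j) (val (j + 1))) -
        28 * δ * (val (next (extendRel ω.Flag) J j) * F.real (Set.Ico (val j) (val (j + 1)))) -
          err j) ≤
      ∫ z in Set.Ico (val a) (val J), z * (fun w : Fin (J + 1) × Fin (J + 1) =>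
        avgAlloc F H val w.1 w.2)
          (poolOf (Table.Verified δ ω) (fun c => val c) a lo l z) ∂F := by
  have := P.prob
  have hpool : ∀ a c : Fin (J + 1), a < c →
      SuffixOK (ω.est 0) (coarseSet ω.Flag) (26 * δ) a c →
      ∑ j ∈ Finset.Ico (a : ℕ) c,
      (val (next (extendRel ω.Flag) J j) * H.real (Set.Ico (val j) (val (j + 1))) -
        28 * δ * (val (next (extendRel ω.Flag) J j) * F.real (Set.Ico (val j) (val (j + 1)))) -
          err j) ≤ avgAlloc F H val a c * ∫ z in Set.Ico (val a) (val c), z ∂F := by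
    intro a c hac hS
    have hcJ : (c : ℕ) ≤ J := Nat.lt_succ_iff.1 c.2
    -- The slack 28δ consists of 26δ for the estimates and δ for each of the two averages compared.
    refine P.pool_value_ge (by positivity) hac hcJ (fun b hab hbc hb => ?_) herr0 herr
    -- A coarse point without a flag towards ⊤ has no mass above it: otherwise the conditional mass
    -- of its tail would be 1 > θ. The suffix condition is then trivial.
    by_cases hflag : ω.Flag ⟨b, by omega⟩ ⊤
    · have hmem : (⟨b, by omega⟩ : Fin (J + 1)) ∈ coarseSet ω.Flag := by
        refine ⟨hb, hflag, fun h => ?_⟩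
        have : b = J := congrArg Fin.val h
        omega
      have h1 := hS _ hmem hab hbc
      have h2 := abs_le.1 (hω.est0 ⟨b, by omega⟩ c)
      have h3 := abs_le.1 (hω.est0 a c)
      simp only at h2 h3
      rw [← P.avgAlloc_mul]
      refine mul_le_mul_of_nonneg_right ?_ measureReal_nonneg
      linarith
    · have h1 : relMass F val J b J ≤ θ := relMass_le_of_not_flag hω (by omega) (by omega)
        fun ⟨_, _, h⟩ => hflag h
      have h2 : F.real (Set.Ico (val b) (val J)) = 0 := by
        by_contra hne
        rw [relMass, div_self hne] at h1
        linarith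
      have h3 : F.real (Set.Ico (val b) (val c)) = 0 :=
        le_antisymm ((measureReal_mono (Set.Ico_subset_Ico_right (P.mono.monotone hcJ))).trans
          h2.le) measureReal_nonneg
      rw [h3, mul_zero]
      exact (P.served_le _).trans h3.le
  induction l generalizing a lo with
  | nil =>
    have h1 := hpool a ⊤ (lt_top_iff_ne_top.2 haT) hl
    refine h1.trans (le_of_eq ?_)
    rw [← integral_const_mul]
    refine integral_congr_ae (Filter.Eventually.of_forall fun z => ?_)
    simp only [poolOf]
    ring
  | cons x l ih =>
    obtain ⟨c, y⟩ := x
    obtain ⟨hc, hac, h1, h2, h3, h4, h5⟩ := hl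
    have hver : Table.Verified δ ω a lo c y := P.verified_of_est hω hac ha hc h1 h2 h3
    have hcJ : (c : ℕ) ≤ J := Nat.lt_succ_iff.1 c.2
    have hac' : (a : ℕ) ≤ c := le_of_lt hac
    have e1 := hpool a c hac h4
    have e2 := ih c y h5 hc.1 hc.2.2
    have hI := P.integrable_mul_alloc (measurable_poolOf (Table.Verified δ ω)
      (fun c : Fin (J + 1) => val c) ((c, y) :: l) a lo)
    rw [← Set.Ico_union_Ico_eq_Ico (P.mono.monotone hac') (P.mono.monotone hcJ),
      setIntegral_union Set.Ico_disjoint_Ico_same measurableSet_Ico hI.integrableOn hI.integrableOn,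
      ← Finset.sum_Ico_consecutive _ hac' hcJ]
    refine add_le_add (e1.trans (le_of_eq ?_)) (e2.trans (le_of_eq ?_))
    · rw [← integral_const_mul]
      refine setIntegral_congr_fun measurableSet_Ico fun z hz => ?_
      simp only [poolOf, hac, hver, and_self, if_true, hz.2]
      ring
    · refine setIntegral_congr_fun measurableSet_Ico fun z hz => ?_
      simp only [poolOf, hac, hver, and_self, if_true, not_lt.2 hz.1, if_false]

/-- `exists_goodChain` with d = 16δ, applied to the distribution functions of the prior and of the
served measure, gives gaps 4δ and oscillations 24δ for the true averages. Passing to the estimates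
leaves 3δ and 26δ. -/
theorem exists_chain (hδ : 0 < δ) (hδ1 : δ ≤ 1 / 4) (hJ : 0 < J) (hθ1 : θ ≤ 1) :
    ∃ l, GoodChain (ω.est 0) (coarseSet ω.Flag) (3 * δ) (26 * δ) ⊥ (-1) l := by
  classical
  have := P.prob
  have := P.finite_served
  have hm := P.mono.monotone
  set f : Fin (J + 1) → ℝ := fun j => F.real (Set.Ico (val 0) (val j)) with hf
  set h : Fin (J + 1) → ℝ := fun j => H.real (Set.Ico (val 0) (val j)) with hh
  have hfd : ∀ a b : Fin (J + 1), a ≤ b → f b - f a = F.real (Set.Ico (val a) (val b)) := by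
    intro a b hab
    simp only [hf, ← real_Ico_add hm F (Nat.zero_le (a : ℕ)) (show (a : ℕ) ≤ b from hab)]
    ring
  have hhd : ∀ a b : Fin (J + 1), a ≤ b → h b - h a = H.real (Set.Ico (val a) (val b)) := by
    intro a b hab
    simp only [hh, ← real_Ico_add hm H (Nat.zero_le (a : ℕ)) (show (a : ℕ) ≤ b from hab)]
    ring
  have havg : ∀ a b : Fin (J + 1), a ≤ b → (h b - h a) / (f b - f a) = avgAlloc F H val a b := by
    intro a b hab
    rw [hfd a b hab, hhd a b hab, avgAlloc]
  set G : Finset (Fin (J + 1)) := (coarseSet ω.Flag).toFinset with hG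
  have hmemG : ∀ b, b ∈ G ↔ b ∈ coarseSet ω.Flag := fun b => by simp [hG]
  have h0 : (⊥ : Fin (J + 1)) ∈ G := by
    rw [hmemG]
    refine ⟨show coarse _ 0 = 0 from rfl, hω.flag _ _ ?_, ?_⟩
    · simp only [relMass]
      have h1 := P.real_univ_Ico
      rw [show (((⊥ : Fin (J + 1)) : ℕ)) = 0 from rfl, show (((⊤ : Fin (J + 1)) : ℕ)) = J from rfl,
        h1, div_one]
      exact hθ1
    · intro h
      have : 0 = J := congrArg Fin.val h
      omega
  have hposm : ∀ b ∈ insert ⊤ G, ∀ c ∈ insert ⊤ G, b < c → f b < f c := by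
    intro b hb c hc hbc
    have hbG : b ∈ coarseSet ω.Flag := by
      rcases Finset.mem_insert.1 hb with h1 | h1
      · exact absurd (h1 ▸ hbc) not_top_lt
      · exact (hmemG b).1 h1
    rw [← sub_pos, hfd b c hbc.le]
    rcases Finset.mem_insert.1 hc with h1 | h1
    · rw [h1]
      exact tail_pos_of_flag hω hbG.2.1
    · exact P.mass_pos_of_coarse hω hbc hbG.1 ((hmemG c).1 h1).1
  obtain ⟨l, hl⟩ := exists_goodChain (f := f) (h := h) (G := G) (d := 16 * δ) (by positivity)
    (fun b hb => lt_top_iff_ne_top.2 ((hmemG b).1 hb).2.2) hposm h0 (lo := -1) (by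
      intro b _ c _ hbc
      rw [havg b c hbc.le]
      have := avgAlloc_nonneg (F := F) (H := H) (val := val) b c
      linarith)
  have hGset : (G : Set (Fin (J + 1))) = coarseSet ω.Flag := by ext b; simp [hmemG]
  rw [hGset] at hl
  have h2 := hl.perturb (q := ω.est 0) (δ := δ) (fun a b hab => by
    rw [havg a b hab.le]; exact hω.est0 a b)
    (lt_top_iff_ne_top.2 ((hmemG _).1 h0).2.2) (fun b hb => lt_top_iff_ne_top.2 hb.2.2)
  refine ⟨l, ?_⟩
  convert h2 using 1 <;> ring

/-- With an accurate table almost no value is lost by pooling. -/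
theorem accurate_value_ge (hδ : 0 < δ) (hδ1 : δ ≤ 1 / 100) (hμ : 0 ≤ μ) (hJ : 0 < J)
    (hθ : θ = 16 * δ / J) :
    ∫ z, z ∂H - 160 * δ * μ ≤ ∫ z, z * (fun w : Fin (J + 1) × Fin (J + 1) =>
        avgAlloc F H val w.1 w.2) (Table.pool δ (fun c => val c) ω z) ∂F := by
  have := P.prob
  have := P.finite_served
  have hJr : (1 : ℝ) ≤ J := by exact_mod_cast hJ
  have hθ0 : 0 ≤ θ := by rw [hθ]; positivity
  have hθ1 : θ ≤ 1 / 2 := by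
    rw [hθ, div_le_iff₀ (by positivity)]
    linarith
  have hex := P.exists_chain hω hδ (by linarith) hJ (by linarith)
  have hchain : GoodChain (ω.est 0) (coarseSet ω.Flag) (3 * δ) (26 * δ) ⊥ (-1) (ω.chain δ) := by
    rw [Table.chain, proposal, dif_pos hex]
    exact hex.choose_spec
  set N := next (extendRel ω.Flag) J with hN
  set Fj : ℕ → ℝ := fun j => F.real (Set.Ico (val j) (val (j + 1))) with hFj
  have hFj0 : ∀ j, 0 ≤ Fj j := fun j => measureReal_nonneg
  set err : ℕ → ℝ := fun j => 16 * δ * (val j * Fj j) + 16 * δ * μ * Fj j + 4 * θ * μ with herrdef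
  have herr0 : ∀ j, 0 ≤ err j := fun j => by
    have := P.val_nonneg j
    have := hFj0 j
    positivity
  have herr : ∀ j < J, val (N j) * Fj j ≤ val j * Fj j + err j := fun j hj => by
    have := P.next_mul_cell_le (R := extendRel ω.Flag) (by positivity) (by linarith) hμ hθ0 hθ1
      (fun a b hab hb h => relMass_le_of_not_flag hω (by omega) (by omega) h) hj
    simp only [herrdef]
    linarith
  have hbotne : (⊥ : Fin (J + 1)) ≠ ⊤ := fun h => by
    have : 0 = J := congrArg Fin.val h
    omega
  have hbot0 : ((⊥ : Fin (J + 1)) : ℕ) = 0 := rfl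
  have hmain := P.chain_value_ge hω hδ.le (by linarith) herr0 herr _ ⊥ (-1) hchain
    (show coarse _ 0 = 0 from rfl) hbotne
  rw [hbot0] at hmain
  have hI := P.integrable_mul_alloc (measurable_poolOf (Table.Verified δ ω)
      (fun c : Fin (J + 1) => val c) (ω.chain δ) ⊥ (-1))
  have hfull : ∫ z in Set.Ico (val 0) (val J), z * (fun w : Fin (J + 1) × Fin (J + 1) =>
        avgAlloc F H val w.1 w.2) (poolOf (Table.Verified δ ω) (fun c => val c) ⊥ (-1) (ω.chain δ) z)
          ∂F = ∫ z, z * (fun w : Fin (J + 1) × Fin (J + 1) =>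
        avgAlloc F H val w.1 w.2) (Table.pool δ (fun c => val c) ω z) ∂F := by
    rw [P.val_zero, Measure.restrict_eq_self_of_ae_mem P.supp]
    rfl
  rw [← hfull]
  refine le_trans ?_ hmain
  have hH : ∫ z, z ∂H ≤ ∑ j ∈ Finset.Ico 0 J, val (N j) * H.real (Set.Ico (val j) (val (j + 1))) := by
    rw [← P.setIntegral_Ico_eq P.le]
    refine (integral_Ico_bounds P.mono.monotone H (Nat.zero_le J)).2.trans
      (Finset.sum_le_sum fun j hj => ?_)
    exact mul_le_mul_of_nonneg_right (P.mono.monotone (lt_next j)) measureReal_nonneg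
  have hS1 := P.sum_val_mul_le
  have hS2 := P.sum_cells
  -- The constant is 96 = 16 + 16 + 64, where 64δμ comes from J cells with error 4θμ each and Jθ =
  -- 16δ.
  have herrsum : ∑ j ∈ Finset.Ico 0 J, err j ≤ 96 * δ * μ := by
    simp only [herrdef]
    rw [Finset.sum_add_distrib, Finset.sum_add_distrib, ← Finset.mul_sum, ← Finset.mul_sum]
    simp only [Finset.sum_const, Nat.card_Ico, Nat.sub_zero, nsmul_eq_mul]
    have h1 : (J : ℝ) * (4 * θ * μ) = 64 * δ * μ := by
      rw [hθ]; field_simp; ring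
    rw [h1]
    have h2 := mul_le_mul_of_nonneg_left hS1 (show 0 ≤ 16 * δ by positivity)
    have h3 : 16 * δ * μ * ∑ j ∈ Finset.Ico 0 J, Fj j = 16 * δ * μ := by rw [hS2, mul_one]
    rw [h3]
    linarith
  have hnF : ∑ j ∈ Finset.Ico 0 J, val (N j) * Fj j ≤ 2 * μ := by
    refine (Finset.sum_le_sum fun j hj => herr j (Finset.mem_Ico.1 hj).2).trans ?_
    rw [Finset.sum_add_distrib]
    have : 96 * δ * μ ≤ 1 * μ := mul_le_mul_of_nonneg_right (by linarith) hμ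
    linarith
  -- The total loss is at most 28δ · 2μ + 96δμ = 152δμ.
  rw [Finset.sum_sub_distrib, Finset.sum_sub_distrib, ← Finset.mul_sum]
  have := mul_le_mul_of_nonneg_left hnF (show 0 ≤ 28 * δ by positivity)
  have h9 : 0 ≤ δ * μ := by positivity
  linarith

omit hω in
/-- The expected loss of value for one agent. -/
theorem expected_value_ge {ν : RoundIdx J M → Measure (Datum J)}
    (hν : Table.IsLaw ν (fun a b => avgAlloc F H val a b) (fun a b => relMass F val J a b))
    (hδ : 0 < δ) (hδ1 : δ ≤ 1 / 100) (hμ : 0 ≤ μ) (hJ : 0 < J)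
    (hacc : (Measure.pi ν).real {ω : Table J M | ¬ ω.Accurate (fun a b => avgAlloc F H val a b)
      (fun a b => relMass F val J a b) δ (16 * δ / J)} ≤ δ) :
    ∫ z, z ∂H - 161 * δ * μ ≤ ∫ z, z * ∫ ω : Table J M, (fun w : Fin (J + 1) × Fin (J + 1) =>
        avgAlloc F H val w.1 w.2) (Table.pool δ (fun c => val c) ω z) ∂(Measure.pi ν) ∂F := by
  classical
  have := P.prob
  have := hν.prob
  set g : Table J M → ℝ → ℝ := fun ω z => z * (fun w : Fin (J + 1) × Fin (J + 1) =>
        avgAlloc F H val w.1 w.2) (Table.pool δ (fun c => val c) ω z) with hg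
  have hgint : ∀ ω, Integrable (g ω) F := fun ω => P.integrable_mul_alloc
    (measurable_poolOf (Table.Verified δ ω) (fun c : Fin (J + 1) => val c) (ω.chain δ) ⊥ (-1))
  set I : Table J M → ℝ := fun ω => ∫ z, g ω z ∂F with hI
  have hI0 : ∀ ω, 0 ≤ I ω := fun ω => integral_nonneg_of_ae (by
    filter_upwards [P.supp] with z hz
    exact mul_nonneg hz.1 (avgAlloc_nonneg _ _))
  have hswap : ∫ z, z * ∫ ω : Table J M, (fun w : Fin (J + 1) × Fin (J + 1) =>
        avgAlloc F H val w.1 w.2) (Table.pool δ (fun c => val c) ω z) ∂(Measure.pi ν) ∂F =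
        ∫ ω, I ω ∂(Measure.pi ν) := by
    rw [integral_fintype (μ := Measure.pi ν) (f := I) Integrable.of_finite]
    simp only [hI, ← integral_const_mul, smul_eq_mul]
    rw [← integral_finsetSum _ (fun ω _ => (hgint ω).const_mul _)]
    refine integral_congr_ae (Filter.Eventually.of_forall fun z => ?_)
    simp only
    rw [integral_fintype Integrable.of_finite]
    rfl
  rw [hswap]
  set K := ∫ z, z ∂H - 160 * δ * μ with hK
  set A := {ω : Table J M | ω.Accurate (fun a b => avgAlloc F H val a b)
      (fun a b => relMass F val J a b) δ (16 * δ / J)} with hA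
  have hHμ : ∫ z, z ∂H ≤ μ := by
    have h1 : ∫ z, z ∂H ≤ ∫ z, z ∂F := integral_mono_measure P.le
      (by filter_upwards [P.supp] with z hz using hz.1) P.integrable_id
    exact h1.trans P.mean
  have hδμ : 0 ≤ δ * μ := by positivity
  -- The value is nonnegative for every table. If K > 0, the inaccurate tables, of probability at
  -- most δ, cost at most δK ≤ δμ.
  rcases le_or_gt K 0 with hK0 | hK0
  · have : 0 ≤ ∫ ω, I ω ∂(Measure.pi ν) := integral_nonneg hI0
    linarith
  have h1 : ∫ ω, A.indicator (fun _ => K) ω ∂(Measure.pi ν) ≤ ∫ ω, I ω ∂(Measure.pi ν) := by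
    refine integral_mono Integrable.of_finite Integrable.of_finite fun ω => ?_
    by_cases hω : ω ∈ A
    · rw [Set.indicator_of_mem hω]
      exact P.accurate_value_ge hω hδ hδ1 hμ hJ rfl
    · rw [Set.indicator_of_notMem hω]
      exact hI0 ω
  rw [integral_indicator_const _ MeasurableSet.of_discrete] at h1
  have h2 := probReal_compl_eq_one_sub (μ := Measure.pi ν) (s := A) MeasurableSet.of_discrete
  have h3 : (Measure.pi ν).real Aᶜ ≤ δ := hacc
  have h4 : 1 - δ ≤ (Measure.pi ν).real A := by linarith
  have h5 := mul_le_mul_of_nonneg_right h4 hK0.le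
  rw [smul_eq_mul] at h1
  have h6 : δ * K ≤ δ * μ := mul_le_mul_of_nonneg_left (by linarith) hδ.le
  linarith

end GridPrior

/-! ### The distribution oracle -/

section Draw

variable (F : Measure ℝ) [IsFiniteMeasure F]

theorem measurable_draw (w : ℝ × ℝ) : Measurable (draw F w) := by
  unfold draw
  by_cases h : F (Set.Ico w.1 w.2) = 0
  · simp only [h, if_true]
    exact measurable_const
  · simp only [h, if_false]
    exact measurable_inr.comp (measurable_quantile F h)

theorem map_draw {w : ℝ × ℝ} (h : F (Set.Ico w.1 w.2) ≠ 0) :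
    (volume : Measure unitInterval).map (draw F w) = (F[|Set.Ico w.1 w.2]).map Sum.inr := by
  have : draw F w = Sum.inr ∘ quantile F w.1 w.2 := by
    funext u
    simp [draw, h]
  rw [this, ← Measure.map_map measurable_inr (measurable_quantile F h), map_quantile F h]

/-- Drawing from the window of a value that is itself random in this window does not change the
law. -/
theorem mul_volume_draw (w : ℝ × ℝ) {B : Set (Unit ⊕ ℝ)} (hB : MeasurableSet B) :
    volume (draw F w ⁻¹' B) * F (Set.Ico w.1 w.2) = F (Set.Ico w.1 w.2 ∩ Sum.inr ⁻¹' B) := by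
  by_cases h : F (Set.Ico w.1 w.2) = 0
  · rw [h, mul_zero, measure_mono_null Set.inter_subset_left h]
  · rw [← Measure.map_apply (measurable_draw F w) hB, map_draw F h,
      Measure.map_apply measurable_inr hB, cond_apply measurableSet_Ico, mul_comm, ← mul_assoc,
      ENNReal.mul_inv_cancel h (measure_ne_top _ _), one_mul]

theorem measurable_uncurry_draw {κ Ω : Type*} [MeasurableSpace Ω] [Countable κ]
    [MeasurableSpace κ] [DiscreteMeasurableSpace κ] (win : κ → ℝ × ℝ) {g : Ω → κ}
    (hg : Measurable g) {u : Ω → unitInterval} (hu : Measurable u) :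
    Measurable fun x => draw F (win (g x)) (u x) := by
  have : Measurable fun q : κ × unitInterval => draw F (win q.1) q.2 :=
    measurable_from_prod_countable_right fun k => measurable_draw F (win k)
  exact this.comp (hg.prodMk hu)

-- The pools partition the range, and the values of a pool are resampled within the same pool: its
-- mass times its conditional law is the restriction of F to it. The pools are split off one after
-- the other.
open Classical in
theorem lintegral_draw_poolOf {κ : Type*} [LinearOrder κ] [BoundedOrder κ]
    (E : κ → ℝ → κ → ℝ → Prop) {val : κ → ℝ} (hval : Monotone val) (l : List (κ × ℝ)) (a : κ)
    (lo : ℝ) {B : Set (Unit ⊕ ℝ)} (hB : MeasurableSet B) :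
    ∫⁻ z in Set.Ico (val a) (val ⊤), volume (draw F (val (poolOf E val a lo l z).1,
      val (poolOf E val a lo l z).2) ⁻¹' B) ∂F =
      F (Set.Ico (val a) (val ⊤) ∩ Sum.inr ⁻¹' B) := by
  induction l generalizing a lo with
  | nil =>
    simp only [poolOf, setLIntegral_const]
    exact mul_volume_draw F _ hB
  | cons x l ih =>
    obtain ⟨c, y⟩ := x
    simp only [poolOf]
    by_cases h : a < c ∧ E a lo c y
    · simp only [h, and_self, if_true]
      have hac := hval h.1.le
      have hct := hval (le_top : c ≤ ⊤)
      rw [← Set.Ico_union_Ico_eq_Ico hac hct, lintegral_union measurableSet_Ico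
        (Set.Ico_disjoint_Ico_same), Set.union_inter_distrib_right,
        measure_union ((Set.Ico_disjoint_Ico_same).mono Set.inter_subset_left Set.inter_subset_left)
          (measurableSet_Ico.inter (measurable_inr hB))]
      congr 1
      · rw [← mul_volume_draw F (val a, val c) hB, ← setLIntegral_const]
        refine setLIntegral_congr_fun measurableSet_Ico fun z hz => ?_
        simp only [if_pos hz.2]
      · rw [← ih c y]
        refine setLIntegral_congr_fun measurableSet_Ico fun z hz => ?_
        simp only [if_neg (not_lt.2 hz.1)]
    · simp only [h, if_false, setLIntegral_const]
      exact mul_volume_draw F _ hB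

end Draw

/-! ### Product measures -/

section Product

variable {ι : Type*} [Fintype ι] [DecidableEq ι] {α : ι → Type*} [∀ i, MeasurableSpace (α i)]

omit [Fintype ι] in
theorem measurable_update_prod (i : ι) :
    Measurable fun q : (∀ i, α i) × α i => Function.update q.1 i q.2 := by
  refine measurable_pi_iff.2 fun j => ?_
  by_cases h : j = i
  · subst h
    simpa using measurable_snd
  · simp only [Function.update_of_ne h]
    fun_prop

variable (ν : ∀ i, Measure (α i)) [∀ i, IsProbabilityMeasure (ν i)]

/-- Resampling one coordinate. -/
theorem map_update_pi (i : ι) (κ : Measure (α i)) [IsProbabilityMeasure κ] :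
    ((Measure.pi ν).prod κ).map (fun q => Function.update q.1 i q.2) =
      Measure.pi (Function.update ν i κ) := by
  have hp : ∀ j, IsProbabilityMeasure (Function.update ν i κ j) := by
    intro j
    by_cases h : j = i
    · subst h
      simpa using ‹IsProbabilityMeasure κ›
    · simpa [h] using ‹∀ i, IsProbabilityMeasure (ν i)› j
  have hm := measurable_update_prod (α := α) i
  refine (Measure.pi_eq fun s hs => ?_).symm
  rw [Measure.map_apply hm (MeasurableSet.univ_pi hs)]
  have : (fun q : (∀ i, α i) × α i => Function.update q.1 i q.2) ⁻¹' Set.univ.pi s =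
      Set.univ.pi (Function.update s i Set.univ) ×ˢ s i := by
    ext q
    simp only [Set.mem_preimage, Set.mem_univ_pi, Set.mem_prod]
    constructor
    · intro h
      refine ⟨fun j => ?_, by simpa using h i⟩
      by_cases hj : j = i
      · subst hj
        simp
      · simpa [hj] using h j
    · rintro ⟨h1, h2⟩ j
      by_cases hj : j = i
      · subst hj
        simpa using h2
      · simpa [hj] using h1 j
  rw [this, Measure.prod_prod, Measure.pi_pi, ← Finset.mul_prod_erase _ _ (Finset.mem_univ i),
    ← Finset.mul_prod_erase Finset.univ _ (Finset.mem_univ i)]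
  simp only [Function.update_self, measure_univ, one_mul]
  rw [mul_comm]
  congr 1
  refine Finset.prod_congr rfl fun j hj => ?_
  rw [Function.update_of_ne (Finset.ne_of_mem_erase hj),
    Function.update_of_ne (Finset.ne_of_mem_erase hj)]

omit [DecidableEq ι] in
theorem map_arrow_prod {α β γ δ : Type*} [MeasurableSpace α] [MeasurableSpace β]
    [MeasurableSpace γ] [MeasurableSpace δ] (μ : ι → Measure α) (ν : ι → Measure β)
    (κ : ι → Measure γ) [∀ i, IsProbabilityMeasure (μ i)] [∀ i, IsProbabilityMeasure (ν i)]
    [∀ i, IsProbabilityMeasure (κ i)] {h : ι → α × β × γ → δ} (hh : ∀ i, Measurable (h i)) :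
    ((Measure.pi μ).prod ((Measure.pi ν).prod (Measure.pi κ))).map
      (fun q i => h i (q.1 i, q.2.1 i, q.2.2 i)) =
      Measure.pi fun i => ((μ i).prod ((ν i).prod (κ i))).map (h i) := by
  have h1 := measurePreserving_arrowProdEquivProdArrow β γ ι ν κ
  have h2 := measurePreserving_arrowProdEquivProdArrow α (β × γ) ι μ (fun i => (ν i).prod (κ i))
  have hp : ∀ i, IsProbabilityMeasure (((μ i).prod ((ν i).prod (κ i))).map (h i)) := fun i =>
    Measure.isProbabilityMeasure_map (hh i).aemeasurable
  have h3 := ((MeasurePreserving.id (Measure.pi μ)).prod (h1.symm _))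
  have h4 := (h2.symm _).comp h3
  rw [← Measure.pi_map_pi (fun i => (hh i).aemeasurable), ← h4.map_eq,
    Measure.map_map (by fun_prop) h4.measurable]
  rfl

/-- Resampling one coordinate, with a parameter. -/
theorem measurePreserving_resample {α : ι → Type*} [∀ i, MeasurableSpace (α i)]
    (ν : ∀ i, Measure (α i)) [∀ i, IsProbabilityMeasure (ν i)] {Ω : Type*} [MeasurableSpace Ω]
    (ρ : Measure Ω) [IsProbabilityMeasure ρ] (i : ι) (κ : Measure (α i)) [IsProbabilityMeasure κ] :
    MeasurePreserving (fun q : α i × (∀ j, α j) × Ω => (Function.update q.2.1 i q.1, q.2.2))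
      (κ.prod ((Measure.pi ν).prod ρ)) ((Measure.pi (Function.update ν i κ)).prod ρ) := by
  have h1 : MeasurePreserving (fun q : (∀ j, α j) × α i => Function.update q.1 i q.2)
      ((Measure.pi ν).prod κ) (Measure.pi (Function.update ν i κ)) :=
    ⟨measurable_update_prod i, map_update_pi ν i κ⟩
  have h2 := h1.comp (Measure.measurePreserving_swap (μ := κ) (ν := Measure.pi ν))
  have h3 := h2.prod (MeasurePreserving.id ρ)
  exact h3.comp ((measurePreserving_prodAssoc κ (Measure.pi ν) ρ).symm _)

/-- The expectation of the own value on an event, in terms of interim probabilities. -/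
theorem integral_coordinate_indicator {Ω : Type*} [MeasurableSpace Ω] (F : ι → Measure ℝ)
    [∀ i, IsProbabilityMeasure (F i)] (κ : Measure Ω) [IsProbabilityMeasure κ] (i : ι)
    (hF : Integrable (fun z => z) (F i)) {S : Set ((ι → ℝ) × Ω)} (hS : MeasurableSet S) :
    ∫ q, S.indicator (fun q => q.1 i) q ∂((Measure.pi F).prod κ) =
      ∫ z, z * ((Measure.pi F).prod κ).real {q | (Function.update q.1 i z, q.2) ∈ S} ∂(F i) := by
  have hmp := measurePreserving_resample F κ i (F i)
  rw [Function.update_eq_self] at hmp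
  have hpre := hS.preimage hmp.measurable
  have hmeas : Measurable (S.indicator fun q : (ι → ℝ) × Ω => q.1 i) :=
    ((measurable_pi_apply i).comp measurable_fst).indicator hS
  rw [← hmp.map_eq, integral_map hmp.measurable.aemeasurable hmeas.aestronglyMeasurable]
  have h1 : (fun q : ℝ × (ι → ℝ) × Ω => S.indicator (fun q : (ι → ℝ) × Ω => q.1 i)
      (Function.update q.2.1 i q.1, q.2.2)) =
      ((fun q : ℝ × (ι → ℝ) × Ω => (Function.update q.2.1 i q.1, q.2.2)) ⁻¹' S).indicator
        (fun q => q.1) := by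
    funext q
    simp only [Set.indicator, Function.update_self]
    rfl
  rw [h1, integral_prod _ ((hF.comp_fst _).indicator hpre), hmp.map_eq]
  refine integral_congr_ae (Filter.Eventually.of_forall fun z => ?_)
  refine Eq.trans ?_ (mul_comm _ _)
  rw [← smul_eq_mul]
  exact integral_indicator_const z (hpre.preimage measurable_prodMk_left)

end Product

/-! ### One round -/

section Round

variable {n : ℕ}

/-- The profile given by the replies of the distribution oracle. -/
def profileOf (D : Draws n) : Profile n := fun j => (D j).elim (fun _ => 0) id

open Classical in
/-- Serve nobody if one of the windows has probability zero. -/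
def accept (D : Draws n) (T : Alloc n) : Alloc n := if ∀ j, (D j).isRight = true then T else ∅

theorem measurable_profileOf : Measurable (profileOf (n := n)) := by
  refine measurable_pi_iff.2 fun j => ?_
  exact (Measurable.sumElim measurable_const measurable_id).comp (measurable_pi_apply j)

theorem measurable_accept : Measurable fun q : Draws n × Alloc n => accept q.1 q.2 := by
  unfold accept
  refine Measurable.ite ?_ measurable_snd measurable_const
  have : {q : Draws n × Alloc n | ∀ j, (q.1 j).isRight = true} =
      ⋂ j, (fun q => q.1 j) ⁻¹' Set.range Sum.inr := by
    ext q
    simp only [Set.mem_ofPred_eq, Set.mem_iInter, Set.mem_preimage, Set.mem_range, Sum.isRight_iff]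
    exact forall_congr' fun j => exists_congr fun y => eq_comm
  rw [this]
  exact MeasurableSet.iInter fun j => measurableSet_range_inr.preimage (by fun_prop)

variable (A : Algorithm n)

/-- The allocation of the algorithm on the sampled profile. -/
def roundAlloc (D : Draws n) (r : A.Coins) : Alloc n := accept D (A.run (profileOf D, r))

theorem measurable_roundAlloc : Measurable fun q : Draws n × A.Coins => roundAlloc A q.1 q.2 :=
  measurable_accept.comp (measurable_fst.prodMk
    (A.measurable_run.comp ((measurable_profileOf.comp measurable_fst).prodMk measurable_snd)))

theorem measurableSet_mem {Ω : Type*} [MeasurableSpace Ω] {f : Ω → Alloc n} (hf : Measurable f)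
    (i : Fin n) : MeasurableSet {x | i ∈ f x} :=
  hf (MeasurableSet.of_discrete (s := {T : Alloc n | i ∈ T}))

theorem roundAlloc_inr (v : Profile n) (r : A.Coins) :
    roundAlloc A (fun j => Sum.inr (v j)) r = A.run (v, r) := by
  rw [roundAlloc, accept, if_pos (by simp)]
  rfl

theorem roundAlloc_inl {D : Draws n} {i : Fin n} {x : Unit} (h : D i = Sum.inl x) (r : A.Coins) :
    roundAlloc A D r = ∅ := by
  rw [roundAlloc, accept, if_neg]
  intro h2
  simpa [h] using h2 i

/-- The probability that `i` is served when its value is replaced by `d`. -/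
def servedMass (ν : Fin n → Measure (Unit ⊕ ℝ)) (i : Fin n) (d : Unit ⊕ ℝ) : ℝ≥0∞ :=
  ((Measure.pi ν).prod A.law) {q | i ∈ roundAlloc A (Function.update q.1 i d) q.2}

variable (ν : Fin n → Measure (Unit ⊕ ℝ)) [∀ i, IsProbabilityMeasure (ν i)] (i : Fin n)

theorem servedMass_le_one (d : Unit ⊕ ℝ) : servedMass A ν i d ≤ 1 := prob_le_one

omit [∀ i, IsProbabilityMeasure (ν i)] in
theorem servedMass_inl (x : Unit) : servedMass A ν i (Sum.inl x) = 0 := by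
  have h (D : Draws n) (r : A.Coins) :
      roundAlloc A (Function.update D i (Sum.inl x)) r = ∅ :=
    roundAlloc_inl A (D := Function.update D i (Sum.inl x)) (Function.update_self ..) r
  simp only [servedMass, h, Finset.notMem_empty, Set.ofPred_false, measure_empty]

theorem measurable_update_roundAlloc : Measurable fun q : (Unit ⊕ ℝ) × Draws n × A.Coins =>
    roundAlloc A (Function.update q.2.1 i q.1) q.2.2 := by
  refine (measurable_roundAlloc A).comp (f := fun q : (Unit ⊕ ℝ) × Draws n × A.Coins =>
    (Function.update q.2.1 i q.1, q.2.2)) (Measurable.prodMk ?_ (by fun_prop))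
  exact (measurable_update_prod i).comp (f := fun q : (Unit ⊕ ℝ) × Draws n × A.Coins =>
    (q.2.1, q.1)) (by fun_prop)

theorem measurable_servedMass : Measurable (servedMass A ν i) :=
  measurable_measure_prodMk_left (ν := (Measure.pi ν).prod A.law)
    (measurableSet_mem (measurable_update_roundAlloc A i) i)

theorem measure_served (κ : Measure (Unit ⊕ ℝ)) [IsProbabilityMeasure κ] :
    ((Measure.pi (Function.update ν i κ)).prod A.law) {q | i ∈ roundAlloc A q.1 q.2} =
      ∫⁻ d, servedMass A ν i d ∂κ := by
  have hS := measurableSet_mem (measurable_roundAlloc A) i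
  have hT := measurableSet_mem (measurable_update_roundAlloc A i) i
  have hmp := measurePreserving_resample ν A.law i κ
  rw [← hmp.measure_preimage hS.nullMeasurableSet, Set.preimage_ofPred_eq, Measure.prod_apply hT]
  rfl

end Round

/-! ### The served measure of one agent -/

section Agent

variable {n : ℕ} (A : Algorithm n) (F : Fin n → Measure ℝ) [∀ i, IsProbabilityMeasure (F i)]
  (i : Fin n)

/-- The law of the answer of the distribution oracle on a window of full mass. -/
abbrev answerLaw (F : Fin n → Measure ℝ) (i : Fin n) : Measure (Unit ⊕ ℝ) := (F i).map Sum.inr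

instance : IsProbabilityMeasure (answerLaw F i) :=
  Measure.isProbabilityMeasure_map measurable_inr.aemeasurable

/-- The part of the prior of agent `i` on which it is served. -/
def served : Measure ℝ := (F i).withDensity fun x => servedMass A (answerLaw F) i (Sum.inr x)

theorem measurable_servedMass_inr :
    Measurable fun x : ℝ => servedMass A (answerLaw F) i (Sum.inr x) :=
  (measurable_servedMass A (answerLaw F) i).comp measurable_inr

theorem served_le : served A F i ≤ F i := by
  have h := withDensity_mono (μ := F i) (f := fun x => servedMass A (answerLaw F) i (Sum.inr x))
    (g := 1) (Filter.Eventually.of_forall fun x => servedMass_le_one A (answerLaw F) i _)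
  rwa [withDensity_one] at h

/-- The average probability of service in a window. -/
theorem lintegral_servedMass_draw (w : ℝ × ℝ) :
    ∫⁻ u, servedMass A (answerLaw F) i (draw (F i) w u) =
      served A F i (Set.Ico w.1 w.2) / F i (Set.Ico w.1 w.2) := by
  have hm := measurable_servedMass A (answerLaw F) i
  -- On a null window the oracle reports failure and nobody is served, in agreement with 0 / 0 = 0.
  -- This covers deviating bids in pools without mass.
  by_cases h : F i (Set.Ico w.1 w.2) = 0
  · have h2 : served A F i (Set.Ico w.1 w.2) = 0 :=
      le_antisymm ((served_le A F i _).trans h.le) zero_le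
    simp [draw, h, h2, servedMass_inl]
  · rw [← lintegral_map hm (measurable_draw (F i) w), map_draw (F i) h,
      lintegral_map hm measurable_inr, ProbabilityTheory.cond, lintegral_smul_measure, served,
      withDensity_apply _ measurableSet_Ico, smul_eq_mul, ENNReal.div_eq_inv_mul]

theorem measurePreserving_answers :
    MeasurePreserving (fun q : Profile n × A.Coins => ((fun j => Sum.inr (q.1 j), q.2) :
      Draws n × A.Coins)) ((Measure.pi F).prod A.law) ((Measure.pi (answerLaw F)).prod A.law) := by
  have h : MeasurePreserving (fun (v : Profile n) j => (Sum.inr (v j) : Unit ⊕ ℝ)) (Measure.pi F)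
      (Measure.pi (answerLaw F)) :=
    ⟨by fun_prop, Measure.pi_map_pi fun i => measurable_inr.aemeasurable⟩
  exact h.prod (MeasurePreserving.id A.law)

theorem lintegral_cost_answers (c : Alloc n → ℝ≥0∞) :
    ∫⁻ q, c (roundAlloc A q.1 q.2) ∂((Measure.pi (answerLaw F)).prod A.law) =
      ∫⁻ q, c (A.run q) ∂((Measure.pi F).prod A.law) := by
  have hc : Measurable fun q : Draws n × A.Coins => c (roundAlloc A q.1 q.2) :=
    (Measurable.of_discrete (f := c)).comp (measurable_roundAlloc A)
  rw [← (measurePreserving_answers A F).lintegral_comp hc]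
  simp only [roundAlloc_inr]

theorem servedMass_inr (x : ℝ) : servedMass A (answerLaw F) i (Sum.inr x) =
    ((Measure.pi F).prod A.law) {q | A.run (Function.update q.1 i x, q.2) ∈ {T | i ∈ T}} := by
  have hS : MeasurableSet {q : Draws n × A.Coins |
      i ∈ roundAlloc A (Function.update q.1 i (Sum.inr x)) q.2} :=
    (measurableSet_mem (measurable_update_roundAlloc A i) i).preimage
      (measurable_prodMk_left (x := (Sum.inr x : Unit ⊕ ℝ)))
  rw [servedMass, ← (measurePreserving_answers A F).measure_preimage hS.nullMeasurableSet]
  congr 1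
  ext q
  have : Function.update (fun j => Sum.inr (q.1 j)) i (Sum.inr x) =
      fun j => (Sum.inr (Function.update q.1 i x j) : Unit ⊕ ℝ) := by
    funext j
    by_cases h : j = i
    · subst h
      simp
    · simp [h]
  simp only [Set.mem_preimage, Set.mem_ofPred_eq, this, roundAlloc_inr]

/-- The expected value of agent `i` in the algorithm. -/
theorem integral_served (hF : Integrable (fun z => z) (F i)) :
    ∫ z, z ∂(served A F i) =
      ∫ q, {q | i ∈ A.run q}.indicator (fun q => q.1 i) q ∂((Measure.pi F).prod A.law) := by
  rw [integral_coordinate_indicator F A.law i hF (measurableSet_mem A.measurable_run i), served,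
    integral_withDensity_eq_integral_toReal_smul (measurable_servedMass_inr A F i)
      (Filter.Eventually.of_forall fun x =>
        (servedMass_le_one A (answerLaw F) i _).trans_lt ENNReal.one_lt_top)]
  refine integral_congr_ae (Filter.Eventually.of_forall fun z => ?_)
  simp only [servedMass_inr, smul_eq_mul]
  exact mul_comm _ _

theorem served_div_eq (val : ℕ → ℝ) (a b : ℕ) :
    served A F i (Set.Ico (val a) (val b)) / F i (Set.Ico (val a) (val b)) =
      ENNReal.ofReal (avgAlloc (F i) (served A F i) val a b) := by
  rw [avgAlloc, measureReal_def, measureReal_def, ← ENNReal.toReal_div, ENNReal.ofReal_toReal]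
  exact ne_top_of_le_ne_top ENNReal.one_ne_top (ENNReal.div_le_of_le_mul
    (by simpa using served_le A F i (Set.Ico (val a) (val b))))

end Agent

/-! ### Resampling preserves the prior -/

section Answers

variable (F : Measure ℝ) [IsProbabilityMeasure F] {val : ℕ → ℝ} {J M : ℕ}

/-- The window between two grid points. -/
def gridWindow (val : ℕ → ℝ) (w : Fin (J + 1) × Fin (J + 1)) : ℝ × ℝ := (val w.1, val w.2)

theorem map_draw_full (h : ∀ᵐ v ∂F, v ∈ Set.Ico (val 0) (val J)) :
    (volume : Measure unitInterval).map
      (draw F (gridWindow val ((⊥, ⊤) : Fin (J + 1) × Fin (J + 1)))) = F.map Sum.inr := by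
  have h1 : F (Set.Ico (val 0) (val J)) = 1 := (prob_compl_eq_zero_iff measurableSet_Ico).1 h
  ext B hB
  have h2 := mul_volume_draw F (val 0, val J) hB
  simp only [h1, mul_one] at h2
  rw [Measure.map_apply (measurable_draw F _) hB, Measure.map_apply measurable_inr hB]
  refine Eq.trans h2 ?_
  rw [Set.inter_comm, ← Measure.restrict_apply (measurable_inr hB),
    Measure.restrict_eq_self_of_ae_mem h]

theorem measurable_pool (δ : ℝ) : Measurable fun q : Table J M × ℝ =>
    Table.pool δ (fun c => val c) q.1 q.2 :=
  measurable_from_prod_countable_right fun ω =>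
    measurable_poolOf (Table.Verified δ ω) (fun c : Fin (J + 1) => val c) (ω.chain δ) ⊥ (-1)

theorem measurable_draw_pool (δ : ℝ) : Measurable fun q : ℝ × Table J M × unitInterval =>
    draw F (gridWindow val (Table.pool δ (fun c => val c) q.2.1 q.1)) q.2.2 :=
  measurable_uncurry_draw F (gridWindow val) ((measurable_pool (val := val) δ).comp
    (f := fun q : ℝ × Table J M × unitInterval => (q.2.1, q.1)) (by fun_prop)) (by fun_prop)

/-- Resampling a random value from its pool does not change its law. -/
theorem map_draw_pool (h : ∀ᵐ v ∂F, v ∈ Set.Ico (val 0) (val J)) (hval : Monotone val)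
    (Λ : Measure (Table J M)) [IsProbabilityMeasure Λ] (δ : ℝ) :
    (F.prod (Λ.prod (volume : Measure unitInterval))).map
      (fun q => draw F (gridWindow val (Table.pool δ (fun c => val c) q.2.1 q.1)) q.2.2) =
      F.map Sum.inr := by
  ext B hB
  have hm := measurable_draw_pool F (val := val) (J := J) (M := M) δ
  rw [Measure.map_apply hm hB, Measure.map_apply measurable_inr hB]
  have hB2 := hm hB
  rw [Measure.prod_apply hB2]
  have h1 : ∀ z, (Λ.prod volume) (Prod.mk z ⁻¹' ((fun q : ℝ × Table J M × unitInterval =>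
      draw F (gridWindow val (Table.pool δ (fun c => val c) q.2.1 q.1)) q.2.2) ⁻¹' B)) =
      ∫⁻ ω, volume (draw F (gridWindow val (Table.pool δ (fun c => val c) ω z)) ⁻¹' B) ∂Λ :=
    fun z => by
      rw [Measure.prod_apply (hB2.preimage measurable_prodMk_left)]
      rfl
  simp only [h1]
  rw [lintegral_lintegral_swap]
  · have h2 : ∀ ω : Table J M, ∫⁻ z, volume (draw F (gridWindow val
        (Table.pool δ (fun c => val c) ω z)) ⁻¹' B) ∂F = F (Sum.inr ⁻¹' B) := fun ω => by
      have h3 := lintegral_draw_poolOf F (Table.Verified δ ω) (val := fun c : Fin (J + 1) => val c)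
        (fun a b hab => hval hab) (ω.chain δ) ⊥ (-1) hB
      have h4 : ∀ᵐ v ∂F, v ∈ Set.Ico (val (⊥ : Fin (J + 1))) (val (⊤ : Fin (J + 1))) := h
      rw [Measure.restrict_eq_self_of_ae_mem h4, Set.inter_comm,
        ← Measure.restrict_apply (measurable_inr hB), Measure.restrict_eq_self_of_ae_mem h4] at h3
      exact h3
    simp only [h2, lintegral_const, measure_univ, mul_one]
  · have hg : Measurable fun q : (ℝ × Table J M) × unitInterval =>
      draw F (gridWindow val (Table.pool δ (fun c => val c) q.1.2 q.1.1)) q.2 :=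
      hm.comp (f := fun q : (ℝ × Table J M) × unitInterval => (q.1.1, q.1.2, q.2)) (by fun_prop)
    exact (measurable_measure_prodMk_left (ν := (volume : Measure unitInterval)) (hg hB)).aemeasurable

end Answers

/-! ### The laws of the recorded data -/

section Agent

variable {n : ℕ} (A : Algorithm n) (F : Fin n → Measure ℝ) [∀ i, IsProbabilityMeasure (F i)]
  (i : Fin n) {val : ℕ → ℝ} {J M : ℕ}

theorem toReal_lintegral_draw_pool (Λ : Measure (Table J M)) [IsProbabilityMeasure Λ] (δ z : ℝ) :
    (∫⁻ d, servedMass A (answerLaw F) i d ∂((Λ.prod (volume : Measure unitInterval)).map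
      fun q => draw (F i) (gridWindow val (Table.pool δ (fun c => val c) q.1 z)) q.2)).toReal =
      ∫ ω : Table J M, (fun w : Fin (J + 1) × Fin (J + 1) =>
        avgAlloc (F i) (served A F i) val w.1 w.2) (Table.pool δ (fun c => val c) ω z) ∂Λ := by
  have hs := measurable_servedMass A (answerLaw F) i
  have hm : Measurable fun q : Table J M × unitInterval =>
      draw (F i) (gridWindow val (Table.pool δ (fun c => val c) q.1 z)) q.2 :=
    (measurable_draw_pool (F i) δ).comp (f := fun q : Table J M × unitInterval => (z, q))
      (by fun_prop)
  rw [lintegral_map hs hm, lintegral_prod (fun q : Table J M × unitInterval => servedMass A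
    (answerLaw F) i (draw (F i) (gridWindow val (Table.pool δ (fun c => val c) q.1 z)) q.2))
    (hs.comp hm).aemeasurable]
  simp only [lintegral_servedMass_draw]
  rw [integral_eq_lintegral_of_nonneg_ae
    (Filter.Eventually.of_forall fun ω => GridPrior.avgAlloc_nonneg _ _) .of_discrete]
  congr 1
  exact lintegral_congr fun ω => served_div_eq A F i val _ _

/-- The window of the agent to which a round is devoted. -/
def sampleWindow (r : RoundIdx J M) : Fin (J + 1) × Fin (J + 1) :=
  if r.2.2.1 = 1 ∨ r.2.2.1 = 4 then (r.1, ⊤) else if r.2.2.1 = 3 then (r.2.1, ⊤) else (r.1, r.2.1)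

/-- The windows in a round devoted to agent `i`. -/
def roundWindow (i : Fin n) (r : RoundIdx J M) (j : Fin n) : Fin (J + 1) × Fin (J + 1) :=
  if j = i then sampleWindow r else (⊥, ⊤)

open Classical in
/-- The grid points above the answer of the distribution oracle. -/
def hits (val : ℕ → ℝ) (J : ℕ) (d : Unit ⊕ ℝ) (b : Fin (J + 1)) : Bool :=
  decide (d ∈ Sum.inr '' Set.Iio (val b))

/-- What is remembered of a round devoted to agent `i`. -/
def datumOf (val : ℕ → ℝ) (J : ℕ) (i : Fin n) (D : Draws n) (T : Alloc n) : Datum J :=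
  (decide (i ∈ accept D T), hits val J (D i))

theorem measurable_hits : Measurable (hits val J) := by
  refine measurable_pi_iff.2 fun b => measurable_to_bool ?_
  have : (fun d => hits val J d b) ⁻¹' {true} = Sum.inr '' Set.Iio (val b) := by
    ext d
    simp [hits]
  rw [this]
  exact measurableSet_Iio.inr_image

theorem measurable_datumOf :
    Measurable fun q : Draws n × Alloc n => datumOf val J i q.1 q.2 := by
  refine Measurable.prodMk ?_ (measurable_hits.comp (by fun_prop))
  exact (Measurable.of_discrete (f := fun T : Alloc n => decide (i ∈ T))).comp measurable_accept

/-- The answers of the distribution oracle on given windows. -/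
def answers (val : ℕ → ℝ) (w : Fin n → Fin (J + 1) × Fin (J + 1)) (u : Fin n → unitInterval) :
    Draws n := fun j => draw (F j) (gridWindow val (w j)) (u j)

theorem measurable_answers (w : Fin n → Fin (J + 1) × Fin (J + 1)) :
    Measurable (answers F val w) :=
  measurable_pi_iff.2 fun j => (measurable_draw (F j) _).comp (measurable_pi_apply j)

/-- The datum of a round devoted to agent `i`, as a function of the coins. -/
def sample (val : ℕ → ℝ) (r : RoundIdx J M) (q : (Fin n → unitInterval) × A.Coins) : Datum J :=
  datumOf val J i (answers F val (roundWindow i r) q.1)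
    (A.run (profileOf (answers F val (roundWindow i r) q.1), q.2))

/-- The law of the datum of a round devoted to agent `i`. -/
def sampleLaw (val : ℕ → ℝ) (r : RoundIdx J M) : Measure (Datum J) :=
  ((volume : Measure (Fin n → unitInterval)).prod A.law).map (sample A F i val r)

theorem measurable_sample (r : RoundIdx J M) :
    Measurable (sample A F i val r) := by
  have h : Measurable fun q : (Fin n → unitInterval) × A.Coins =>
      answers F val (roundWindow i r) q.1 := (measurable_answers F _).comp measurable_fst
  exact (measurable_datumOf i).comp (h.prodMk (A.measurable_run.comp
    ((measurable_profileOf.comp h).prodMk measurable_snd)))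

instance (r : RoundIdx J M) : IsProbabilityMeasure (sampleLaw A F i val r) :=
  Measure.isProbabilityMeasure_map (measurable_sample A F i r).aemeasurable

variable (hF : ∀ j, ∀ᵐ v ∂F j, v ∈ Set.Ico (val 0) (val J))
include hF

/-- All agents but i are sampled from windows of full mass, hence from their priors. -/
theorem map_answers (r : RoundIdx J M) :
    (volume : Measure (Fin n → unitInterval)).map (answers F val (roundWindow i r)) =
      Measure.pi (Function.update (answerLaw F) i
        ((volume : Measure unitInterval).map (draw (F i) (gridWindow val (sampleWindow r))))) := by
  have hp (j : Fin n) : IsProbabilityMeasure ((volume : Measure unitInterval).map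
      (draw (F j) (gridWindow val (roundWindow i r j)))) :=
    Measure.isProbabilityMeasure_map (measurable_draw _ _).aemeasurable
  rw [volume_pi]
  unfold answers
  rw [Measure.pi_map_pi fun j => (measurable_draw _ _).aemeasurable]
  congr 1
  funext j
  by_cases h : j = i
  · subst h
    simp [roundWindow]
  · rw [Function.update_of_ne h, roundWindow, if_neg h]
    exact map_draw_full (F j) (hF j)

theorem sampleLaw_served (r : RoundIdx J M) :
    (sampleLaw A F i val r).real {x | x.1 = true} =
      avgAlloc (F i) (served A F i) val (sampleWindow r).1 (sampleWindow r).2 := by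
  have hp : IsProbabilityMeasure ((volume : Measure unitInterval).map
      (draw (F i) (gridWindow val (sampleWindow r)))) :=
    Measure.isProbabilityMeasure_map (measurable_draw _ _).aemeasurable
  have hmp : MeasurePreserving (Prod.map (answers F val (roundWindow i r)) (id : A.Coins → A.Coins))
      ((volume : Measure (Fin n → unitInterval)).prod A.law) _ :=
    (⟨measurable_answers F _, map_answers F i hF r⟩ : MeasurePreserving _ _ _).prod
      (MeasurePreserving.id A.law)
  rw [measureReal_def, sampleLaw, Measure.map_apply (measurable_sample A F i r) .of_discrete]
  have h1 : sample A F i val r ⁻¹' {x | x.1 = true} =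
      Prod.map (answers F val (roundWindow i r)) (id : A.Coins → A.Coins) ⁻¹'
        {q | i ∈ roundAlloc A q.1 q.2} := by
    ext q
    simp [sample, datumOf, roundAlloc]
  rw [h1, hmp.measure_preimage
    (measurableSet_mem (measurable_roundAlloc A) i).nullMeasurableSet, measure_served,
    lintegral_map (measurable_servedMass A _ i) (measurable_draw _ _), lintegral_servedMass_draw,
    gridWindow, served_div_eq, ENNReal.toReal_ofReal (GridPrior.avgAlloc_nonneg _ _)]

omit hF in
theorem sampleLaw_hit (hval : Monotone val) (r : RoundIdx J M) (b : Fin (J + 1)) {a : Fin (J + 1)}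
    (hr : sampleWindow r = (a, ⊤)) :
    (sampleLaw A F i val r).real {x | x.2 b = true} = relMass (F i) val J a b := by
  rw [measureReal_def, sampleLaw, Measure.map_apply (measurable_sample A F i r) .of_discrete]
  have hB : MeasurableSet (Sum.inr '' Set.Iio (val b) : Set (Unit ⊕ ℝ)) :=
    measurableSet_Iio.inr_image
  have h1 : sample A F i val r ⁻¹' {x | x.2 b = true} =
      ((fun u : Fin n → unitInterval => u i) ⁻¹' (draw (F i) (gridWindow val (a, (⊤ : Fin (J + 1))))
        ⁻¹' (Sum.inr '' Set.Iio (val b)))) ×ˢ Set.univ := by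
    ext q
    simp [sample, datumOf, hits, answers, roundWindow, hr]
  have h2 := mul_volume_draw (F i) (val a, val J) hB
  rw [Set.preimage_image_eq _ Sum.inr_injective, Set.Ico_inter_Iio,
    min_eq_right (hval (Nat.lt_succ_iff.1 b.2))] at h2
  rw [h1, Measure.prod_prod, measure_univ, mul_one, volume_pi,
    (measurePreserving_eval (fun _ : Fin n => (volume : Measure unitInterval)) i).measure_preimage
      (measurable_draw _ _ hB).nullMeasurableSet, relMass, measureReal_def, measureReal_def, ← h2,
    ENNReal.toReal_mul]
  -- On a null tail the oracle never returns a value, so there are no hits, matching the convention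
  -- 0 / 0 = 0 in `relMass`.
  by_cases h3 : F i (Set.Ico (val a) (val J)) = 0
  · have h4 : draw (F i) (gridWindow val (a, (⊤ : Fin (J + 1)))) ⁻¹'
        (Sum.inr '' Set.Iio (val b)) = ∅ := by
      ext u
      have h5 : F i (Set.Ico (gridWindow val (a, (⊤ : Fin (J + 1)))).1
        (gridWindow val (a, (⊤ : Fin (J + 1)))).2) = 0 := h3
      simp [draw, h5]
    rw [h4, h3]
    simp
  · rw [mul_div_cancel_right₀]
    · rfl
    · exact (ENNReal.toReal_pos h3 (measure_ne_top _ _)).ne'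

theorem isLaw_sampleLaw (hval : Monotone val) : Table.IsLaw (J := J) (M := M) (sampleLaw A F i val)
    (fun a b => avgAlloc (F i) (served A F i) val a b) (fun a b => relMass (F i) val J a b) where
  prob _ := inferInstance
  bit0 _ _ _ := sampleLaw_served A F i hF _
  bit2 _ _ _ := sampleLaw_served A F i hF _
  bit3 _ _ _ := sampleLaw_served A F i hF _
  hit1 _ _ _ b := sampleLaw_hit A F i hval _ b rfl
  hit4 _ _ _ b := sampleLaw_hit A F i hval _ b rfl

end Agent

/-! ### Executions -/

theorem Reduction.transcript_apply {n : ℕ} {vmax : ℝ} (R : Reduction n) (S : Setting n vmax)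
    (A : Algorithm n) (b : Profile n) (τ : R.Tape A) {t : ℕ} (ht : t ≤ R.calls) (k : Fin t) :
    R.transcript S A b τ t ht k =
      R.reply S A τ.1 b k (R.transcript S A b τ k (k.2.le.trans ht))
        (τ.2 ⟨k, k.2.trans_le ht⟩).1 (τ.2 ⟨k, k.2.trans_le ht⟩).2 := by
  induction t with
  | zero => exact k.elim0
  | succ t ih =>
    refine Fin.lastCases ?_ (fun j => ?_) k
    · simp [Reduction.transcript]
    · simp only [Reduction.transcript, Fin.snoc_castSucc]
      exact ih _ j

/-- The parameters of the reduction: a grid, the number of repetitions, the tolerance, and the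
probability of a test run. -/
structure Scheme where
  J : ℕ
  M : ℕ
  val : ℕ → ℝ
  δ : ℝ
  ρ : ℝ

namespace Scheme

variable (P : Scheme) (n : ℕ)

/-- The fraction of the grid points below a bid. -/
def height (z : ℝ) : ℝ := (∑ j ∈ Finset.range P.J, if P.val (j + 1) ≤ z then (1 : ℝ) else 0) / P.J

/-- The coins for which agent `j` is tested. -/
def block (j : Fin n) : Set unitInterval :=
  {s | P.ρ * j / n ≤ (s : ℝ) ∧ (s : ℝ) < P.ρ * (j + 1) / n}

/-- The coins for which the bid of agent `j` passes the test. -/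
def passes (j : Fin n) (z : ℝ) : Set unitInterval :=
  {s | P.ρ * j / n ≤ (s : ℝ) ∧ (s : ℝ) < P.ρ * (j + P.height z) / n}

/-- The coins for which nobody is tested. -/
def regular : Set unitInterval := {s | P.ρ ≤ (s : ℝ)}

variable {n}

/-- The allocation is kept if nobody is tested or if the test is passed. -/
def Keep (s : unitInterval) (b : Profile n) : Prop := s ∈ P.regular ∨ ∃ j, s ∈ P.passes n j (b j)

abbrev Tables (n : ℕ) : Type := Fin n → Table P.J P.M

open Classical in
/-- The windows for the final draws. -/
def finalWindow (s : unitInterval) (b : Profile n) (tb : P.Tables n) (j : Fin n) :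
    Fin (P.J + 1) × Fin (P.J + 1) :=
  -- While another agent is tested, the bid of j is ignored and its prior is sampled. Such coins add
  -- a constant to the interim allocation of j.
  if s ∈ P.regular ∪ P.block n j then Table.pool P.δ (fun c => P.val c) (tb j) (b j) else (⊥, ⊤)

open Classical in
/-- The outcome of a final round. -/
def outcome (s : unitInterval) (b : Profile n) (y : Reply n) : Alloc n :=
  if P.Keep s b then accept y.1 y.2.1 else ∅

variable (n) in
/-- The number of samples. -/
def samples : ℕ := Fintype.card (Fin n × RoundIdx P.J P.M)

variable (n) in
/-- An enumeration of the samples. -/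
def enum : Fin n × RoundIdx P.J P.M ≃ Fin (P.samples n) := Fintype.equivFin _

/-- The tables extracted from a history. -/
def tableOf {t : ℕ} (h : History n t) : P.Tables n := fun i r =>
  if ht : (P.enum n (i, r) : ℕ) < t then
    datumOf P.val P.J i (h ⟨P.enum n (i, r), ht⟩).1 (h ⟨P.enum n (i, r), ht⟩).2.1
  -- This default never matters: the final rounds come after all samples.
  else (false, fun _ => false)

/-- The bids used in the final round number `k`: the true ones for `k = 0`; in round `i + 1` the bid
of agent `i` is scaled. -/
def bidsAt (u : unitInterval) (b : Profile n) (k : ℕ) : Profile n :=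
  fun j => if (j : ℕ) + 1 = k then u * b j else b j

theorem measurable_height : Measurable P.height := by
  unfold height
  refine Measurable.div_const (Finset.measurable_fun_sum _ fun j _ => ?_) _
  exact Measurable.ite measurableSet_Ici measurable_const measurable_const

theorem measurableSet_regular : MeasurableSet P.regular :=
  measurableSet_le measurable_const (by fun_prop)

theorem measurableSet_block (j : Fin n) : MeasurableSet (P.block n j) :=
  (measurableSet_le measurable_const measurable_subtype_coe).inter
    (measurableSet_lt measurable_subtype_coe measurable_const)

theorem measurableSet_keep :
    MeasurableSet {q : unitInterval × Profile n | P.Keep q.1 q.2} := by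
  have h : {q : unitInterval × Profile n | P.Keep q.1 q.2} = (Prod.fst ⁻¹' P.regular) ∪
      ⋃ j : Fin n, {q : unitInterval × Profile n | P.ρ * j / n ≤ (q.1 : ℝ) ∧
        (q.1 : ℝ) < P.ρ * (j + P.height (q.2 j)) / n} := by
    ext q
    simp [Keep, passes]
  rw [h]
  refine (P.measurableSet_regular.preimage measurable_fst).union (.iUnion fun j => ?_)
  have h1 : Measurable fun q : unitInterval × Profile n => (q.1 : ℝ) := by fun_prop
  have h2 := P.measurable_height.comp
    (f := fun q : unitInterval × Profile n => q.2 j) (by fun_prop)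
  exact (measurableSet_le measurable_const h1).inter
    (measurableSet_lt h1 ((measurable_const.mul (measurable_const.add h2)).div_const _))

theorem measurable_finalWindow (j : Fin n) :
    Measurable fun q : unitInterval × Profile n × P.Tables n => P.finalWindow q.1 q.2.1 q.2.2 j := by
  unfold finalWindow
  refine Measurable.ite ((P.measurableSet_regular.union (P.measurableSet_block j)).preimage
    measurable_fst) ?_ measurable_const
  exact (measurable_pool (val := P.val) P.δ).comp
    (f := fun q : unitInterval × Profile n × P.Tables n => (q.2.2 j, q.2.1 j)) (by fun_prop)

theorem measurable_outcome :
    Measurable fun q : (unitInterval × Profile n) × Reply n => P.outcome q.1.1 q.1.2 q.2 := by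
  unfold outcome
  refine Measurable.ite (P.measurableSet_keep.preimage measurable_fst) ?_ measurable_const
  exact measurable_accept.comp
    (f := fun q : (unitInterval × Profile n) × Reply n => (q.2.1, q.2.2.1)) (by fun_prop)

theorem measurable_tableOf {t : ℕ} : Measurable (P.tableOf (n := n) (t := t)) := by
  refine measurable_pi_iff.2 fun i => measurable_pi_iff.2 fun r => ?_
  unfold tableOf
  by_cases ht : (P.enum n (i, r) : ℕ) < t
  · simp only [ht, dif_pos]
    exact (measurable_datumOf i).comp (f := fun h : History n t =>
      ((h ⟨P.enum n (i, r), ht⟩).1, (h ⟨P.enum n (i, r), ht⟩).2.1)) (by fun_prop)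
  · simp only [ht, dif_neg, not_false_eq_true]
    exact measurable_const

theorem measurable_bidsAt (k : ℕ) :
    Measurable fun q : unitInterval × Profile n => bidsAt q.1 q.2 k := by
  refine measurable_pi_iff.2 fun j => ?_
  unfold bidsAt
  split_ifs <;> fun_prop

open Classical in
variable (n) in
/-- The reduction. -/
def reduction : Reduction n where
  -- The first coin decides about tests, the second scales bids for payments. The first `samples`
  -- rounds fill the tables; of the n + 1 final rounds, the first determines the allocation and each
  -- other one the payment of one agent.
  Seed := unitInterval × unitInterval
  seedLaw := volume
  calls := P.samples n + (n + 1)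
  window t q j := gridWindow P.val
    (if ht : t < P.samples n then
      roundWindow ((P.enum n).symm ⟨t, ht⟩).1 ((P.enum n).symm ⟨t, ht⟩).2 j
    else P.finalWindow q.1.1 (bidsAt q.1.2 q.2.1 (t - P.samples n)) (P.tableOf q.2.2) j)
  query t q := profileOf q.2
  alloc q := P.outcome q.1.1 q.2.1 (q.2.2 ⟨P.samples n, by omega⟩)
  -- An unbiased estimate of Myerson's payment: for uniform u, the mean of z x(u z) is ∫_0^z x.
  pay q i := q.2.1 i *
    ((if i ∈ P.outcome q.1.1 q.2.1 (q.2.2 ⟨P.samples n, by omega⟩) then 1 else 0) -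
      (if i ∈ P.outcome q.1.1 (bidsAt q.1.2 q.2.1 (i + 1))
        (q.2.2 ⟨P.samples n + (i + 1), by omega⟩) then 1 else 0))
  measurable_window t := by
    refine measurable_pi_iff.2 fun j => ?_
    refine (Measurable.of_discrete (f := gridWindow (J := P.J) P.val)).comp ?_
    by_cases ht : t < P.samples n
    · simp only [ht, dif_pos]
      exact measurable_const
    · simp only [ht, dif_neg, not_false_eq_true]
      refine (P.measurable_finalWindow j).comp
        (f := fun q : (unitInterval × unitInterval) × Profile n × History n t =>
          (q.1.1, bidsAt q.1.2 q.2.1 (t - P.samples n), P.tableOf q.2.2)) ?_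
      refine Measurable.prodMk (by fun_prop) (Measurable.prodMk ?_ ?_)
      · exact (measurable_bidsAt _).comp
          (f := fun q : (unitInterval × unitInterval) × Profile n × History n t =>
            (q.1.2, q.2.1)) (by fun_prop)
      · exact P.measurable_tableOf.comp (by fun_prop)
  measurable_query t := measurable_profileOf.comp measurable_snd
  measurable_alloc := P.measurable_outcome.comp
    (f := fun q : (unitInterval × unitInterval) × Profile n × History n (P.samples n + (n + 1)) =>
      ((q.1.1, q.2.1), q.2.2 ⟨P.samples n, by omega⟩)) (by fun_prop)
  measurable_pay := by
    refine measurable_pi_iff.2 fun i => ?_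
    refine Measurable.mul (by fun_prop) (Measurable.sub ?_ ?_)
    · refine Measurable.ite (measurableSet_mem ?_ i) measurable_const measurable_const
      exact P.measurable_outcome.comp
        (f := fun q : (unitInterval × unitInterval) × Profile n ×
          History n (P.samples n + (n + 1)) =>
            ((q.1.1, q.2.1), q.2.2 ⟨P.samples n, by omega⟩)) (by fun_prop)
    · refine Measurable.ite (measurableSet_mem ?_ i) measurable_const measurable_const
      refine P.measurable_outcome.comp
        (f := fun q : (unitInterval × unitInterval) × Profile n ×
          History n (P.samples n + (n + 1)) =>
            ((q.1.1, bidsAt q.1.2 q.2.1 (i + 1)), q.2.2 ⟨P.samples n + (i + 1), by omega⟩)) ?_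
      refine Measurable.prodMk (Measurable.prodMk (by fun_prop) ?_) (by fun_prop)
      exact (measurable_bidsAt _).comp
          (f := fun q : (unitInterval × unitInterval) × Profile n ×
            History n (P.samples n + (n + 1)) => (q.1.2, q.2.1)) (by fun_prop)

/-! ### The execution of the reduction -/

variable {vmax : ℝ} (S : Setting n vmax) (A : Algorithm n)

/-- The coins of all rounds. -/
abbrev RoundCoins : Type _ := Fin (P.samples n + (n + 1)) → (Fin n → unitInterval) × A.Coins

/-- The tables as a function of the coins. -/
def tables (ω : P.RoundCoins A) : P.Tables n := fun i r =>
  sample A S.prior i P.val r (ω (Fin.castAdd (n + 1) (P.enum n (i, r))))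

open Classical in
/-- The result of a final round. -/
def lottery (s : unitInterval) (b : Profile n) (tb : P.Tables n)
    (c : (Fin n → unitInterval) × A.Coins) : Alloc n :=
  if P.Keep s b then roundAlloc A (answers S.prior P.val (P.finalWindow s b tb) c.1) c.2 else ∅

theorem tableOf_transcript (b : Profile n) (τ : (P.reduction n).Tape A) {t : ℕ}
    (ht : t ≤ (P.reduction n).calls) (h : P.samples n ≤ t) :
    P.tableOf ((P.reduction n).transcript S A b τ t ht) = P.tables S A τ.2 := by
  funext i r
  have h1 : (P.enum n (i, r) : ℕ) < t := (P.enum n (i, r)).2.trans_le h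
  simp only [tableOf, h1, dif_pos]
  rw [Reduction.transcript_apply]
  simp only [Reduction.reply, reduction, Fin.is_lt, dif_pos, Fin.eta, Equiv.symm_apply_apply]
  rfl

open Classical in
theorem outcome_transcript (b : Profile n) (τ : (P.reduction n).Tape A) (k : Fin (n + 1)) :
    P.outcome τ.1.1 (bidsAt τ.1.2 b k) ((P.reduction n).transcript S A b τ
      (P.reduction n).calls le_rfl (Fin.natAdd (P.samples n) k)) =
      P.lottery S A τ.1.1 (bidsAt τ.1.2 b k) (P.tables S A τ.2)
        (τ.2 (Fin.natAdd (P.samples n) k)) := by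
  refine (congrArg (P.outcome τ.1.1 (bidsAt τ.1.2 b k)) (Reduction.transcript_apply
    (P.reduction n) S A b τ le_rfl (Fin.natAdd (P.samples n) k))).trans ?_
  have h1 : ¬ P.samples n + (k : ℕ) < P.samples n := by omega
  have hk : P.samples n + (k : ℕ) ≤ P.samples n + (n + 1) := by omega
  have h2 : (fun i => draw (S.prior i) ((P.reduction n).window (P.samples n + k)
      (τ.1, b, (P.reduction n).transcript S A b τ (P.samples n + k) hk) i)
        ((τ.2 (Fin.natAdd (P.samples n) k)).1 i)) =
      answers S.prior P.val (P.finalWindow τ.1.1 (bidsAt τ.1.2 b k) (P.tables S A τ.2))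
        (τ.2 (Fin.natAdd (P.samples n) k)).1 := by
    funext i
    rw [answers, ← P.tableOf_transcript S A b τ (t := P.samples n + k) hk (by omega)]
    simp only [reduction, h1, dif_neg, not_false_eq_true, Nat.add_sub_cancel_left]
  exact congrArg (fun D => if P.Keep τ.1.1 (bidsAt τ.1.2 b k) then
    roundAlloc A D (τ.2 (Fin.natAdd (P.samples n) k)).2 else ∅) h2

end Scheme

section Rearrange

variable {α β γ δ : Type*} [MeasurableSpace α] [MeasurableSpace β] [MeasurableSpace γ]
  [MeasurableSpace δ] (μ : Measure α) (ν : Measure β) (κ : Measure γ) (ρ : Measure δ)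
  [IsProbabilityMeasure μ] [IsProbabilityMeasure ν] [IsProbabilityMeasure κ]
  [IsProbabilityMeasure ρ]

theorem measurePreserving_left_comm :
    MeasurePreserving (fun q : α × β × γ => (q.2.1, q.1, q.2.2)) (μ.prod (ν.prod κ))
      (ν.prod (μ.prod κ)) :=
  (measurePreserving_prodAssoc ν μ κ).comp
    (((Measure.measurePreserving_swap (μ := μ) (ν := ν)).prod (MeasurePreserving.id κ)).comp
      ((measurePreserving_prodAssoc μ ν κ).symm _))

theorem measurePreserving_prodAssoc₄ :
    MeasurePreserving (fun q : α × β × γ × δ => ((q.1, q.2.1, q.2.2.1), q.2.2.2))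
      (μ.prod (ν.prod (κ.prod ρ))) ((μ.prod (ν.prod κ)).prod ρ) :=
  (((measurePreserving_prodAssoc μ (ν.prod κ) ρ).symm _).comp
    ((MeasurePreserving.id μ).prod ((measurePreserving_prodAssoc ν κ ρ).symm _)))

end Rearrange

/-! ### Joint law of bids, tables and final coins -/

namespace Scheme

variable (P : Scheme) {n : ℕ} {vmax : ℝ} (S : Setting n vmax) (A : Algorithm n)

/-- The law of the coins of a round. -/
abbrev roundLaw (A : Algorithm n) : Measure ((Fin n → unitInterval) × A.Coins) :=
  (volume : Measure (Fin n → unitInterval)).prod A.law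

/-- The law of the table of an agent. -/
abbrev tableLaw (i : Fin n) : Measure (Table P.J P.M) :=
  Measure.pi (sampleLaw A S.prior i P.val)

theorem bidsAt_zero (u : unitInterval) (b : Profile n) : bidsAt u b 0 = b := by
  funext j
  simp [bidsAt]

theorem bidsAt_succ (u : unitInterval) (b : Profile n) (i : Fin n) :
    bidsAt u b (i + 1) = Function.update b i (u * b i) := by
  funext j
  by_cases h : j = i
  · subst h
    simp [bidsAt]
  · have : (j : ℕ) ≠ i := fun h2 => h (Fin.ext h2)
    simp [bidsAt, h, this]

theorem outAlloc_eq (b : Profile n) (τ : (P.reduction n).Tape A) :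
    (P.reduction n).outAlloc S A b τ =
      P.lottery S A τ.1.1 b (P.tables S A τ.2) (τ.2 (Fin.natAdd (P.samples n) 0)) := by
  have h := P.outcome_transcript S A b τ 0
  have h2 : bidsAt τ.1.2 b ((0 : Fin (n + 1)) : ℕ) = b := bidsAt_zero _ _
  rw [h2] at h
  exact h

open Classical in
theorem outPay_eq (b : Profile n) (τ : (P.reduction n).Tape A) (i : Fin n) :
    (P.reduction n).outPay S A b τ i = b i *
      ((if i ∈ P.lottery S A τ.1.1 b (P.tables S A τ.2) (τ.2 (Fin.natAdd (P.samples n) 0))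
        then 1 else 0) -
      (if i ∈ P.lottery S A τ.1.1 (Function.update b i (τ.1.2 * b i)) (P.tables S A τ.2)
        (τ.2 (Fin.natAdd (P.samples n) i.succ)) then 1 else 0)) := by
  have h := P.outcome_transcript S A b τ i.succ
  have h2 : bidsAt τ.1.2 b (i.succ : ℕ) = Function.update b i (τ.1.2 * b i) := bidsAt_succ _ _ _
  rw [h2] at h
  rw [← h, ← P.outAlloc_eq, ← h2]
  rfl

theorem measurable_tables : Measurable (P.tables S A) :=
  measurable_pi_iff.2 fun i => measurable_pi_iff.2 fun r =>
    (measurable_sample A S.prior i r).comp (measurable_pi_apply _)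

/-- Distinct entries of the tables read distinct rounds, so all entries are independent; currying
the index groups them by agents. -/
theorem map_tables : (Measure.pi fun _ => roundLaw A).map (P.tables S A) =
    Measure.pi (P.tableLaw S A) := by
  have hinj : Function.Injective fun x => Fin.castAdd (n + 1) (P.enum n x) :=
    (Fin.castAdd_injective _ _).comp (P.enum n).injective
  have hms := fun x : Fin n × RoundIdx P.J P.M =>
    measurable_sample A S.prior x.1 (val := P.val) x.2
  have h1 := (iIndepFun_coordinates (fun _ => roundLaw A) hinj).comp
    (fun x => sample A S.prior x.1 P.val x.2) hms
  have h2 := (iIndepFun_iff_map_fun_eq_pi_map fun x => ((hms x).comp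
    (measurable_pi_apply _)).aemeasurable).1 h1
  have h3 : ∀ x : Fin n × RoundIdx P.J P.M, (Measure.pi fun _ => roundLaw A).map
      (sample A S.prior x.1 P.val x.2 ∘
        fun ω : P.RoundCoins A => ω (Fin.castAdd (n + 1) (P.enum n x))) =
      sampleLaw A S.prior x.1 P.val x.2 := fun x => by
    rw [← Measure.map_map (hms x) (measurable_pi_apply _),
      (measurePreserving_eval (fun _ => roundLaw A) _).map_eq]
    rfl
  simp only [h3] at h2
  have h4 := Measure.infinitePi_map_curry (fun (i : Fin n) (r : RoundIdx P.J P.M) =>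
    sampleLaw A S.prior i P.val r)
  simp only [Measure.infinitePi_eq_pi] at h4
  rw [← h2, Measure.map_map (MeasurableEquiv.measurable _) (measurable_pi_iff.2 fun x =>
    ((hms x).comp (measurable_pi_apply _)))] at h4
  exact h4

/-- The tables and the coins of a final round are independent. -/
theorem measurePreserving_tables (k : Fin (n + 1)) :
    MeasurePreserving (fun ω : P.RoundCoins A => (P.tables S A ω, ω (Fin.natAdd (P.samples n) k)))
      (Measure.pi fun _ => roundLaw A) ((Measure.pi (P.tableLaw S A)).prod (roundLaw A)) := by
  have hm := P.measurable_tables S A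
  refine ⟨hm.prodMk (measurable_pi_apply _), ?_⟩
  have hind : IndepFun (P.tables S A) (fun ω : P.RoundCoins A => ω (Fin.natAdd (P.samples n) k))
      (Measure.pi fun _ => roundLaw A) := by
    refine indepFun_of_dependsOn (fun _ => roundLaw A) hm (measurable_pi_apply _)
      (S := Set.range (Fin.castAdd (n + 1))) (T := {Fin.natAdd (P.samples n) k}) ?_ ?_ ?_
    · rw [Set.disjoint_singleton_right]
      rintro ⟨j, hj⟩
      have := congrArg Fin.val hj
      simp only [Fin.val_castAdd, Fin.val_natAdd] at this
      omega
    · intro ω ω' h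
      funext i r
      simp only [tables, h _ (Set.mem_range_self _)]
    · intro ω ω' h
      exact h _ rfl
  rw [(indepFun_iff_map_prod_eq_prod_map_map hm.aemeasurable
    (measurable_pi_apply _).aemeasurable).1 hind,
    (measurePreserving_eval (fun _ => roundLaw A) _).map_eq, P.map_tables S A]

end Scheme

namespace Scheme

variable (P : Scheme) {n : ℕ} {vmax : ℝ} (S : Setting n vmax) (A : Algorithm n)

/-- The law of the bids, the tables and the coins of a final round. -/
abbrev runLaw : Measure (Profile n × P.Tables n × (Fin n → unitInterval) × A.Coins) :=
  (Measure.pi S.prior).prod ((Measure.pi (P.tableLaw S A)).prod (roundLaw A))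

/-- A single final round k suffices: expected payments are differences of two probabilities, each of
which involves one final round, so the joint law of two rounds is not needed. -/
theorem measurePreserving_execution (k : Fin (n + 1)) :
    MeasurePreserving (fun q : Profile n × (P.reduction n).Tape A =>
      ((q.2.1.2, q.2.1.1, q.1, P.tables S A q.2.2, q.2.2 (Fin.natAdd (P.samples n) k)) :
        unitInterval × unitInterval × Profile n × P.Tables n × (Fin n → unitInterval) × A.Coins))
      (S.joint.prod ((P.reduction n).tapeLaw A))
      ((volume : Measure unitInterval).prod ((volume : Measure unitInterval).prod
        (P.runLaw S A))) := by
  have h1 := (MeasurePreserving.id (Measure.pi S.prior)).prod ((MeasurePreserving.id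
    (volume : Measure (unitInterval × unitInterval))).prod (P.measurePreserving_tables S A k))
  have h2 := (measurePreserving_left_comm (Measure.pi S.prior)
    (volume : Measure (unitInterval × unitInterval)) _).comp h1
  have h3 := ((Measure.measurePreserving_swap (μ := (volume : Measure unitInterval))
    (ν := (volume : Measure unitInterval))).prod (MeasurePreserving.id (P.runLaw S A))).comp h2
  exact (measurePreserving_prodAssoc (volume : Measure unitInterval)
    (volume : Measure unitInterval) (P.runLaw S A)).comp h3

theorem measurable_final_answers : Measurable fun q : unitInterval × Profile n × P.Tables n ×
    (Fin n → unitInterval) =>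
      answers S.prior P.val (P.finalWindow q.1 q.2.1 q.2.2.1) q.2.2.2 := by
  refine measurable_pi_iff.2 fun j => ?_
  refine measurable_uncurry_draw (S.prior j) (gridWindow P.val) ?_ (by fun_prop)
  exact (P.measurable_finalWindow j).comp (f := fun q : unitInterval × Profile n × P.Tables n ×
    (Fin n → unitInterval) => (q.1, q.2.1, q.2.2.1)) (by fun_prop)

theorem measurable_lottery : Measurable fun q : unitInterval × Profile n × P.Tables n ×
    (Fin n → unitInterval) × A.Coins => P.lottery S A q.1 q.2.1 q.2.2.1 q.2.2.2 := by
  unfold lottery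
  refine Measurable.ite (P.measurableSet_keep.preimage (f := fun q : unitInterval × Profile n ×
    P.Tables n × (Fin n → unitInterval) × A.Coins => (q.1, q.2.1)) (by fun_prop)) ?_
    measurable_const
  refine (measurable_roundAlloc A).comp (f := fun q : unitInterval × Profile n ×
    P.Tables n × (Fin n → unitInterval) × A.Coins =>
    (answers S.prior P.val (P.finalWindow q.1 q.2.1 q.2.2.1) q.2.2.2.1, q.2.2.2.2))
    (Measurable.prodMk ?_ (by fun_prop))
  exact (P.measurable_final_answers S).comp (f := fun q : unitInterval × Profile n ×
    P.Tables n × (Fin n → unitInterval) × A.Coins => (q.1, q.2.1, q.2.2.1, q.2.2.2.1))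
    (by fun_prop)

open Classical in
/-- The final answer for agent `j`, as a function of its bid, its table and a coin. -/
def finalAnswer (F : Measure ℝ) (s : unitInterval) (j : Fin n)
    (x : ℝ × Table P.J P.M × unitInterval) : Unit ⊕ ℝ :=
  draw F (gridWindow P.val (if s ∈ P.regular ∪ P.block n j then
    Table.pool P.δ (fun c => P.val c) x.2.1 x.1 else (⊥, ⊤))) x.2.2

theorem measurable_finalAnswer (F : Measure ℝ) [IsFiniteMeasure F] (s : unitInterval) (j : Fin n) :
    Measurable (P.finalAnswer F s j) := by
  refine measurable_uncurry_draw F (gridWindow P.val) ?_ (by fun_prop)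
  split_ifs
  · exact (measurable_pool (val := P.val) P.δ).comp
      (f := fun x : ℝ × Table P.J P.M × unitInterval => (x.2.1, x.1)) (by fun_prop)
  · exact measurable_const

/-- The law of the final answer for agent `j` if its bid is obtained from its value by `β`. -/
def answerLawOf (s : unitInterval) (j : Fin n) (β : ℝ → ℝ) : Measure (Unit ⊕ ℝ) :=
  ((S.prior j).prod ((P.tableLaw S A j).prod volume)).map
    fun x => P.finalAnswer (S.prior j) s j (β x.1, x.2)

/-- The law of the answers in a final round, when the bid of agent `j` is `β j` of its value. -/
theorem measurePreserving_final (s : unitInterval) {β : Fin n → ℝ → ℝ}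
    (hβ : ∀ j, Measurable (β j)) :
    MeasurePreserving (fun q : Profile n × P.Tables n × (Fin n → unitInterval) × A.Coins =>
      ((answers S.prior P.val (P.finalWindow s (fun j => β j (q.1 j)) q.2.1) q.2.2.1, q.2.2.2) :
        Draws n × A.Coins)) (P.runLaw S A)
      ((Measure.pi fun j => P.answerLawOf S A s j (β j)).prod A.law) := by
  have hmeas (j : Fin n) : Measurable fun x : ℝ × Table P.J P.M × unitInterval =>
      P.finalAnswer (S.prior j) s j (β j x.1, x.2) :=
    (P.measurable_finalAnswer (S.prior j) s j).comp
      (((hβ j).comp measurable_fst).prodMk measurable_snd)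
  have h1 := map_arrow_prod S.prior (P.tableLaw S A)
    (fun _ : Fin n => (volume : Measure unitInterval)) hmeas
  rw [← volume_pi] at h1
  have h2 : MeasurePreserving (fun (q : Profile n × P.Tables n × (Fin n → unitInterval)) j =>
      P.finalAnswer (S.prior j) s j (β j (q.1 j), q.2.1 j, q.2.2 j))
      ((Measure.pi S.prior).prod ((Measure.pi (P.tableLaw S A)).prod volume))
      (Measure.pi fun j => P.answerLawOf S A s j (β j)) :=
    ⟨measurable_pi_iff.2 fun j => (hmeas j).comp
      (f := fun q : Profile n × P.Tables n × (Fin n → unitInterval) => (q.1 j, q.2.1 j, q.2.2 j))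
      (by fun_prop), h1⟩
  have h3 : MeasurePreserving
      (fun q : Profile n × P.Tables n × (Fin n → unitInterval) × A.Coins =>
        ((q.1, q.2.1, q.2.2.1), q.2.2.2)) (P.runLaw S A)
      (((Measure.pi S.prior).prod ((Measure.pi (P.tableLaw S A)).prod
        (volume : Measure (Fin n → unitInterval)))).prod A.law) :=
    measurePreserving_prodAssoc₄ _ _ _ _
  have h4 := (h2.prod (MeasurePreserving.id A.law)).comp h3
  have h5 : (Prod.map (fun (q : Profile n × P.Tables n × (Fin n → unitInterval)) j =>
      P.finalAnswer (S.prior j) s j (β j (q.1 j), q.2.1 j, q.2.2 j)) id ∘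
      fun q : Profile n × P.Tables n × (Fin n → unitInterval) × A.Coins =>
        ((q.1, q.2.1, q.2.2.1), q.2.2.2)) = fun q =>
      ((answers S.prior P.val (P.finalWindow s (fun j => β j (q.1 j)) q.2.1) q.2.2.1, q.2.2.2) :
        Draws n × A.Coins) := by
    funext q
    refine Prod.ext (funext fun j => ?_) rfl
    rfl
  rwa [h5] at h4

end Scheme

/-! ### Tests and interim allocations -/

namespace Scheme

/-- The conditions on the parameters. -/
structure Valid (P : Scheme) : Prop where
  J_pos : 0 < P.J
  M_pos : 0 < P.M
  mono : StrictMono P.val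
  val_zero : P.val 0 = 0
  ρ_pos : 0 < P.ρ
  ρ_le_one : P.ρ ≤ 1

variable {P : Scheme} (hP : P.Valid) {n : ℕ} {vmax : ℝ} (S : Setting n vmax) (A : Algorithm n)

section Height

theorem height_nonneg (z : ℝ) : 0 ≤ P.height z :=
  div_nonneg (Finset.sum_nonneg fun _ _ => by split_ifs <;> norm_num) (Nat.cast_nonneg _)

theorem height_mono : Monotone P.height := by
  intro z z' h
  refine div_le_div_of_nonneg_right (Finset.sum_le_sum fun j _ => ?_) (Nat.cast_nonneg _)
  by_cases h1 : P.val (j + 1) ≤ z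
  · rw [if_pos h1, if_pos (h1.trans h)]
  · rw [if_neg h1]
    split_ifs <;> norm_num

theorem height_le_one (z : ℝ) : P.height z ≤ 1 := by
  refine div_le_one_of_le₀ ?_ (Nat.cast_nonneg _)
  calc (∑ j ∈ Finset.range P.J, if P.val (j + 1) ≤ z then (1 : ℝ) else 0)
      ≤ ∑ j ∈ Finset.range P.J, 1 := Finset.sum_le_sum fun j _ => by split_ifs <;> norm_num
    _ = P.J := by simp

/-- The term of index c - 1 switches from 0 to 1. This jump at each possible cut provides the growth
that compensates for false cuts. -/
theorem height_add_le {c : ℕ} (hc : 0 < c) (hcJ : c ≤ P.J) {z z' : ℝ} (h1 : z < P.val c)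
    (h2 : P.val c ≤ z') : P.height z + 1 / P.J ≤ P.height z' := by
  obtain ⟨j, rfl⟩ : ∃ j, c = j + 1 := ⟨c - 1, by omega⟩
  have hj : j ∈ Finset.range P.J := Finset.mem_range.2 (by omega)
  rw [height, height, ← add_div]
  refine div_le_div_of_nonneg_right ?_ (Nat.cast_nonneg _)
  rw [← Finset.add_sum_erase _ _ hj, ← Finset.add_sum_erase _ _ hj, if_neg (not_le.2 h1),
    if_pos h2, zero_add, add_comm]
  refine add_le_add le_rfl (Finset.sum_le_sum fun k _ => ?_)
  by_cases h3 : P.val (k + 1) ≤ z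
  · rw [if_pos h3, if_pos (h3.trans (h1.le.trans h2))]
  · rw [if_neg h3]
    split_ifs <;> norm_num

end Height

section Events

include hP

theorem passes_subset (i : Fin n) (z : ℝ) : P.passes n i z ⊆ P.block n i := by
  rintro s ⟨h1, h2⟩
  refine ⟨h1, h2.trans_le ?_⟩
  have := height_le_one (P := P) z
  have := hP.ρ_pos
  gcongr

theorem block_disjoint {i j : Fin n} {s : unitInterval} (hi : s ∈ P.block n i)
    (hj : s ∈ P.block n j) : i = j := by
  have key : ∀ {i j : Fin n}, s ∈ P.block n i → s ∈ P.block n j → (i : ℕ) < j + 1 := by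
    intro i j hi hj
    have h1 := hi.1.trans_lt hj.2
    have hn : (0 : ℝ) < n := Nat.cast_pos.2 i.pos
    rw [div_lt_div_iff_of_pos_right hn, mul_lt_mul_iff_right₀ hP.ρ_pos] at h1
    exact_mod_cast h1
  have h1 := key hi hj
  have h2 := key hj hi
  exact Fin.ext (by omega)

theorem keep_update_of_mem {i : Fin n} {s : unitInterval} (hs : s ∈ P.regular ∪ P.block n i)
    (b : Profile n) (z : ℝ) :
    P.Keep s (Function.update b i z) ↔ s ∈ P.regular ∪ P.passes n i z := by
  constructor
  · rintro (h | ⟨j, hj⟩)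
    · exact Or.inl h
    · rcases hs with hs | hs
      · exact Or.inl hs
      · obtain rfl := block_disjoint hP (passes_subset hP j _ hj) hs
        rw [Function.update_self] at hj
        exact Or.inr hj
  · rintro (h | h)
    · exact Or.inl h
    · exact Or.inr ⟨i, by rwa [Function.update_self]⟩

/-- For such coins the window of i is the full range and i is not the tested agent, so its bid is
never used. -/
theorem lottery_update_of_notMem {i : Fin n} {s : unitInterval}
    (hs : s ∉ P.regular ∪ P.block n i) (b : Profile n) (z z' : ℝ) (tb : P.Tables n)
    (c : (Fin n → unitInterval) × A.Coins) :
    P.lottery S A s (Function.update b i z) tb c =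
      P.lottery S A s (Function.update b i z') tb c := by
  have h1 : P.finalWindow s (Function.update b i z) tb =
      P.finalWindow s (Function.update b i z') tb := by
    funext j
    by_cases hj : j = i
    · subst hj
      rw [finalWindow, finalWindow, if_neg hs, if_neg hs]
    · simp only [finalWindow, Function.update_of_ne hj]
  have h2 : ∀ z z' : ℝ, P.Keep s (Function.update b i z) → P.Keep s (Function.update b i z') := by
    rintro z z' (h | ⟨j, hj⟩)
    · exact Or.inl h
    · refine Or.inr ⟨j, ?_⟩
      have hji : j ≠ i := by
        rintro rfl
        exact hs (Or.inr (passes_subset hP j _ hj))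
      rwa [Function.update_of_ne hji] at hj ⊢
  rw [lottery, lottery, h1]
  by_cases h3 : P.Keep s (Function.update b i z)
  · rw [if_pos h3, if_pos (h2 _ _ h3)]
  · rw [if_neg h3, if_neg fun h => h3 (h2 _ _ h)]

/-- The probability that nobody is tested or that agent `i` passes its test with the bid `z`. -/
theorem volume_keep (i : Fin n) (z : ℝ) :
    (volume : Measure unitInterval).real (P.regular ∪ P.passes n i z) =
      1 - P.ρ + P.ρ * P.height z / n := by
  have h0 := hP.ρ_pos
  have h1 := hP.ρ_le_one
  have hn : (0 : ℝ) < n := Nat.cast_pos.2 i.pos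
  have hz0 := height_nonneg (P := P) z
  have hz1 := height_le_one (P := P) z
  have hin : (i : ℝ) + 1 ≤ n := by exact_mod_cast i.2
  have hi0 : (0 : ℝ) ≤ i := Nat.cast_nonneg _
  have e2 : P.ρ * (i + P.height z) / n ≤ P.ρ := by
    rw [div_le_iff₀ hn]
    gcongr
    linarith
  have e1 : P.ρ * i / n ≤ P.ρ * (i + P.height z) / n := by
    gcongr
    linarith
  have e0 : 0 ≤ P.ρ * i / n := by positivity
  set x : unitInterval := ⟨P.ρ, h0.le, h1⟩
  set y : unitInterval := ⟨P.ρ * i / n, e0, (e1.trans e2).trans h1⟩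
  set w : unitInterval := ⟨P.ρ * (i + P.height z) / n, e0.trans e1, e2.trans h1⟩
  have hr : P.regular = Set.Ici x := by
    ext s
    exact Iff.rfl
  have hp : P.passes n i z = Set.Ico y w := by
    ext s
    exact Iff.rfl
  rw [hr, hp, measureReal_union _ measurableSet_Ico, measureReal_def, measureReal_def,
    unitInterval.volume_Ici, unitInterval.volume_Ico, ENNReal.toReal_ofReal, ENNReal.toReal_ofReal]
  · simp only [x, y, w]
    ring
  · exact sub_nonneg.2 e1
  · exact sub_nonneg.2 h1
  · rw [Set.disjoint_left]
    intro s hs1 hs2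
    exact absurd (lt_of_le_of_lt (hs1 : x ≤ s) hs2.2) (not_lt.2 e2)

end Events

section Interim

/-- The probability that agent `i` is served at the bid `z`, for a given coin of the reduction. -/
def serveMass (P : Scheme) (S : Setting n vmax) (A : Algorithm n) (i : Fin n) (z : ℝ)
    (s : unitInterval) : ℝ≥0∞ :=
  P.runLaw S A {q | i ∈ P.lottery S A s (Function.update q.1 i z) q.2.1 q.2.2}

/-- The expected average of the pool of the bid `z`. -/
def poolMean (P : Scheme) (S : Setting n vmax) (A : Algorithm n) (i : Fin n) (z : ℝ) : ℝ :=
  ∫ ω : Table P.J P.M, (fun w : Fin (P.J + 1) × Fin (P.J + 1) =>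
    avgAlloc (S.prior i) (served A S.prior i) P.val w.1 w.2)
      (Table.pool P.δ (fun c => P.val c) ω z) ∂(P.tableLaw S A i)

theorem measurable_serveMass (i : Fin n) {Ω : Type*} [MeasurableSpace Ω] {f : Ω → ℝ}
    (hf : Measurable f) {g : Ω → unitInterval} (hg : Measurable g) :
    Measurable fun x => serveMass P S A i (f x) (g x) := by
  have h := (P.measurable_lottery S A).comp (f := fun q : (ℝ × unitInterval) × Profile n ×
    P.Tables n × (Fin n → unitInterval) × A.Coins =>
      (q.1.2, Function.update q.2.1 i q.1.1, q.2.2.1, q.2.2.2))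
    (Measurable.prodMk (by fun_prop) (Measurable.prodMk ((measurable_update_prod i).comp
      (f := fun q : (ℝ × unitInterval) × Profile n × P.Tables n × (Fin n → unitInterval) ×
        A.Coins => (q.2.1, q.1.1)) (by fun_prop)) (by fun_prop)))
  exact (measurable_measure_prodMk_left (ν := P.runLaw S A) (measurableSet_mem h i)).comp
    (hf.prodMk hg)

include hP in
theorem serveMass_of_notMem (i : Fin n) (z : ℝ) {s : unitInterval}
    (hs : s ∉ P.regular ∪ P.block n i) : serveMass P S A i z s = serveMass P S A i 0 s := by
  simp only [serveMass, lottery_update_of_notMem hP S A hs _ z 0]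

variable (hS : ∀ j, ∀ᵐ v ∂S.prior j, v ∈ Set.Ico (P.val 0) (P.val P.J))
include hP hS

/-- A truthful bid is resampled either from its pool or from the full range, and both preserve the
prior. Thus the algorithm faces the product prior whatever the coin is. -/
theorem answerLawOf_id (s : unitInterval) (j : Fin n) :
    P.answerLawOf S A s j id = answerLaw S.prior j := by
  rw [answerLawOf]
  by_cases hs : s ∈ P.regular ∪ P.block n j
  · simp only [finalAnswer, if_pos hs]
    exact map_draw_pool (S.prior j) (hS j) hP.mono.monotone _ _
  · simp only [finalAnswer, if_neg hs]
    have h := map_draw_full (S.prior j) (hS j)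
    have h2 : MeasurePreserving (fun x : ℝ × Table P.J P.M × unitInterval => x.2.2)
        ((S.prior j).prod ((P.tableLaw S A j).prod volume)) volume :=
      (measurePreserving_snd (μ := P.tableLaw S A j)).comp measurePreserving_snd
    refine Eq.trans ?_ h
    conv_rhs => rw [← h2.map_eq, Measure.map_map (measurable_draw _ _) h2.measurable]
    rfl

/-- The answers of the other agents follow their priors, whatever their pools are, and that of i is
a draw from the pool of z. If the test fails, nobody is served. -/
theorem toReal_serveMass_of_mem (i : Fin n) (z : ℝ) {s : unitInterval}
    (hs : s ∈ P.regular ∪ P.block n i) :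
    (serveMass P S A i z s).toReal =
      (P.regular ∪ P.passes n i z).indicator (fun _ => poolMean P S A i z) s := by
  by_cases hk : s ∈ P.regular ∪ P.passes n i z
  · rw [Set.indicator_of_mem hk]
    set β : Fin n → ℝ → ℝ := Function.update (fun _ => id) i (fun _ => z) with hβ
    have hβm : ∀ j, Measurable (β j) := by
      intro j
      by_cases hj : j = i
      · subst hj
        simp [hβ]
      · simp only [hβ, Function.update_of_ne hj]
        exact measurable_id
    have hup : ∀ b : Profile n, (fun j => β j (b j)) = Function.update b i z := by
      intro b
      funext j
      by_cases hj : j = i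
      · subst hj
        simp [hβ]
      · simp [hβ, hj]
    have hmp := P.measurePreserving_final S A s hβm
    have h1 : {q : Profile n × P.Tables n × (Fin n → unitInterval) × A.Coins |
        i ∈ P.lottery S A s (Function.update q.1 i z) q.2.1 q.2.2} =
        (fun q : Profile n × P.Tables n × (Fin n → unitInterval) × A.Coins =>
      ((answers S.prior P.val (P.finalWindow s (fun j => β j (q.1 j)) q.2.1) q.2.2.1, q.2.2.2) :
        Draws n × A.Coins)) ⁻¹' {q | i ∈ roundAlloc A q.1 q.2} := by
      ext q
      simp only [Set.mem_ofPred_eq, Set.mem_preimage, lottery, hup,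
        if_pos ((keep_update_of_mem hP hs q.1 z).2 hk)]
    have h2 : (fun j => P.answerLawOf S A s j (β j)) = Function.update (answerLaw S.prior) i
        (((P.tableLaw S A i).prod (volume : Measure unitInterval)).map fun q =>
          draw (S.prior i) (gridWindow P.val (Table.pool P.δ (fun c => P.val c) q.1 z)) q.2) := by
      funext j
      by_cases hj : j = i
      · subst hj
        have hm : Measurable fun q : Table P.J P.M × unitInterval => draw (S.prior j)
            (gridWindow P.val (Table.pool P.δ (fun c => P.val c) q.1 z)) q.2 :=
          (measurable_draw_pool (S.prior j) P.δ).comp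
            (f := fun q : Table P.J P.M × unitInterval => (z, q)) (by fun_prop)
        simp only [Function.update_self, answerLawOf, finalAnswer, if_pos hs, hβ]
        have h3 := (measurePreserving_snd (μ := S.prior j)
          (ν := (P.tableLaw S A j).prod (volume : Measure unitInterval))).map_eq
        conv_rhs => rw [← h3, Measure.map_map hm measurable_snd]
        rfl
      · simp only [Function.update_of_ne hj, hβ]
        exact answerLawOf_id hP S A hS s j
    have hm : Measurable fun q : Table P.J P.M × unitInterval => draw (S.prior i)
            (gridWindow P.val (Table.pool P.δ (fun c => P.val c) q.1 z)) q.2 :=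
          (measurable_draw_pool (S.prior i) P.δ).comp
            (f := fun q : Table P.J P.M × unitInterval => (z, q)) (by fun_prop)
    have := Measure.isProbabilityMeasure_map (μ := (P.tableLaw S A i).prod
      (volume : Measure unitInterval)) hm.aemeasurable
    rw [serveMass, h1, hmp.measure_preimage
      (measurableSet_mem (measurable_roundAlloc A) i).nullMeasurableSet, h2, measure_served,
      toReal_lintegral_draw_pool]
    rfl
  · rw [Set.indicator_of_notMem hk]
    have : ∀ b : Profile n, ¬ P.Keep s (Function.update b i z) := fun b h =>
      hk ((keep_update_of_mem hP hs b z).1 h)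
    simp [serveMass, lottery, this]

end Interim

end Scheme

/-! ### Payments and incentive compatibility -/

theorem integral_unitInterval_comp_mul (f : ℝ → ℝ) (z : ℝ) :
    z * ∫ u : unitInterval, f (u * z) = ∫ x in (0 : ℝ)..z, f x := by
  have h1 : ∫ u : unitInterval, f (u * z) = ∫ x in (0 : ℝ)..1, f (x * z) := by
    rw [intervalIntegral.integral_of_le zero_le_one, ← integral_Icc_eq_integral_Ioc]
    exact integral_subtype measurableSet_Icc (fun x : ℝ => f (x * z))
  rw [h1]
  simp

/-- Convexity of the integral of a monotone function. -/
theorem MonotoneOn.mul_le_integral_sub {f : ℝ → ℝ} (hf : MonotoneOn f (Set.Ici 0)) {v z : ℝ}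
    (hv : 0 ≤ v) (hz : 0 ≤ z) :
    (v - z) * f z ≤ (∫ x in (0 : ℝ)..v, f x) - ∫ x in (0 : ℝ)..z, f x := by
  have hint : ∀ {a b : ℝ}, 0 ≤ a → 0 ≤ b → IntervalIntegrable f volume a b := fun ha hb =>
    (hf.mono fun x hx => (le_min ha hb).trans hx.1).intervalIntegrable
  rw [intervalIntegral.integral_interval_sub_left (hint le_rfl hv) (hint le_rfl hz)]
  have hc : ∫ _ in z..v, f z = (v - z) * f z := by simp
  rcases le_total z v with h | h
  · rw [← hc]
    refine intervalIntegral.integral_mono_on h intervalIntegrable_const (hint hz hv) fun x hx => ?_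
    exact hf hz (hz.trans hx.1) hx.1
  · rw [intervalIntegral.integral_symm, ← neg_le_neg_iff, neg_neg]
    have hc2 : ∫ _ in v..z, f z = -((v - z) * f z) := by simp; ring
    rw [← hc2]
    refine intervalIntegral.integral_mono_on h (hint hv hz) intervalIntegrable_const fun x hx => ?_
    exact hf (hv.trans hx.1) hz hx.2

instance {n : ℕ} {vmax : ℝ} (R : Reduction n) (S : Setting n vmax) (A : Algorithm n) :
    IsProbabilityMeasure (S.joint.prod (R.tapeLaw A)) := by
  unfold Setting.joint Reduction.tapeLaw
  infer_instance

namespace Scheme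

variable {P : Scheme} (hP : P.Valid) {n : ℕ} {vmax : ℝ} (S : Setting n vmax) (A : Algorithm n)

/-- The probability that agent `i` is served at the bid `z`. -/
def interim (P : Scheme) (S : Setting n vmax) (A : Algorithm n) (i : Fin n) (z : ℝ) : ℝ :=
  ∫ s, (serveMass P S A i z s).toReal

theorem serveMass_le_one (i : Fin n) (z : ℝ) (s : unitInterval) : serveMass P S A i z s ≤ 1 :=
  prob_le_one

theorem integrable_serveMass (i : Fin n) (z : ℝ) :
    Integrable fun s => (serveMass P S A i z s).toReal := by
  have h := (measurable_serveMass (P := P) S A i (f := fun _ : unitInterval => z)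
    measurable_const measurable_id).ennreal_toReal
  refine Integrable.of_bound h.aestronglyMeasurable 1 (Filter.Eventually.of_forall fun s => ?_)
  rw [Real.norm_of_nonneg ENNReal.toReal_nonneg]
  exact ENNReal.toReal_mono ENNReal.one_ne_top (serveMass_le_one S A i z s)

variable (hS : ∀ j, ∀ᵐ v ∂S.prior j, v ∈ Set.Ico (P.val 0) (P.val P.J))

-- The coins split into those that keep the lottery for the bid of i, of measure 1 - ρ + ρ height /
-- n, those where i fails its test and gets nothing, and those where its bid plays no role.
include hP hS in
theorem interim_eq (i : Fin n) (z : ℝ) : interim P S A i z =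
    (1 - P.ρ + P.ρ * P.height z / n) * poolMean P S A i z +
      ∫ s in (P.regular ∪ P.block n i)ᶜ, (serveMass P S A i 0 s).toReal := by
  have hm1 : MeasurableSet (P.regular ∪ P.block n i) :=
    P.measurableSet_regular.union (P.measurableSet_block i)
  have hm2 : MeasurableSet (P.regular ∪ P.passes n i z) := P.measurableSet_regular.union
    ((measurableSet_le measurable_const measurable_subtype_coe).inter
      (measurableSet_lt measurable_subtype_coe measurable_const))
  have h1 : ∀ s, (serveMass P S A i z s).toReal =
      (P.regular ∪ P.passes n i z).indicator (fun _ => poolMean P S A i z) s +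
        (P.regular ∪ P.block n i)ᶜ.indicator (fun s => (serveMass P S A i 0 s).toReal) s := by
    intro s
    by_cases hs : s ∈ P.regular ∪ P.block n i
    · rw [toReal_serveMass_of_mem hP S A hS i z hs, Set.indicator_of_notMem (Set.notMem_compl_iff.2 hs),
        add_zero]
    · have hs2 : s ∉ P.regular ∪ P.passes n i z := fun h =>
        hs (h.imp id fun h => passes_subset hP i z h)
      rw [Set.indicator_of_notMem hs2, Set.indicator_of_mem hs, zero_add,
        serveMass_of_notMem hP S A i z hs]
  rw [interim]
  simp only [h1]
  rw [integral_add ((integrable_const _).indicator hm2)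
    ((integrable_serveMass S A i 0).indicator hm1.compl), integral_indicator_const _ hm2,
    volume_keep hP, integral_indicator hm1.compl, smul_eq_mul]

/-- Agent `i` is served in a final round, if its bid is given by `f`. -/
def servedEvent (P : Scheme) (S : Setting n vmax) (A : Algorithm n) (i : Fin n) (k : Fin (n + 1))
    (f : unitInterval → ℝ) : Set (Profile n × (P.reduction n).Tape A) :=
  {q | i ∈ P.lottery S A q.2.1.1 (Function.update q.1 i (f q.2.1.2)) (P.tables S A q.2.2)
    (q.2.2 (Fin.natAdd (P.samples n) k))}

theorem real_lottery (i : Fin n) (k : Fin (n + 1)) {f : unitInterval → ℝ} (hf : Measurable f) :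
    MeasurableSet (servedEvent P S A i k f) ∧
    (S.joint.prod ((P.reduction n).tapeLaw A)).real (servedEvent P S A i k f) = ∫ u, interim P S A i (f u) := by
  have hmp := P.measurePreserving_execution S A k
  have hE : MeasurableSet {q : unitInterval × unitInterval × Profile n × P.Tables n ×
      (Fin n → unitInterval) × A.Coins |
      i ∈ P.lottery S A q.2.1 (Function.update q.2.2.1 i (f q.1)) q.2.2.2.1 q.2.2.2.2} := by
    refine measurableSet_mem ((P.measurable_lottery S A).comp (f := fun q : unitInterval ×
      unitInterval × Profile n × P.Tables n × (Fin n → unitInterval) × A.Coins =>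
        (q.2.1, Function.update q.2.2.1 i (f q.1), q.2.2.2.1, q.2.2.2.2)) ?_) i
    refine Measurable.prodMk (by fun_prop) (Measurable.prodMk ?_ (by fun_prop))
    exact (measurable_update_prod i).comp (f := fun q : unitInterval × unitInterval × Profile n ×
      P.Tables n × (Fin n → unitInterval) × A.Coins => (q.2.2.1, f q.1)) (by fun_prop)
  refine ⟨hE.preimage hmp.measurable, ?_⟩
  have h1 := hmp.measure_preimage hE.nullMeasurableSet
  have h2 : (S.joint.prod ((P.reduction n).tapeLaw A)) (servedEvent P S A i k f) = ∫⁻ u, ∫⁻ s, serveMass P S A i (f u) s := by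
    refine h1.trans ?_
    rw [Measure.prod_apply hE]
    refine lintegral_congr fun u => ?_
    rw [Measure.prod_apply (hE.preimage measurable_prodMk_left)]
    rfl
  rw [measureReal_def, h2]
  have h3 : ∀ u, interim P S A i (f u) = (∫⁻ s, serveMass P S A i (f u) s).toReal := fun u => by
    rw [interim, integral_toReal]
    · exact (measurable_serveMass S A i measurable_const measurable_id).aemeasurable
    · exact Filter.Eventually.of_forall fun s =>
        (serveMass_le_one S A i _ s).trans_lt ENNReal.one_lt_top
  simp only [h3]
  rw [integral_toReal]
  · exact (measurable_serveMass S A i (f := fun q : unitInterval × unitInterval => f q.1)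
      (hf.comp measurable_fst) measurable_snd).lintegral_prod_right'.aemeasurable
  · refine Filter.Eventually.of_forall fun u => lt_of_le_of_lt ?_ ENNReal.one_lt_top
    calc ∫⁻ s, serveMass P S A i (f u) s ≤ ∫⁻ _ : unitInterval, 1 :=
          lintegral_mono fun s => serveMass_le_one S A i _ s
      _ = 1 := by simp

theorem interimAlloc_eq (i : Fin n) (z : ℝ) :
    (P.reduction n).interimAlloc S A i z = interim P S A i z := by
  have h := (real_lottery (P := P) S A i 0 (f := fun _ => z) measurable_const).2
  rw [integral_const, probReal_univ, one_smul] at h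
  rw [← h, Reduction.interimAlloc]
  simp only [outAlloc_eq]
  rfl

theorem outPay_update (i : Fin n) (z : ℝ) :
    (fun q : Profile n × (P.reduction n).Tape A =>
      (P.reduction n).outPay S A (Function.update q.1 i z) q.2 i) = fun q =>
      z * ((servedEvent P S A i 0 fun _ => z).indicator (fun _ => 1) q -
        (servedEvent P S A i i.succ fun u => u * z).indicator (fun _ => 1) q) := by
  funext q
  rw [outPay_eq, Function.update_self, Function.update_idem]
  simp only [Set.indicator, servedEvent, Set.mem_ofPred_eq]
  congr

theorem measurable_mul_coe (z : ℝ) : Measurable fun u : unitInterval => (u : ℝ) * z := by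
  fun_prop

theorem integrable_pay (i : Fin n) (z : ℝ) :
    Integrable (fun q : Profile n × (P.reduction n).Tape A =>
      (P.reduction n).outPay S A (Function.update q.1 i z) q.2 i)
      (S.joint.prod ((P.reduction n).tapeLaw A)) := by
  have h0 := (real_lottery (P := P) S A i 0 (f := fun _ => z) measurable_const).1
  have h1 := (real_lottery (P := P) S A i i.succ (measurable_mul_coe z)).1
  rw [outPay_update]
  exact (((integrable_const _).indicator h0).sub ((integrable_const _).indicator h1)).const_mul z

theorem interimPay_eq (i : Fin n) (z : ℝ) :
    (P.reduction n).interimPay S A i z =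
      z * (interim P S A i z) - ∫ x in (0 : ℝ)..z, interim P S A i x := by
  have h0 := real_lottery (P := P) S A i 0 (f := fun _ => z) measurable_const
  have h1 := real_lottery (P := P) S A i i.succ (measurable_mul_coe z)
  rw [Reduction.interimPay, outPay_update, integral_const_mul,
    integral_sub ((integrable_const _).indicator h0.1) ((integrable_const _).indicator h1.1),
    integral_indicator_const _ h0.1, integral_indicator_const _ h1.1, h0.2, h1.2,
    ← integral_unitInterval_comp_mul (interim P S A i), integral_const, probReal_univ]
  simp only [smul_eq_mul, mul_one, one_mul]
  ring

-- Up to a constant the interim allocation is the mean average of the pool times φ = 1 - ρ + ρ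
-- height / n. As φ ≤ 1 and every grid point adds σ = ρ / (n J) to it, φ grows there by a factor of
-- at least 1 + σ.
include hP in
theorem monotone_interim {μ : ℝ} (i : Fin n) (hG : ∀ i, GridPrior (S.prior i) (served A S.prior i)
    P.val P.J (16 * P.δ) μ) (hδ : 0 ≤ P.δ) (hexp : Real.exp (-2 * P.M * P.δ ^ 2) *
    ((P.J + 1) * P.M) ≤ P.ρ / (n * P.J) / 4) : Monotone (interim P S A i) := by
  intro z z' hz
  have h0 := hP.ρ_pos
  have h1 := hP.ρ_le_one
  have hn : (1 : ℝ) ≤ n := by exact_mod_cast i.pos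
  have hJ : (1 : ℝ) ≤ P.J := by exact_mod_cast hP.J_pos
  have hS : ∀ j, ∀ᵐ v ∂S.prior j, v ∈ Set.Ico (P.val 0) (P.val P.J) := fun j => by
    rw [hP.val_zero]
    exact (hG j).supp
  have hlaw := isLaw_sampleLaw (M := P.M) A S.prior i hS hP.mono.monotone
  have hσ1 : P.ρ / (n * P.J) ≤ 1 := (div_le_one (by positivity)).2 (by nlinarith)
  rw [interim_eq hP S A hS, interim_eq hP S A hS, mul_comm, mul_comm _ (poolMean P S A i z')]
  refine add_le_add ?_ le_rfl
  have hφ0 : ∀ z, 0 ≤ 1 - P.ρ + P.ρ * P.height z / n := fun z => by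
    have := height_nonneg (P := P) z
    have : 0 ≤ P.ρ * P.height z / n := by positivity
    linarith
  have hφ1 : ∀ z, 1 - P.ρ + P.ρ * P.height z / n ≤ 1 := fun z => by
    have h2 := height_le_one (P := P) z
    have : P.ρ * P.height z / n ≤ P.ρ := by
      rw [div_le_iff₀ (by positivity)]
      gcongr
      linarith
    linarith
  refine Table.integral_pool_mul_mono (val := fun c : Fin (P.J + 1) => P.val c) hlaw hP.M_pos hδ
    (fun a b hab => hP.mono hab) (σ := P.ρ / (n * P.J)) (by positivity) hσ1 hexp
    (fun a b => GridPrior.avgAlloc_nonneg _ _) (fun a b => GridPrior.relMass_nonneg _ _)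
    (fun a b => ?_) (fun a c hac => ?_) (φ := fun z => 1 - P.ρ + P.ρ * P.height z / n)
    hφ0 (fun x y hxy => ?_) (fun a c x y hac hx hy => ?_) hz
  · exact (hG i).relMass_le_one (Nat.lt_succ_iff.1 b.2)
  · exact (hG i).relMass_mul_avgAlloc_le (Nat.lt_succ_iff.1 c.2)
  · have := height_mono (P := P) hxy
    simp only
    gcongr
  · have h2 := height_add_le (P := P) (c := c) (lt_of_le_of_lt (Nat.zero_le _) hac)
      (Nat.lt_succ_iff.1 c.2) hx hy
    have h3 := mul_le_mul_of_nonneg_left (hφ1 x) (show 0 ≤ P.ρ / (n * P.J) by positivity)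
    have h4 : P.ρ * (P.height x + 1 / P.J) / n ≤ P.ρ * P.height y / n := by gcongr
    have h5 : P.ρ * (P.height x + 1 / P.J) / n =
      P.ρ * P.height x / n + P.ρ / (n * P.J) := by field_simp
    linarith

/-- Truthful bidding yields utility ∫_0^v x, and a bid z yields (v - z) x(z) + ∫_0^z x. For monotone
x the latter is a tangent bound of a convex function. -/
theorem isBIC_of_monotone (h : ∀ i, MonotoneOn (interim P S A i) (Set.Ici 0)) :
    (P.reduction n).IsBIC S A := by
  refine fun i => ⟨fun z _ => integrable_pay S A i z, fun v z hv hz => ?_⟩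
  rw [interimAlloc_eq, interimAlloc_eq, interimPay_eq, interimPay_eq]
  have := MonotoneOn.mul_le_integral_sub (h i) hv hz
  linarith

theorem isNormalized : (P.reduction n).IsNormalized S A := by
  intro i
  rw [interimPay_eq]
  simp

end Scheme

/-! ### Welfare of the reduction -/

theorem integral_sum_served {n : ℕ} {Ω : Type*} [MeasurableSpace Ω] (F : Fin n → Measure ℝ)
    [∀ i, IsProbabilityMeasure (F i)] (hF : ∀ i, Integrable (fun z => z) (F i)) (κ : Measure Ω)
    [IsProbabilityMeasure κ] {x : Profile n × Ω → Alloc n} (hx : Measurable x) :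
    ∫ q, ∑ i ∈ x q, q.1 i ∂((Measure.pi F).prod κ) =
      ∑ i, ∫ z, z * ((Measure.pi F).prod κ).real {q | i ∈ x (Function.update q.1 i z, q.2)}
        ∂(F i) := by
  have hint : ∀ i, Integrable (fun q : Profile n × Ω => q.1 i) ((Measure.pi F).prod κ) := fun i =>
    ((measurePreserving_eval F i).integrable_comp_of_integrable (hF i)).comp_fst _
  have h1 : ∀ q, ∑ i ∈ x q, q.1 i = ∑ i, {q | i ∈ x q}.indicator (fun q => q.1 i) q := by
    intro q
    rw [← Finset.sum_subset (Finset.subset_univ (x q))]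
    · refine Finset.sum_congr rfl fun i hi => ?_
      rw [Set.indicator_of_mem (by exact hi)]
    · intro i _ hi
      rw [Set.indicator_of_notMem (by exact hi)]
  simp only [h1]
  rw [integral_finsetSum _ fun i _ => (hint i).indicator (measurableSet_mem hx i)]
  exact Finset.sum_congr rfl fun i _ =>
    integral_coordinate_indicator F κ i (hF i) (measurableSet_mem hx i)

theorem value_eq_served {n : ℕ} (F : Fin n → Measure ℝ) [∀ i, IsProbabilityMeasure (F i)]
    (hF : ∀ i, Integrable (fun z => z) (F i)) (A : Algorithm n) :
    ∫ q, ∑ i ∈ A.run q, q.1 i ∂((Measure.pi F).prod A.law) =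
      ∑ i, ∫ z, z ∂(served A F i) := by
  rw [integral_sum_served F hF A.law A.measurable_run]
  refine Finset.sum_congr rfl fun i _ => ?_
  rw [integral_served A F i (hF i), integral_coordinate_indicator F A.law i (hF i)
    (measurableSet_mem A.measurable_run i)]
  rfl

namespace Scheme

variable {P : Scheme} (hP : P.Valid) {n : ℕ} {vmax : ℝ} (S : Setting n vmax) (A : Algorithm n)

variable (P) in
theorem measurable_outAlloc : Measurable fun q : Profile n × (P.reduction n).Tape A =>
    (P.reduction n).outAlloc S A q.1 q.2 := by
  simp only [outAlloc_eq]
  exact ((P.measurable_lottery S A).comp measurable_snd).comp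
    (P.measurePreserving_execution S A 0).measurable

theorem interim_le_one (i : Fin n) (z : ℝ) : interim P S A i z ≤ 1 := by
  rw [← interimAlloc_eq]
  exact measureReal_le_one

theorem interim_nonneg (i : Fin n) (z : ℝ) : 0 ≤ interim P S A i z :=
  integral_nonneg fun _ => ENNReal.toReal_nonneg

theorem poolMean_nonneg (i : Fin n) (z : ℝ) : 0 ≤ poolMean P S A i z :=
  integral_nonneg fun _ => GridPrior.avgAlloc_nonneg _ _

section Cost

variable (hS : ∀ j, ∀ᵐ v ∂S.prior j, v ∈ Set.Ico (P.val 0) (P.val P.J))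

include hP hS in
/-- The expected cost does not increase. -/
theorem lintegral_cost_le :
    ∫⁻ q, S.cost ((P.reduction n).outAlloc S A q.1 q.2)
        ∂(S.joint.prod ((P.reduction n).tapeLaw A)) ≤
      ∫⁻ q, S.cost (A.run q) ∂(S.joint.prod A.law) := by
  have hc : Measurable S.cost := .of_discrete
  have hmp := P.measurePreserving_execution S A 0
  have hm : Measurable fun q : unitInterval × unitInterval × Profile n × P.Tables n ×
      (Fin n → unitInterval) × A.Coins =>
      S.cost (P.lottery S A q.2.1 q.2.2.1 q.2.2.2.1 q.2.2.2.2) :=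
    hc.comp ((P.measurable_lottery S A).comp measurable_snd)
  simp only [outAlloc_eq]
  refine (hmp.lintegral_comp hm).le.trans ?_
  -- For each test coin the sampled profile follows the product prior, so the run costs as much as
  -- the algorithm in expectation; discarding its allocation can only lower the cost because the
  -- empty set is free.
  have key : ∀ s, ∫⁻ q, S.cost (P.lottery S A s q.1 q.2.1 q.2.2) ∂(P.runLaw S A) ≤
      ∫⁻ q, S.cost (A.run q) ∂(S.joint.prod A.law) := by
    intro s
    have hf := P.measurePreserving_final S A s (β := fun _ => id) fun _ => measurable_id
    have hl : (fun j => P.answerLawOf S A s j id) = answerLaw S.prior :=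
      funext fun j => answerLawOf_id hP S A hS s j
    rw [hl] at hf
    have h1 := lintegral_cost_answers A S.prior S.cost
    have hcm : Measurable fun q : Draws n × A.Coins => S.cost (roundAlloc A q.1 q.2) :=
      hc.comp (measurable_roundAlloc A)
    rw [Setting.joint, ← h1, ← hf.lintegral_comp hcm]
    refine lintegral_mono fun q => ?_
    simp only [lottery]
    split_ifs
    · exact le_rfl
    · rw [S.cost_empty]
      exact zero_le
  rw [lintegral_prod _ hm.aemeasurable]
  calc _ ≤ ∫⁻ _ : unitInterval, ∫⁻ q, S.cost (A.run q) ∂(S.joint.prod A.law) := by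
        refine lintegral_mono fun u => ?_
        have hmu : Measurable fun q : unitInterval × Profile n × P.Tables n ×
            (Fin n → unitInterval) × A.Coins => S.cost (P.lottery S A q.1 q.2.1 q.2.2.1 q.2.2.2) :=
          hc.comp (P.measurable_lottery S A)
        simp only
        rw [lintegral_prod _ hmu.aemeasurable]
        calc _ ≤ ∫⁻ _ : unitInterval, ∫⁻ q, S.cost (A.run q) ∂(S.joint.prod A.law) :=
              lintegral_mono fun s => key s
          _ = _ := by simp
    _ = _ := by simp

end Cost

-- Value and cost are compared separately. With probability 1 - ρ nobody is tested and agent i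
-- obtains its pooled value, which is within 161δμ of its value in the algorithm; the other coins
-- contribute nonnegative amounts. Each agent loses at most (ρ + 161δ) μ.
include hP in
theorem welfare_ge {μ ε : ℝ} (hG : ∀ i, GridPrior (S.prior i) (served A S.prior i)
    P.val P.J (16 * P.δ) μ) (hδ : 0 < P.δ) (hδ1 : P.δ ≤ 1 / 100) (hμ : 0 ≤ μ)
    (hexp : n ≠ 0 → Real.exp (-2 * P.M * P.δ ^ 2) *
      ((P.J + 1) * P.M) ≤ P.ρ / (n * P.J) / 4)
    (hacc : ∀ i : Fin n, (P.tableLaw S A i).real {ω : Table P.J P.M |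
      ¬ ω.Accurate (fun a b => avgAlloc (S.prior i) (served A S.prior i) P.val a b)
      (fun a b => relMass (S.prior i) P.val P.J a b) P.δ (16 * P.δ / P.J)} ≤ P.δ)
    (hε : n * (P.ρ + 161 * P.δ) ≤ ε) :
    A.welfare S - ((ε * μ : ℝ) : EReal) ≤ (P.reduction n).welfare S A := by
  have hS : ∀ j, ∀ᵐ v ∂S.prior j, v ∈ Set.Ico (P.val 0) (P.val P.J) := fun j => by
    rw [hP.val_zero]
    exact (hG j).supp
  have hF := fun i => (hG i).integrable_id
  have hvalue : ∫ q, ∑ i ∈ A.run q, q.1 i ∂(S.joint.prod A.law) - ε * μ ≤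
      ∫ q, ∑ i ∈ (P.reduction n).outAlloc S A q.1 q.2, q.1 i
        ∂(S.joint.prod ((P.reduction n).tapeLaw A)) := by
    have hprob : IsProbabilityMeasure ((P.reduction n).tapeLaw A) := by
      unfold Reduction.tapeLaw
      infer_instance
    rw [Setting.joint, value_eq_served S.prior hF A,
      integral_sum_served S.prior hF _ (measurable_outAlloc P S A)]
    have hi : ∀ i : Fin n, ∫ z, z ∂(served A S.prior i) - (P.ρ + 161 * P.δ) * μ ≤
        ∫ z, z * ((Measure.pi S.prior).prod ((P.reduction n).tapeLaw A)).real
          {q | i ∈ (P.reduction n).outAlloc S A (Function.update q.1 i z) q.2} ∂(S.prior i) := by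
      intro i
      have hn0 : n ≠ 0 := i.pos.ne'
      have h1 : ∀ z, ((Measure.pi S.prior).prod ((P.reduction n).tapeLaw A)).real
          {q | i ∈ (P.reduction n).outAlloc S A (Function.update q.1 i z) q.2} =
          interim P S A i z := fun z => interimAlloc_eq S A i z
      simp only [h1]
      have h2 := (hG i).expected_value_ge
        (isLaw_sampleLaw (M := P.M) A S.prior i hS hP.mono.monotone) hδ hδ1 hμ hP.J_pos (hacc i)
      have h3 : Integrable (fun z => z * interim P S A i z) (S.prior i) := by
        refine (hF i).mul_bdd (c := 1)
          (monotone_interim hP S A i hG hδ.le (hexp hn0)).measurable.aestronglyMeasurable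
          (Filter.Eventually.of_forall fun z => ?_)
        rw [Real.norm_of_nonneg (interim_nonneg S A i z)]
        exact interim_le_one S A i z
      have h4 : ∫ z, z * ((1 - P.ρ) * poolMean P S A i z) ∂(S.prior i) ≤
          ∫ z, z * interim P S A i z ∂(S.prior i) := by
        refine integral_mono_of_nonneg ?_ h3 ?_
        · filter_upwards [(hG i).supp] with z hz
          exact mul_nonneg hz.1 (mul_nonneg (sub_nonneg.2 hP.ρ_le_one) (poolMean_nonneg S A i z))
        · filter_upwards [(hG i).supp] with z hz
          refine mul_le_mul_of_nonneg_left ?_ hz.1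
          rw [interim_eq hP S A hS]
          have e1 : 0 ≤ ∫ s in (P.regular ∪ P.block n i)ᶜ, (serveMass P S A i 0 s).toReal :=
            integral_nonneg fun _ => ENNReal.toReal_nonneg
          have e2 : 0 ≤ P.ρ * P.height z / n * poolMean P S A i z :=
            mul_nonneg (div_nonneg (mul_nonneg hP.ρ_pos.le (height_nonneg z)) (Nat.cast_nonneg _))
              (poolMean_nonneg S A i z)
          linarith
      have h5 : ∫ z, z * ((1 - P.ρ) * poolMean P S A i z) ∂(S.prior i) =
          (1 - P.ρ) * ∫ z, z * poolMean P S A i z ∂(S.prior i) := by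
        rw [← integral_const_mul]
        refine integral_congr_ae (Filter.Eventually.of_forall fun z => ?_)
        simp only
        ring
      have h6 : ∫ z, z ∂(served A S.prior i) ≤ μ :=
        (integral_mono_measure (hG i).le (by filter_upwards [(hG i).supp] with z hz using hz.1)
          (hF i)).trans (hG i).mean
      have h7 : ∫ z, z ∂(served A S.prior i) - 161 * P.δ * μ ≤
        ∫ z, z * poolMean P S A i z ∂(S.prior i) := h2
      have h8 := mul_le_mul_of_nonneg_left h7 (sub_nonneg.2 hP.ρ_le_one)
      have h9 := mul_le_mul_of_nonneg_left h6 hP.ρ_pos.le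
      have h10 : 0 ≤ P.ρ * (161 * P.δ * μ) := by
        have := hP.ρ_pos
        positivity
      rw [h5] at h4
      linarith
    have hsum := Finset.sum_le_sum fun i (_ : i ∈ Finset.univ) => hi i
    rw [Finset.sum_sub_distrib, Finset.sum_const, Finset.card_univ, Fintype.card_fin,
      nsmul_eq_mul] at hsum
    have := mul_le_mul_of_nonneg_right hε hμ
    linarith
  rw [Algorithm.welfare, Reduction.welfare, Setting.expWelfare, Setting.expWelfare]
  -- The finite loss is moved next to the value, since the cost may be infinite.
  rw [sub_eq_add_neg, sub_eq_add_neg, add_right_comm, ← sub_eq_add_neg, ← sub_eq_add_neg,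
    ← EReal.coe_sub]
  refine EReal.sub_le_sub (EReal.coe_le_coe_iff.2 hvalue) ?_
  exact EReal.coe_ennreal_le_coe_ennreal_iff.2 (lintegral_cost_le hP S A hS)

end Scheme

/-! ### The choice of the parameters -/

section Parameters

variable {N J M : ℝ} (hN : 2 ≤ N) (hJ : 250 ≤ J) (hNJ : 125 * N ≤ J)
  (hM : 160000 * N * J * Real.log J ≤ M)
include hJ

theorem exp_le_of_log_le {x : ℝ} (h : 10 * Real.log J ≤ x) : Real.exp (-x) ≤ 1 / J ^ 10 := by
  have hJ0 : 0 < J := by linarith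
  have h1 : Real.log (J ^ 10) = 10 * Real.log J := by
    rw [Real.log_pow]
    norm_num
  rw [Real.exp_neg, ← one_div]
  refine one_div_le_one_div_of_le (by positivity) ?_
  calc J ^ 10 = Real.exp (Real.log (J ^ 10)) := (Real.exp_log (by positivity)).symm
    _ ≤ Real.exp x := Real.exp_le_exp.2 (by linarith)

theorem exp_half_le : Real.exp (-((J + 1) / 2)) ≤ 1 / (128 * J ^ 3) := by
  have hJ0 : 0 < J := by linarith
  rw [Real.exp_neg, ← one_div]
  refine one_div_le_one_div_of_le (by positivity) ?_
  have h1 := Real.pow_div_factorial_le_exp (J / 2) (by positivity) 6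
  have h2 : Real.exp (J / 2) ≤ Real.exp ((J + 1) / 2) := Real.exp_le_exp.2 (by linarith)
  refine le_trans ?_ (h1.trans h2)
  have h3 : (250 : ℝ) ^ 3 ≤ J ^ 3 := by gcongr
  have h4 : (J / 2) ^ 6 / (Nat.factorial 6 : ℝ) = J ^ 3 * J ^ 3 / 46080 := by
    norm_num [Nat.factorial]
    ring
  rw [h4, le_div_iff₀ (by norm_num)]
  have h5 : 0 ≤ J ^ 3 := by positivity
  nlinarith

theorem log_ge_one : 1 ≤ Real.log J := by
  rw [Real.le_log_iff_exp_le (by linarith)]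
  linarith [Real.exp_one_lt_d9]

include hN hNJ hM

theorem exp_frequency_le : Real.exp (-2 * M * (1 / (2000 * N)) ^ 2) ≤ 1 / J ^ 10 := by
  have hl := log_ge_one hJ
  rw [show -2 * M * (1 / (2000 * N)) ^ 2 = -(2 * M * (1 / (2000 * N)) ^ 2) by ring]
  refine exp_le_of_log_le hJ ?_
  -- Since J ≥ 125 N and 160000 · 125 = 20000000, the exponent is at least 2 · 20000000 / 2000 ^ 2 =
  -- 10 times log J.
  have h1 : 20000000 * N ^ 2 * Real.log J ≤ M := by
    refine le_trans ?_ hM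
    have : 0 ≤ N * Real.log J := by positivity
    nlinarith [mul_le_mul_of_nonneg_right hNJ this]
  rw [div_pow, one_pow, mul_one_div, le_div_iff₀ (by positivity)]
  nlinarith

omit hNJ in
theorem exp_miss_le : Real.exp (-(16 * (1 / (2000 * N)) / J * M)) ≤ 1 / J ^ 10 := by
  have hl := log_ge_one hJ
  refine exp_le_of_log_le hJ ?_
  have hJ0 : 0 < J := by linarith
  have h : 16 * (1 / (2000 * N)) / J * M = 16 * M / (2000 * N * J) := by
    field_simp
  rw [h, le_div_iff₀ (by positivity)]
  have : 0 ≤ N * J * Real.log J := by positivity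
  nlinarith

theorem accuracy_bound :
    (J + 1) ^ 2 * (6 * Real.exp (-2 * M * (1 / (2000 * N)) ^ 2) +
      (J + 1) * Real.exp (-(16 * (1 / (2000 * N)) / J * M)) + 2 * Real.exp (-((J + 1) / 2))) ≤
      1 / (2000 * N) := by
  have hJ0 : 0 < J := by linarith
  have h1 := exp_frequency_le hN hJ hNJ hM
  have h2 := exp_miss_le hN hJ hM
  have h3 := exp_half_le hJ
  have h4 : 1 / J ^ 10 ≤ 1 / (1000 * J ^ 4) := by
    refine one_div_le_one_div_of_le (by positivity) ?_
    have : (250 : ℝ) ^ 6 ≤ J ^ 6 := by gcongr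
    have h0 : 0 ≤ J ^ 4 := by positivity
    nlinarith [mul_le_mul_of_nonneg_right this h0]
  have h5 : (J + 1) ^ 2 ≤ 2 * J ^ 2 := by nlinarith
  have h6 : J + 1 ≤ 2 * J := by linarith
  calc _ ≤ (2 * J ^ 2) * (6 * (1 / (1000 * J ^ 4)) + (2 * J) * (1 / (1000 * J ^ 4)) +
        2 * (1 / (128 * J ^ 3))) := by
        gcongr
        · exact h1.trans h4
        · exact h2.trans h4
    _ = (12 / (1000 * J) + 4 / 1000 + 4 / 128) / J := by
        field_simp
        ring
    _ ≤ (12 / (1000 * 250) + 4 / 1000 + 4 / 128) / J := by gcongr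
    _ ≤ (1 / 16) / J := by gcongr; norm_num
    _ ≤ 1 / (2000 * N) := by
        rw [div_div, div_le_div_iff₀ (by positivity) (by positivity)]
        linarith

theorem failure_bound (hM2 : M ≤ 160001 * N * J * Real.log J) {n : ℝ} (hn : 1 ≤ n) (hnN : n ≤ N) :
    Real.exp (-2 * M * (1 / (2000 * N)) ^ 2) * ((J + 1) * M) ≤ 1 / (2 * N) / (n * J) / 4 := by
  have hJ0 : 0 < J := by linarith
  have hl := log_ge_one hJ
  have hlJ : Real.log J ≤ J := (Real.log_le_sub_one_of_pos hJ0).trans (by linarith)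
  have h1 := exp_frequency_le hN hJ hNJ hM
  have h2 : M ≤ 1281 * J ^ 3 := by
    calc M ≤ 160001 * N * J * Real.log J := hM2
      _ ≤ 160001 * (J / 125) * J * J := by gcongr; linarith
      _ ≤ 1281 * J ^ 3 := by
        have : 0 ≤ J ^ 3 := by positivity
        nlinarith
  have hM0 : 0 ≤ M := le_trans (by positivity) hM
  have h3 : 1 / (8 * J ^ 3) ≤ 1 / (2 * N) / (n * J) / 4 := by
    rw [div_div, div_div]
    refine one_div_le_one_div_of_le (by positivity) ?_
    have h : N * n ≤ J * J := by
      refine mul_le_mul ?_ ?_ (by linarith) hJ0.le <;> linarith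
    nlinarith [mul_le_mul_of_nonneg_right h hJ0.le]
  refine le_trans ?_ h3
  calc _ ≤ (1 / J ^ 10) * ((2 * J) * (1281 * J ^ 3)) := by
        gcongr
        linarith
    _ = 2562 / J ^ 6 := by field_simp; ring
    _ ≤ 1 / (8 * J ^ 3) := by
        rw [div_le_div_iff₀ (by positivity) (by positivity)]
        have : (250 : ℝ) ^ 3 ≤ J ^ 3 := by gcongr
        have h0 : 0 ≤ J ^ 3 := by positivity
        nlinarith

end Parameters

/-- The number of grid points. -/
def gridSize (N r : ℝ) : ℕ := ⌈125 * N⌉₊ * (⌈Real.log (1 + r) / Real.log 2⌉₊ + 1)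

section GridSize

variable {N r : ℝ} (hN : 2 ≤ N)

theorem le_gridSize : 125 * N ≤ gridSize N r := by
  rw [gridSize, Nat.cast_mul]
  have h1 := Nat.le_ceil (125 * N)
  refine h1.trans (le_mul_of_one_le_right (Nat.cast_nonneg _) ?_)
  push_cast
  have : (0 : ℝ) ≤ (⌈Real.log (1 + r) / Real.log 2⌉₊ : ℝ) := Nat.cast_nonneg _
  linarith

include hN

theorem gridSize_le {L : ℝ} (hL : Real.log 2 ≤ L) (hr : Real.log (1 + r) ≤ L) (hr1 : 1 ≤ r) :
    gridSize N r ≤ 630 * (N * L) := by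
  have hl2 := Real.log_two_gt_d9
  have h1 := (Nat.ceil_lt_add_one (show 0 ≤ 125 * N by positivity)).le
  have h0 : 0 ≤ Real.log (1 + r) / Real.log 2 :=
    div_nonneg (Real.log_nonneg (by linarith)) (by linarith)
  have h2 := (Nat.ceil_lt_add_one h0).le
  have h3 : Real.log (1 + r) / Real.log 2 ≤ L / Real.log 2 := by gcongr
  have h4 : 3 * (L / Real.log 2) ≤ 5 * L := by
    rw [mul_div_assoc', div_le_iff₀ (by linarith)]
    nlinarith
  have h5 : 1 ≤ L / Real.log 2 := (one_le_div (by linarith)).2 hL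
  rw [gridSize, Nat.cast_mul]
  push_cast
  calc (⌈125 * N⌉₊ : ℝ) * ((⌈Real.log (1 + r) / Real.log 2⌉₊ : ℝ) + 1)
      ≤ (126 * N) * (5 * L) := by
        refine mul_le_mul (by linarith) (by linarith) (by positivity) (by positivity)
    _ = _ := by ring

theorem lt_pow_gridSize (hr : 1 ≤ r) : 1 + r < (1 + 16 * (1 / (2000 * N))) ^ gridSize N r := by
  have hd : 0 < 16 * (1 / (2000 * N)) := by positivity
  -- By Bernoulli's inequality ⌈125 N⌉ steps double the power, because the step is 16 / (2000 N) = 1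
  -- / (125 N).
  have h1 : 2 ≤ (1 + 16 * (1 / (2000 * N))) ^ ⌈125 * N⌉₊ := by
    have hb := one_add_mul_le_pow (show (-2 : ℝ) ≤ 16 * (1 / (2000 * N)) by linarith) ⌈125 * N⌉₊
    have hc := mul_le_mul_of_nonneg_right (Nat.le_ceil (125 * N)) hd.le
    have he : 125 * N * (16 * (1 / (2000 * N))) = 1 := by
      field_simp
      norm_num
    linarith
  have hl2 : 0 < Real.log 2 := Real.log_pos (by norm_num)
  set k := ⌈Real.log (1 + r) / Real.log 2⌉₊
  have h2 : 1 + r < 2 ^ (k + 1) := by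
    rw [← Real.log_lt_log_iff (by linarith) (by positivity), Real.log_pow, ← div_lt_iff₀ hl2]
    push_cast
    exact lt_of_le_of_lt (Nat.le_ceil _) (lt_add_one _)
  rw [gridSize, pow_mul]
  exact h2.trans_le (pow_le_pow_left₀ (by norm_num) h1 _)

end GridSize

/-- With J of order nEL and M of order nE J log J, the count n J^2 M is of order n^5 E^4 L^3 log J.
The exponent of E is rounded up to 5, and log J ≤ 4 log f because J ≤ 630 f ≤ f^4. -/
theorem calls_le {n E L J M : ℝ} (hn : 1 ≤ n) (hE : 2 ≤ E) (hL : Real.log 2 ≤ L) (hJ : 250 ≤ J)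
    (hJ2 : J ≤ 630 * (n * E * L)) (hM0 : 0 ≤ M) (hM : M ≤ 160001 * (n * E) * J * Real.log J) :
    10 ≤ n ^ 5 * E ^ 5 * L ^ 3 ∧ n * ((J + 1) ^ 2 * 5 * M) + (n + 1) ≤
      10 ^ 20 * (n ^ 5 * E ^ 5 * L ^ 3) * Real.log (n ^ 5 * E ^ 5 * L ^ 3) := by
  have hl2 := Real.log_two_gt_d9
  have hL0 : 0.69 ≤ L := by linarith
  have hlJ := log_ge_one hJ
  have hL2 : 0.47 ≤ L ^ 2 := by nlinarith
  have hE4 : (2 : ℝ) ^ 4 ≤ E ^ 4 := by gcongr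
  have hn4 : (1 : ℝ) ≤ n ^ 4 := one_le_pow₀ hn
  set f := n ^ 5 * E ^ 5 * L ^ 3 with hf
  have hfe : f = (n * E * L) * (n ^ 4 * (E ^ 4 * L ^ 2)) := by rw [hf]; ring
  have h1 : 7.5 ≤ n ^ 4 * (E ^ 4 * L ^ 2) := by
    have : 7.5 ≤ E ^ 4 * L ^ 2 := by nlinarith
    nlinarith
  have h2 : 1.38 ≤ n * E * L := by
    have : 2 ≤ n * E := by nlinarith
    nlinarith
  have hf1 : n * E * L ≤ f := by
    rw [hfe]
    nlinarith
  have hf10 : 10 ≤ f := by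
    rw [hfe]
    nlinarith
  have hlogJ : Real.log J ≤ 4 * Real.log f := by
    rw [show (4 : ℝ) * Real.log f = Real.log (f ^ 4) by rw [Real.log_pow]; norm_num]
    refine Real.log_le_log (by linarith) ?_
    have h3 : (10 : ℝ) ^ 3 ≤ f ^ 3 := by gcongr
    have : f ^ 4 = f ^ 3 * f := by ring
    nlinarith
  refine ⟨hf10, ?_⟩
  have hnE : 0 ≤ n * E := by positivity
  have hJ0 : 0 ≤ J := by linarith
  have hJsq : (J + 1) ^ 2 ≤ 2 * J ^ 2 := by nlinarith
  have hone : n + 1 ≤ n * J ^ 3 * (n * E) * Real.log J := by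
    have e1 : 2 ≤ J ^ 3 := by
      have : (250 : ℝ) ^ 3 ≤ J ^ 3 := by gcongr
      linarith
    have e2 : 1 ≤ n * E := by nlinarith
    calc n + 1 ≤ n * 2 * 1 * 1 := by linarith
      _ ≤ _ := by gcongr
  have hmain : n * ((J + 1) ^ 2 * 5 * M) ≤ 1600010 * (n * J ^ 3 * (n * E) * Real.log J) := by
    calc n * ((J + 1) ^ 2 * 5 * M)
        ≤ n * (2 * J ^ 2 * 5 * (160001 * (n * E) * J * Real.log J)) := by gcongr
      _ = _ := by ring
  have hcube : n * J ^ 3 * (n * E) ≤ 630 ^ 3 * f := by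
    calc n * J ^ 3 * (n * E) ≤ n * (630 * (n * E * L)) ^ 3 * (n * E) := by gcongr
      _ = 630 ^ 3 * (n ^ 5 * E ^ 4 * L ^ 3) := by ring
      _ ≤ 630 ^ 3 * (n ^ 5 * E ^ 5 * L ^ 3) := by
        gcongr
        · linarith
        · norm_num
  have hlf : 0 ≤ Real.log f := Real.log_nonneg (by linarith)
  calc n * ((J + 1) ^ 2 * 5 * M) + (n + 1)
      ≤ 1600011 * ((n * J ^ 3 * (n * E)) * Real.log J) := by linarith
    _ ≤ 1600011 * ((630 ^ 3 * f) * (4 * Real.log f)) := by gcongr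
    _ ≤ 10 ^ 20 * f * Real.log f := by
      have : 0 ≤ f * Real.log f := by positivity
      nlinarith

/-- The reduction for at least one agent. -/
theorem exists_reduction {n : ℕ} (hn : 0 < n) {vmax μ e : ℝ} (hμ : 0 < μ) (hv : μ ≤ vmax)
    (he : 0 < e) (he2 : e ≤ 1 / 2) :
    ∃ R : Reduction n,
      (10 ≤ (n : ℝ) ^ 5 * e⁻¹ ^ 5 * Real.log (vmax / (e * μ)) ^ 3 ∧
      (R.calls : ℝ) ≤ 10 ^ 20 * ((n : ℝ) ^ 5 * e⁻¹ ^ 5 * Real.log (vmax / (e * μ)) ^ 3) *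
        Real.log ((n : ℝ) ^ 5 * e⁻¹ ^ 5 * Real.log (vmax / (e * μ)) ^ 3)) ∧
      ∀ S : Setting n vmax, S.muMax = μ → ∀ A : Algorithm n,
        R.IsBIC S A ∧ R.IsNormalized S A ∧ A.welfare S - ((e * μ : ℝ) : EReal) ≤ R.welfare S A := by
  have hn1 : (1 : ℝ) ≤ n := by exact_mod_cast hn
  have hE : 2 ≤ e⁻¹ := by
    rw [le_inv_comm₀ (by norm_num) he]
    linarith
  set N : ℝ := n * e⁻¹ with hNdef
  have hN : 2 ≤ N := by nlinarith
  have hnN : (n : ℝ) ≤ N := by nlinarith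
  have hr1 : 1 ≤ vmax / μ := (one_le_div hμ).2 hv
  have hratio : vmax / (e * μ) = e⁻¹ * (vmax / μ) := by field_simp
  set L : ℝ := Real.log (vmax / (e * μ)) with hLdef
  have hL : Real.log 2 ≤ L := by
    rw [hLdef, hratio]
    exact Real.log_le_log (by norm_num) (by nlinarith)
  have hrL : Real.log (1 + vmax / μ) ≤ L := by
    rw [hLdef, hratio]
    exact Real.log_le_log (by linarith) (by nlinarith)
  set J : ℕ := gridSize N (vmax / μ) with hJdef
  have hNJ : 125 * N ≤ J := le_gridSize
  have hJ : (250 : ℝ) ≤ J := by linarith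
  have hJL := gridSize_le hN hL hrL hr1
  have hlJ := log_ge_one hJ
  set M : ℕ := ⌈160000 * N * J * Real.log J⌉₊ with hMdef
  have hM : 160000 * N * J * Real.log J ≤ M := Nat.le_ceil _
  have hM2 : (M : ℝ) ≤ 160001 * N * J * Real.log J := by
    have h1 := (Nat.ceil_lt_add_one (show 0 ≤ 160000 * N * J * Real.log J by positivity)).le
    have h2 : 1 ≤ N * J * Real.log J := by
      have : 1 ≤ N * J := by nlinarith
      nlinarith
    linarith
  have hM0 : 0 < M := by
    have : (0 : ℝ) < M := lt_of_lt_of_le (by positivity) hM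
    exact_mod_cast this
  -- The grid satisfies val (j + 1) = (1 + d) val j + d μ with d = 16δ: relative precision for large
  -- values, absolute precision of order d μ near 0.
  let P : Scheme := ⟨J, M, fun j => μ * ((1 + 16 * (1 / (2000 * N))) ^ j - 1), 1 / (2000 * N),
    1 / (2 * N)⟩
  have hd : 0 < 16 * (1 / (2000 * N)) := by positivity
  have hP : P.Valid :=
    { J_pos := by
        have : (0 : ℝ) < J := by linarith
        exact_mod_cast this
      M_pos := hM0
      mono := by
        refine strictMono_nat_of_lt_succ fun j => ?_
        have h1 : (1 + 16 * (1 / (2000 * N))) ^ j < (1 + 16 * (1 / (2000 * N))) ^ (j + 1) :=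
          pow_lt_pow_right₀ (by linarith) (Nat.lt_succ_self j)
        exact mul_lt_mul_of_pos_left (sub_lt_sub_right h1 1) hμ
      val_zero := by simp [P]
      ρ_pos := by positivity
      ρ_le_one := by
        refine (div_le_one (by positivity)).2 ?_
        linarith }
  have hδ : 0 < P.δ := by positivity
  have hvJ : vmax < P.val P.J := by
    have h1 := lt_pow_gridSize hN hr1
    have h2 : vmax / μ < (1 + 16 * (1 / (2000 * N))) ^ J - 1 := by linarith
    calc vmax = μ * (vmax / μ) := by field_simp
      _ < _ := mul_lt_mul_of_pos_left h2 hμ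
  have hexp : Real.exp (-2 * P.M * P.δ ^ 2) * ((P.J + 1) * P.M) ≤ P.ρ / (n * P.J) / 4 :=
    failure_bound hN hJ hNJ hM hM2 hn1 hnN
  refine ⟨P.reduction n, ?_, fun S hSμ A => ?_⟩
  · have hJ2 : (J : ℝ) ≤ 630 * (n * e⁻¹ * L) := hJL
    obtain ⟨h1, h2⟩ := calls_le hn1 hE hL hJ hJ2 (Nat.cast_nonneg _) hM2
    refine ⟨h1, le_trans (le_of_eq ?_) h2⟩
    simp only [Scheme.reduction, Scheme.samples, RoundIdx, Fintype.card_prod, Fintype.card_fin, P]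
    push_cast
    ring
  · have hG : ∀ i, GridPrior (S.prior i) (served A S.prior i) P.val P.J (16 * P.δ) μ := fun i =>
      { prob := inferInstance
        le := served_le A S.prior i
        supp := by
          filter_upwards [S.prior_support i] with v hv
          exact ⟨hv.1, hv.2.trans_lt hvJ⟩
        val_zero := hP.val_zero
        mono := hP.mono
        step := fun j => by
          simp only [P]
          rw [pow_succ]
          apply le_of_eq
          ring
        mean := by
          rw [← hSμ]
          exact le_ciSup (f := fun i => ∫ v, v ∂S.prior i) (Set.finite_range _).bddAbove i }
    have hS : ∀ j, ∀ᵐ v ∂S.prior j, v ∈ Set.Ico (P.val 0) (P.val P.J) := fun j => by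
      rw [hP.val_zero]
      exact (hG j).supp
    refine ⟨Scheme.isBIC_of_monotone S A fun i =>
      (Scheme.monotone_interim hP S A i hG hδ.le hexp).monotoneOn _,
      Scheme.isNormalized S A, Scheme.welfare_ge hP S A hG hδ ?_ hμ.le (fun _ => hexp)
      (fun i => ?_) ?_⟩
    · refine one_div_le_one_div_of_le (by norm_num) ?_
      linarith
    · refine (Table.real_not_accurate_le (isLaw_sampleLaw (M := P.M) A S.prior i hS
        hP.mono.monotone) hP.M_pos hδ.le
        (fun a b => (hG i).relMass_le_one (Nat.lt_succ_iff.1 b.2))).trans ?_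
      exact accuracy_bound hN hJ hNJ hM
    · have h1 : (n : ℝ) = N * e := by
        rw [hNdef]
        field_simp
      simp only [P]
      rw [h1]
      -- The tests take half of the allowed loss, and 161 / 2000 of it pays for pooling.
      have h2 : N * e * (1 / (2 * N) + 161 * (1 / (2000 * N))) = e * (1 / 2 + 161 / 2000) := by
        field_simp
      rw [h2]
      nlinarith

/-- The reduction for no agents. -/
def emptyReduction (n : ℕ) : Reduction n where
  Seed := Unit
  seedLaw := Measure.dirac ()
  calls := 0
  window _ _ _ := 0
  query _ _ := 0
  alloc _ := ∅
  pay _ := 0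
  measurable_window _ := measurable_const
  measurable_query _ := measurable_const
  measurable_alloc := measurable_const
  measurable_pay := measurable_const

/-- A single reduction meets both bounds, because n^4 E^4 L^2 ≥ 1 lifts the smaller scale to the
larger one. Capping ε at 1 / 2 only strengthens the guarantee. -/
theorem exists_reduction_softO (n : ℕ) (vmax μ ε : ℝ) (hμ : 0 < μ) (hv : μ ≤ vmax) (hε : 0 < ε) :
    ∃ R : Reduction n,
      (R.calls : ℝ) ≤ softO (10 ^ 20) 1 (runtimeScale 9 9 5 n ε vmax μ) ∧
      (R.calls : ℝ) ≤ softO (10 ^ 20) 1 (runtimeScale 5 5 3 n ε vmax μ) ∧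
      ∀ S : Setting n vmax, S.muMax = μ → ∀ A : Algorithm n,
        R.IsBIC S A ∧ R.IsNormalized S A ∧
          A.welfare S - ((ε * μ : ℝ) : EReal) ≤ R.welfare S A := by
  rcases Nat.eq_zero_or_pos n with rfl | hn
  · refine ⟨emptyReduction 0, by simp [emptyReduction, softO, runtimeScale],
      by simp [emptyReduction, softO, runtimeScale], fun S hS => ?_⟩
    -- Without agents the largest mean is an empty supremum, that is 0, which μ > 0 excludes.
    rw [Setting.muMax, Real.iSup_of_isEmpty] at hS
    exact absurd hS hμ.ne
  have he : 0 < min ε (1 / 2) := lt_min hε (by norm_num)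
  obtain ⟨R, ⟨h10, hcalls⟩, hR⟩ := exists_reduction hn hμ hv he (min_le_right _ _)
  refine ⟨R, ?_, ?_, fun S hS A => ?_⟩
  · set E := (min ε (1 / 2))⁻¹ with hEdef
    set L := Real.log (vmax / (min ε (1 / 2) * μ)) with hLdef
    have hE : 2 ≤ E := by
      rw [hEdef, le_inv_comm₀ (by norm_num) he]
      exact (min_le_right _ _).trans (by norm_num)
    have hL : Real.log 2 ≤ L := by
      refine Real.log_le_log (by norm_num) ?_
      have h1 : vmax / (min ε (1 / 2) * μ) = E * (vmax / μ) := by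
        rw [hEdef]
        field_simp
      have h2 : 1 ≤ vmax / μ := (one_le_div hμ).2 hv
      rw [h1]
      nlinarith
    have hl2 := Real.log_two_gt_d9
    have hn1 : (1 : ℝ) ≤ n := by exact_mod_cast hn
    have hn4 : (1 : ℝ) ≤ (n : ℝ) ^ 4 := one_le_pow₀ hn1
    have hE4 : (2 : ℝ) ^ 4 ≤ E ^ 4 := by gcongr
    have hL2 : 0.47 ≤ L ^ 2 := by nlinarith
    have hEL : 1 ≤ E ^ 4 * L ^ 2 := by nlinarith
    have hone : 1 ≤ (n : ℝ) ^ 4 * (E ^ 4 * L ^ 2) := by nlinarith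
    have hle : (n : ℝ) ^ 5 * E ^ 5 * L ^ 3 ≤ runtimeScale 9 9 5 n ε vmax μ := by
      have : runtimeScale 9 9 5 n ε vmax μ =
          ((n : ℝ) ^ 5 * E ^ 5 * L ^ 3) * ((n : ℝ) ^ 4 * (E ^ 4 * L ^ 2)) := by
        rw [runtimeScale, ← hEdef, ← hLdef]
        ring
      rw [this]
      exact le_mul_of_one_le_right (by linarith) hone
    have hlog := Real.log_le_log (by linarith) hle
    have h0 : 0 ≤ Real.log ((n : ℝ) ^ 5 * E ^ 5 * L ^ 3) := Real.log_nonneg (by linarith)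
    rw [softO, pow_one]
    refine hcalls.trans ?_
    gcongr
    linarith
  · rw [softO, pow_one]
    exact hcalls
  · obtain ⟨h1, h2, h3⟩ := hR S hS A
    refine ⟨h1, h2, le_trans (EReal.sub_le_sub le_rfl ?_) h3⟩
    exact EReal.coe_le_coe_iff.2 (mul_le_mul_of_nonneg_right (min_le_left _ _) hμ.le)

end BlackBox

end

theorem mainTheorem1 :
    (∃ (C : ℝ) (p : ℕ), ∀ (n : ℕ) (vmax μ ε : ℝ), 0 < μ → μ ≤ vmax → 0 < ε →
      ∃ R : BlackBox.Reduction n,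
        (R.calls : ℝ) ≤ BlackBox.softO C p (BlackBox.runtimeScale 9 9 5 n ε vmax μ) ∧
        ∀ S : BlackBox.Setting n vmax, S.muMax = μ → ∀ A : BlackBox.Algorithm n,
          R.IsBIC S A ∧ R.IsNormalized S A ∧
          A.welfare S - ((ε * μ : ℝ) : EReal) ≤ R.welfare S A) ∧
    (∃ (C : ℝ) (p : ℕ), ∀ (n : ℕ) (vmax μ ε : ℝ), 0 < μ → μ ≤ vmax → 0 < ε →
      ∃ R : BlackBox.Reduction n,
        (R.calls : ℝ) ≤ BlackBox.softO C p (BlackBox.runtimeScale 5 5 3 n ε vmax μ) ∧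
        ∀ S : BlackBox.Setting n vmax, S.IsFeasibility → S.muMax = μ →
          ∀ A : BlackBox.Algorithm n,
          R.IsBIC S A ∧ R.IsNormalized S A ∧
          A.welfare S - ((ε * μ : ℝ) : EReal) ≤ R.welfare S A) := by
  refine ⟨⟨10 ^ 20, 1, fun n vmax μ ε hμ hv hε => ?_⟩,
    ⟨10 ^ 20, 1, fun n vmax μ ε hμ hv hε => ?_⟩⟩
  · obtain ⟨R, h1, _, h2⟩ := BlackBox.exists_reduction_softO n vmax μ ε hμ hv hε
    exact ⟨R, h1, h2⟩
  · obtain ⟨R, _, h1, h2⟩ := BlackBox.exists_reduction_softO n vmax μ ε hμ hv hε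
    exact ⟨R, h1, fun S _ => h2 S⟩
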